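/- Let $R$ be a commutative Noetherian ring and $\Lambda$ an $R$-algebra that is finitely generated as an $R$-module; all modules are left modules. *Notation.* For a ring $A$, let $\mathrm{mod}\,A$ (resp. $\mathrm{Fl}\,A$) be the category of finitely generated (resp. finite length) $A$-modules. For $\mathcal A=\mathrm{mod}\,A$ or $\mathrm{Fl}\,A$, a torsion class of $\mathcal A$ is a subcategory of $\mathcal A$ that contains $0$ and is closed under factor modules and extensions; $\mathrm{tors}\,\mathcal A$ is the set of torsion classes, ordered by inclusion, and $\mathrm{tors}\,A:=\mathrm{tors}(\mathrm{mod}\,A)$. Write $\mathrm{add}\,M$ for the direct summands of finite direct sums of copies of $M$, and $\mathrm{Fac}\,M$ for the factor modules of objects of $\mathrm{add}\,M$. A two-term silting complex of $A$ is an object $P$ of $\mathsf K^{\rm b}(\mathrm{proj}\,A)$ that is isomorphic to a complex concentrated in degrees $-1,0$, satisfies $\mathrm{Hom}(P,P[i])=0$ for all $i>0$, and generates $\mathsf K^{\rm b}(\mathrm{proj}\,A)$ as a thick subcategory. Let $2\text{-silt}\,A$ be the set of two-term silting complexes, where $P$ and $Q$ are identified if $\mathrm{add}\,P=\mathrm{add}\,Q$,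 with the order $Q\le P$ iff $\mathrm{Hom}(P,Q[i])=0$ for all $i>0$. A silting $A$-module is a module isomorphic to $H^0(P)$ for some two-term silting complex $P$, and $$\text{s-tors}(\mathrm{Fl}\,A):=\{\mathrm{Fac}\,M\cap \mathrm{Fl}\,A\mid M\text{ a silting }A\text{-module}\}.$$ For $\mathfrak p\in\mathrm{Spec}\,R$, write $(-)_{\mathfrak p}=R_{\mathfrak p}\otimes_R-$, and $\mathcal C_{\mathfrak p}=\{X_{\mathfrak p}\mid X\in\mathcal C\}$ for a subcategory $\mathcal C$ (closed under isomorphism). For $\mathcal X\in\mathrm{tors}(\mathrm{Fl}\,\Lambda_{\mathfrak p})$ put $\psi_{\mathfrak p}(\mathcal X)=\{X\in\mathrm{mod}\,\Lambda_{\mathfrak p}\mid X/\mathfrak pX\in\mathcal X\}$. A family $(\mathcal X^{\mathfrak p})_{\mathfrak p}\in\prod_{\mathfrak p\in\mathrm{Spec}\,R}\mathrm{tors}(\mathrm{Fl}\,\Lambda_{\mathfrak p})$ is called compatible if $\psi_{\mathfrak p}(\mathcal X^{\mathfrak p})_{\mathfrak q}\cap\mathrm{Fl}\,\Lambda_{\mathfrak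 q}\supseteq\mathcal X^{\mathfrak q}$ for all primes $\mathfrak p\supseteq\mathfrak q$. The pair $(R,\Lambda)$ is called compatible if the image of $$\Phi_{\rm t}\colon \mathrm{tors}\,\Lambda\to\prod_{\mathfrak p\in\mathrm{Spec}\,R}\mathrm{tors}(\mathrm{Fl}\,\Lambda_{\mathfrak p}),\qquad \mathcal T\mapsto(\mathcal T_{\mathfrak p}\cap\mathrm{Fl}\,\Lambda_{\mathfrak p})_{\mathfrak p},$$ is exactly the set of compatible families. Finally, $\mathrm{Spec}\,R$ is ordered by inclusion, and $\mathrm{Hom}_{\rm poset}(X,Y)$ is the set of order-preserving maps $X\to Y$ with the pointwise order. **Theorem.** Assume that $R$ is ring indecomposable (it is not a product of two nonzero rings) and that (a) for every $\mathfrak p\in\mathrm{Spec}\,R$, the map $(-)_{\mathfrak p}\colon 2\text{-silt}\,\Lambda\to 2\text{-silt}\,\Lambda_{\mathfrak p}$, $P\mapsto P_{\mathfrak p}$, is an isomorphism of posets; (b) for every $\mathfrak p\in\mathrm{Spec}\,R$, $\text{s-tors}(\mathrm{Fl}\,\Lambda_{\mathfrak p})=\mathrm{tors}(\mathrm{Fl}\,\Lambda_{\mathfrak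 p})$. Then $(R,\Lambda)$ is compatible, and there is an isomorphism of posets $$\mathrm{tors}\,\Lambda\;\simeq\;\mathrm{Hom}_{\rm poset}(\mathrm{Spec}\,R,\;2\text{-silt}\,\Lambda).$$ -/

import Mathlib

universe u

open CategoryTheory Limits TensorProduct

namespace SiltingTorsion

section AnyRing

variable {A : Type u} [Ring A]

/-- The category `mod A` of finitely generated left `A`-modules. -/
def modFg (A : Type u) [Ring A] : ObjectProperty (ModuleCat.{u} A) :=
  fun X => Module.Finite A X

/-- The category `Fl A` of left `A`-modules of finite length. -/
def modFl (A : Type u) [Ring A] : ObjectProperty (ModuleCat.{u} A) :=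
  fun X => IsFiniteLength A X

/-- `T` is a torsion class of `𝒜`: a subcategory of `𝒜` containing the zero modules and closed
under factor modules and extensions in `𝒜`. -/
structure IsTorsionClass (𝒜 T : ObjectProperty (ModuleCat.{u} A)) : Prop where
  le : T ≤ 𝒜
  zero : ∀ X, IsZero X → T X
  factor : ∀ (X Y : ModuleCat.{u} A) (f : X ⟶ Y), Epi f → T X → 𝒜 Y → T Y
  extension : ∀ S : ShortComplex (ModuleCat.{u} A), S.ShortExact →
    T S.X₁ → T S.X₃ → 𝒜 S.X₂ → T S.X₂

/-- The poset `tors 𝒜` of torsion classes of `𝒜`, ordered by inclusion. -/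
abbrev Tors (𝒜 : ObjectProperty (ModuleCat.{u} A)) : Type (u + 1) :=
  {T : ObjectProperty (ModuleCat.{u} A) // IsTorsionClass 𝒜 T}

/-- `add M`: the direct summands of finite direct sums of copies of `M`, written through the
maps `X ⟶ Mⁿ ⟶ X` with composite the identity. -/
def addOf {C : Type*} [Category* C] [Preadditive C] (M : C) : ObjectProperty C :=
  fun X => ∃ (n : ℕ) (i : Fin n → (X ⟶ M)) (p : Fin n → (M ⟶ X)), ∑ k, i k ≫ p k = 𝟙 X

/-- `Fac M`: the factor modules of modules in `add M`. -/
def fac (M : ModuleCat.{u} A) : ObjectProperty (ModuleCat.{u} A) :=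
  fun X => ∃ (Y : ModuleCat.{u} A) (f : Y ⟶ X), addOf M Y ∧ Epi f

/-- The homotopy category `K(Mod A)` of cochain complexes of left `A`-modules. -/
abbrev KMod (A : Type u) [Ring A] := HomotopyCategory (ModuleCat.{u} A) (ComplexShape.up ℤ)

/-- `K^b(proj A)`, as a full subcategory of `K(Mod A)` closed under isomorphism. -/
def Kbproj (A : Type u) [Ring A] : ObjectProperty (KMod A) := fun X =>
  ∃ K : CochainComplex (ModuleCat.{u} A) ℤ,
    (∀ n, Module.Finite A (K.X n) ∧ Module.Projective A (K.X n)) ∧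
    (∃ a b : ℤ, ∀ n, n < a ∨ b < n → IsZero (K.X n)) ∧
    Nonempty (X ≅ (HomotopyCategory.quotient _ _).obj K)

/-- `Hom(P, Q[i]) = 0` for all `i > 0`. -/
def HomVanish (P Q : KMod A) : Prop := ∀ i : ℤ, 0 < i → ∀ f : P ⟶ Q⟦i⟧, f = 0

/-- `P` is isomorphic in the homotopy category to a complex of finitely generated projective
modules concentrated in degrees `-1` and `0`. -/
def IsTwoTerm (P : KMod A) : Prop :=
  ∃ K : CochainComplex (ModuleCat.{u} A) ℤ,
    (∀ n, Module.Finite A (K.X n) ∧ Module.Projective A (K.X n)) ∧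
    (∀ n, n ≠ -1 → n ≠ 0 → IsZero (K.X n)) ∧
    Nonempty (P ≅ (HomotopyCategory.quotient _ _).obj K)

/-- Two-term silting complexes. `triangEnvelope` is the thick subcategory generated by `P`, the
smallest triangulated subcategory closed under direct summands that contains `P`. -/
structure IsTwoTermSilting (P : KMod A) : Prop where
  twoTerm : IsTwoTerm P
  presilting : HomVanish P P
  generates : Kbproj A ≤ (ObjectProperty.singleton P).triangEnvelope

/-- Silting modules: the modules `H⁰(P)` for `P` a two-term silting complex. -/
def IsSiltingModule (M : ModuleCat.{u} A) : Prop :=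
  ∃ P : KMod A, IsTwoTermSilting P ∧
    Nonempty (M ≅
      (HomotopyCategory.homologyFunctor (ModuleCat.{u} A) (ComplexShape.up ℤ) 0).obj P)

/-- `tors (Fl A)`, as a set of subcategories. -/
def torsFl (A : Type u) [Ring A] : Set (ObjectProperty (ModuleCat.{u} A)) :=
  {T | IsTorsionClass (modFl A) T}

/-- `s-tors (Fl A)`: the subcategories `Fac M ∩ Fl A` with `M` a silting `A`-module. -/
def sTorsFl (A : Type u) [Ring A] : Set (ObjectProperty (ModuleCat.{u} A)) :=
  {T | ∃ M : ModuleCat.{u} A, IsSiltingModule M ∧ T = fac M ⊓ modFl A}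

lemma addOf_refl {C : Type*} [Category* C] [Preadditive C] (M : C) : addOf M M :=
  ⟨1, fun _ => 𝟙 M, fun _ => 𝟙 M, by simp⟩

lemma addOf_of_iso {C : Type*} [Category* C] [Preadditive C] {M N X : C} (h : addOf M X) (e : N ≅ M) :
    addOf N X := by
  obtain ⟨n, i, p, h⟩ := h
  exact ⟨n, fun k => i k ≫ e.inv, fun k => e.hom ≫ p k, by simpa using h⟩

lemma addOf_of_iso' {C : Type*} [Category* C] [Preadditive C] {M X Y : C} (h : addOf M X) (e : Y ≅ X) :
    addOf M Y := by
  obtain ⟨n, i, p, h⟩ := h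
  exact ⟨n, fun k => e.hom ≫ i k, fun k => p k ≫ e.inv, by
    simp only [Category.assoc]
    rw [← Preadditive.comp_sum]
    simp only [← Category.assoc (i _)]
    rw [← Preadditive.sum_comp, h]; simp⟩

lemma addOf_trans {C : Type*} [Category* C] [Preadditive C] {M N X : C} (h : addOf M N)
    (h' : addOf N X) : addOf M X := by
  obtain ⟨n, i, p, h⟩ := h
  obtain ⟨m, i', p', h'⟩ := h'
  refine ⟨m * n, fun k => i' (finProdFinEquiv.symm k).1 ≫ i (finProdFinEquiv.symm k).2,
    fun k => p (finProdFinEquiv.symm k).2 ≫ p' (finProdFinEquiv.symm k).1, ?_⟩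
  rw [finProdFinEquiv.symm.sum_comp (fun q : Fin m × Fin n =>
    (i' q.1 ≫ i q.2) ≫ p q.2 ≫ p' q.1), Fintype.sum_prod_type]
  rw [← h']
  refine Finset.sum_congr rfl fun k _ => ?_
  simp only [Category.assoc]
  rw [← Preadditive.comp_sum]
  simp only [← Category.assoc (i _)]
  rw [← Preadditive.sum_comp, h]; simp

lemma addOf_map {C D : Type*} [Category* C] [Preadditive C] [Category* D] [Preadditive D]
    (F : C ⥤ D) [F.Additive] {M X : C} (h : addOf M X) : addOf (F.obj M) (F.obj X) := by
  obtain ⟨n, i, p, h⟩ := h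
  exact ⟨n, fun k => F.map (i k), fun k => F.map (p k), by
    simp only [← F.map_comp]
    rw [← Functor.map_sum, h, F.map_id]⟩

lemma prop_of_addOf {C : Type*} [Category* C] [Preadditive C] [HasFiniteBiproducts C] 
    (Q : ObjectProperty C) [Q.IsClosedUnderFiniteProducts]
    [Q.IsStableUnderRetracts] {M X : C} (h : addOf M X) (hM : Q M) : Q X := by
  obtain ⟨n, i, p, h⟩ := h
  have h1 : Q (∏ᶜ fun _ : Fin n => M) := Q.prop_product fun _ => hM
  have h2 : Q (⨁ fun _ : Fin n => M) :=
    Q.prop_of_retract (biproduct.isoProduct (fun _ : Fin n => M)).retract h1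
  refine Q.prop_of_retract (Y := ⨁ fun _ : Fin n => M) ⟨biproduct.lift i, biproduct.desc p, ?_⟩ h2
  rw [biproduct.lift_desc, h]

/-- finitely generated projective modules are `add A`. -/
lemma fgProj_iff (M : ModuleCat.{u} A) :
    (Module.Finite A M ∧ Module.Projective A M) ↔ addOf (ModuleCat.of A A) M := by
  constructor
  · rintro ⟨h1, h2⟩
    obtain ⟨n, f, g, -, -, h⟩ := Module.Finite.exists_comp_eq_id_of_projective A M
    refine ⟨n, fun k => ModuleCat.ofHom (LinearMap.proj k ∘ₗ g),
      fun k => ModuleCat.ofHom (f ∘ₗ LinearMap.single A (fun _ => A) k), ?_⟩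
    ext x
    have hx := LinearMap.congr_fun h x
    simp only [LinearMap.comp_apply, LinearMap.id_apply] at hx
    simp only [ModuleCat.hom_sum, LinearMap.sum_apply, ModuleCat.hom_comp, ModuleCat.hom_ofHom, 
      LinearMap.comp_apply, LinearMap.proj_apply, ModuleCat.hom_id, LinearMap.id_apply]
    rw [← map_sum]
    have : ∑ k, (LinearMap.single A (fun _ => A) k) (g x k) = g x :=
      LinearMap.sum_single_apply (φ := fun _ : Fin n => A) (g x)
    rw [this, hx]
  · rintro ⟨n, i, p, h⟩
    let g : M →ₗ[A] (Fin n → A) := LinearMap.pi fun k => (i k).hom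
    let f : (Fin n → A) →ₗ[A] M := LinearMap.lsum A (fun _ => A) ℕ fun k => (p k).hom
    have hfg : f ∘ₗ g = LinearMap.id := by
      ext x
      have := congrArg (fun t => t.hom x) h
      simpa [f, g, ModuleCat.hom_sum] using this
    exact ⟨Module.Finite.of_surjective f (LinearMap.surjective_of_comp_eq_id _ _ hfg),
      Module.Projective.of_split g f hfg⟩

lemma HomVanish.of_addOf {P Q P' Q' : KMod A} (hP : addOf P P') (hQ : addOf Q Q')
    (h : HomVanish P Q) : HomVanish P' Q' := by
  intro i hi f
  obtain ⟨n, a, b, hab⟩ := hP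
  obtain ⟨m, c, d, hcd⟩ := addOf_map (shiftFunctor (KMod A) i) hQ
  rw [← Category.id_comp f, ← Category.comp_id f, ← hab, ← hcd]
  simp only [Preadditive.comp_sum, Preadditive.sum_comp, Category.assoc]
  refine Finset.sum_eq_zero fun k _ => Finset.sum_eq_zero fun l _ => ?_
  have := h i hi (b l ≫ f ≫ c k)
  rw [reassoc_of% this]
  simp

/-- Two-term silting complexes are identified when they are additively equivalent. -/
def twoSiltSetoid (A : Type u) [Ring A] : Setoid {P : KMod A // IsTwoTermSilting P} where
  r P Q := addOf P.1 = addOf Q.1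
  iseqv := ⟨fun _ => rfl, fun h => h.symm, fun h h' => h.trans h'⟩

/-- `2-silt A`: the two-term silting complexes up to additive equivalence. -/
def TwoSilt (A : Type u) [Ring A] : Type (u + 1) := Quotient (twoSiltSetoid A)

/-- The order of `2-silt A`: `Q ≤ P` when `Hom(P, Q[i]) = 0` for all `i > 0`. -/
instance instLETwoSilt (A : Type u) [Ring A] : LE (TwoSilt A) where
  le := Quotient.lift₂ (fun Q P => HomVanish P.1 Q.1) (by
    intro Q P Q' P' (hQ : addOf Q.1 = addOf Q'.1) (hP : addOf P.1 = addOf P'.1)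
    have hQ1 : addOf Q.1 Q'.1 := hQ ▸ addOf_refl _
    have hQ2 : addOf Q'.1 Q.1 := hQ ▸ addOf_refl _
    have hP1 : addOf P.1 P'.1 := hP ▸ addOf_refl _
    have hP2 : addOf P'.1 P.1 := hP ▸ addOf_refl _
    exact propext ⟨fun h => h.of_addOf hP1 hQ1, fun h => h.of_addOf hP2 hQ2⟩)

section Generation

open HomologicalComplex

lemma Kbproj_le (Q : ObjectProperty (KMod A)) [Q.IsTriangulated] [Q.IsStableUnderRetracts]
    (hQ : Q ((HomotopyCategory.singleFunctor (ModuleCat.{u} A) 0).obj (ModuleCat.of A A))) :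
    Kbproj A ≤ Q := by
  have h1 : ∀ b : ℤ, Q ((HomotopyCategory.singleFunctor (ModuleCat.{u} A) b).obj
      (ModuleCat.of A A)) := by
    intro b
    have e := ((HomotopyCategory.singleFunctors (ModuleCat.{u} A)).shiftIso (-b) b 0 (by lia)).app
      (ModuleCat.of A A)
    exact Q.prop_of_retract e.symm.retract (Q.le_shift (-b) _ hQ)
  have h2 : ∀ (b : ℤ) (M : ModuleCat.{u} A), Module.Finite A M ∧ Module.Projective A M →
      Q ((HomotopyCategory.quotient _ _).obj ((single (ModuleCat.{u} A) (ComplexShape.up ℤ) b).obj M)) :=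
    fun b M hM => prop_of_addOf Q (addOf_map (HomotopyCategory.singleFunctor _ b)
      ((fgProj_iff M).1 hM)) (h1 b)
  have key : ∀ (m : ℕ) (a : ℤ) (K : CochainComplex (ModuleCat.{u} A) ℤ),
      (∀ n, Module.Finite A (K.X n) ∧ Module.Projective A (K.X n)) →
      (∀ n, n < a ∨ a + m ≤ n → IsZero (K.X n)) → Q ((HomotopyCategory.quotient _ _).obj K) := by
    intro m
    induction m with
    | zero =>
      intro a K _ h
      refine Q.prop_of_isZero ?_
      refine Functor.map_isZero _ ?_
      rw [IsZero.iff_id_eq_zero]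
      ext n : 1
      exact (h n (by lia)).eq_of_src _ _
    | succ m ih =>
      intro a K hK h
      set b := a + m with hb
      let f : (single (ModuleCat.{u} A) (ComplexShape.up ℤ) b).obj (K.X b) ⟶ K :=
        mkHomFromSingle (𝟙 _) (by
          intro k hk
          simp at hk
          exact (h k (by lia)).eq_of_tgt _ _)
      have hfb : IsIso (f.f b) := by
        simp only [f, mkHomFromSingle_f]
        infer_instance
      have hz : ∀ n, n ≠ b → IsZero (((single (ModuleCat.{u} A) (ComplexShape.up ℤ) b).obj (K.X b)).X n) :=
        fun n hn => isZero_single_obj_X _ _ _ _ hn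
      have hmono : ∀ n, Mono (f.f n) := by
        intro n
        by_cases hn : n = b
        · subst hn; infer_instance
        · exact ⟨fun _ _ _ => (hz n hn).eq_of_tgt _ _⟩
      have : Mono f := HomologicalComplex.mono_of_mono_f f hmono
      let S : ShortComplex (CochainComplex (ModuleCat.{u} A) ℤ) :=
        ShortComplex.mk f (cokernel.π f) (cokernel.condition f)
      have hS : S.ShortExact :=
        { exact := ShortComplex.exact_cokernel f 
          mono_f := this
          epi_g := by dsimp [S]; infer_instance }
      have hSn : ∀ n, (S.map (eval (ModuleCat.{u} A) _ n)).ShortExact := fun n =>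
        hS.map_of_exact _
      have z3 : IsZero (S.X₃.X b) := by
        have h0 : S.f.f b ≫ S.g.f b = 0 := (S.map (eval (ModuleCat.{u} A) _ b)).zero
        have hg : S.g.f b = 0 := by
          have : IsIso (S.f.f b) := hfb
          rwa [← cancel_epi (S.f.f b), comp_zero]
        have : Epi (S.g.f b) := (hSn b).epi_g
        exact IsZero.of_epi_eq_zero (S.g.f b) hg
      have i3 : ∀ n, n ≠ b → IsIso (S.g.f n) := by
        intro n hn
        have := (hSn n).epi_g
        have := (hSn n).exact.mono_g ((hz n hn).eq_of_src _ _)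
        exact isIso_of_mono_of_epi (S.map (eval (ModuleCat.{u} A) _ n)).g
      have σ : ∀ n, (S.map (eval (ModuleCat.{u} A) _ n)).Splitting := by
        intro n
        by_cases hn : n = b
        · subst hn
          exact ShortComplex.Splitting.ofIsIsoOfIsZero _ hfb z3
        · exact ShortComplex.Splitting.ofIsZeroOfIsIso _ (hz n hn) (i3 n hn)
      have hT := (HomotopyCategory.distinguished_iff_iso_trianglehOfDegreewiseSplit
        (CochainComplex.trianglehOfDegreewiseSplit S σ)).2 ⟨S, σ, ⟨Iso.refl _⟩⟩
      refine Q.ext_of_isTriangulatedClosed₂ _ hT (h2 b _ (hK b)) (ih a S.X₃ ?_ ?_)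
      · intro n
        rw [fgProj_iff]
        by_cases hn : n = b
        · exact ⟨0, Fin.elim0, Fin.elim0, (hn ▸ z3 : IsZero (S.X₃.X n)).eq_of_src _ _⟩
        · have := i3 n hn
          exact addOf_of_iso' ((fgProj_iff _).1 (hK n)) (asIso (S.g.f n)).symm
      · intro n hn
        by_cases hnb : n = b
        · subst hnb; exact z3
        · have := i3 n hnb
          exact (h n (by lia)).of_iso (asIso (S.g.f n)).symm
  rintro X ⟨K, hK, ⟨a, b, hab⟩, ⟨e⟩⟩
  refine Q.prop_of_retract e.retract (key (b + 1 - a).toNat a K hK fun n hn => hab n (by lia))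

end Generation

lemma homVanish_quotient_iff (K : CochainComplex (ModuleCat.{u} A) ℤ) :
    HomVanish ((HomotopyCategory.quotient _ _).obj K) ((HomotopyCategory.quotient _ _).obj K) ↔
      ∀ i : ℤ, 0 < i → ∀ f : K ⟶ K⟦i⟧, (HomotopyCategory.quotient _ _).map f = 0 := by
  constructor
  · intro h i hi f
    rw [← cancel_mono (((HomotopyCategory.quotient _ _).commShiftIso i).hom.app K),
      h i hi ((HomotopyCategory.quotient _ _).map f ≫ _), zero_comp]
  · intro h i hi f
    obtain ⟨g, hg⟩ := (HomotopyCategory.quotient _ _).map_surjective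
      (f ≫ ((HomotopyCategory.quotient _ _).commShiftIso i).inv.app K)
    rw [← cancel_mono (((HomotopyCategory.quotient _ _).commShiftIso i).inv.app K), ← hg, h i hi g,
      zero_comp]

lemma isZero_shift_X {A : Type u} [Ring A] {K : CochainComplex (ModuleCat.{u} A) ℤ}
    (hK : ∀ n, n ≠ -1 → n ≠ 0 → IsZero (K.X n)) {i n : ℤ} (hi : 0 < i) (h : i ≠ 1 ∨ n ≠ -1) :
    IsZero (K.X n) ∨ IsZero ((K⟦i⟧).X n) := by
  by_cases h1 : n = -1 ∨ n = 0
  · right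
    exact hK (n + i) (by lia) (by lia)
  · left
    exact hK n (by tauto) (by tauto)

end AnyRing

section Localisation

variable {R Λ : Type u} [CommRing R] [Ring Λ] [Algebra R Λ] (p : PrimeSpectrum R)

/-- The localisation `Λ_p = R_p ⊗ Λ`. -/
abbrev LocAlg (Λ : Type u) [Ring Λ] [Algebra R Λ] (p : PrimeSpectrum R) : Type u :=
  Localization.AtPrime p.asIdeal ⊗[R] Λ

/-- The localisation `M_p = R_p ⊗ M` of a `Λ`-module `M`. -/
def LocMod (M : ModuleCat.{u} Λ) : Type u :=
  Localization.AtPrime p.asIdeal ⊗[R] RestrictScalars R Λ M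

noncomputable instance instAddCommGroupLocMod (M : ModuleCat.{u} Λ) : AddCommGroup (LocMod p M) :=
  inferInstanceAs (AddCommGroup (Localization.AtPrime p.asIdeal ⊗[R] RestrictScalars R Λ M))

/-- The action of `Λ_p` on `R_p ⊗ M`. -/
noncomputable def locAction (M : ModuleCat.{u} Λ) :
    LocAlg Λ p →+* Module.End R (Localization.AtPrime p.asIdeal ⊗[R] RestrictScalars R Λ M) :=
  ((Module.endTensorEndAlgHom (R := R) (S := R) (A := R)).comp
    (Algebra.TensorProduct.map (Algebra.lsmul R R (Localization.AtPrime p.asIdeal))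
      (RestrictScalars.lsmul R Λ M))).toRingHom

/-- `(a ⊗ l) • (b ⊗ m) = (a * b) ⊗ (l • m)`. -/
noncomputable instance instModuleLocMod (M : ModuleCat.{u} Λ) : Module (LocAlg Λ p) (LocMod p M) :=
  Module.compHom (Localization.AtPrime p.asIdeal ⊗[R] RestrictScalars R Λ M) (locAction p M)

/-- The pure tensor `a ⊗ m` in `M_p`. -/
noncomputable def LocMod.tmul {M : ModuleCat.{u} Λ} (a : Localization.AtPrime p.asIdeal) (m : M) :
    LocMod p M :=
  a ⊗ₜ[R] (RestrictScalars.addEquiv R Λ M).symm m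

lemma LocMod.smul_tmul {M : ModuleCat.{u} Λ} (a b : Localization.AtPrime p.asIdeal) (l : Λ)
    (m : M) : (a ⊗ₜ[R] l : LocAlg Λ p) • LocMod.tmul p b m = LocMod.tmul p (a * b) (l • m) := rfl

lemma LocMod.tmul_add {M : ModuleCat.{u} Λ} (a : Localization.AtPrime p.asIdeal) (m n : M) :
    LocMod.tmul p a (m + n) = LocMod.tmul p a m + LocMod.tmul p a n := 
  TensorProduct.tmul_add _ _ _

lemma LocMod.induction {M : ModuleCat.{u} Λ} {motive : LocMod p M → Prop}
    (tmul : ∀ a m, motive (LocMod.tmul p a m)) (add : ∀ x y, motive x → motive y → motive (x + y))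
    (x : LocMod p M) : motive x := by
  induction x using TensorProduct.induction_on with
  | zero => have := tmul 0 0; rwa [LocMod.tmul, TensorProduct.zero_tmul] at this
  | tmul a m => exact tmul a m
  | add x y hx hy => exact add x y hx hy

/-- A `Λ_p`-linear map out of `M_p` from an additive map that is linear on pure tensors. -/
noncomputable def LocMod.mkLin {M : ModuleCat.{u} Λ} {Y : Type*} [AddCommGroup Y] [Module (LocAlg Λ p) Y]
    (f : LocMod p M →+ Y)
    (h : ∀ a l b m, f (LocMod.tmul p (a * b) (l • m)) =
      (a ⊗ₜ[R] l : LocAlg Λ p) • f (LocMod.tmul p b m)) : LocMod p M →ₗ[LocAlg Λ p] Y where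
  toFun := f
  map_add' := f.map_add
  map_smul' c x := by
    dsimp only [RingHom.id_apply]
    induction x using LocMod.induction with
    | add x y hx hy => rw [smul_add, map_add, map_add, hx, hy, smul_add]
    | tmul b m =>
      induction c using TensorProduct.induction_on with
      | zero =>
        have e : (0 : LocAlg Λ p) = 0 ⊗ₜ[R] 0 := (TensorProduct.zero_tmul _ _).symm
        rw [e, LocMod.smul_tmul, h]
      | add c d hc hd => rw [add_smul, map_add, hc, hd, add_smul]
      | tmul a l => rw [LocMod.smul_tmul, h]

/-- The map `M_p → N_p` induced by `f : M → N`. -/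
noncomputable def locMap {M N : ModuleCat.{u} Λ} (f : M ⟶ N) :
    LocMod p M →ₗ[LocAlg Λ p] LocMod p N :=
  LocMod.mkLin p (TensorProduct.map (LinearMap.id : Localization.AtPrime p.asIdeal →ₗ[R] _)
    ({ toFun := fun x => f.hom x
       map_add' := fun x y => f.hom.map_add x y
       map_smul' := fun r x => f.hom.map_smul (algebraMap R Λ r) x } :
     RestrictScalars R Λ M →ₗ[R] RestrictScalars R Λ N)).toAddMonoidHom
    (fun a l b m => by
      change LocMod.tmul p (a * b) (f.hom (l • m)) = _ • LocMod.tmul p b (f.hom m)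
      rw [map_smul, LocMod.smul_tmul])

lemma locMap_tmul {M N : ModuleCat.{u} Λ} (f : M ⟶ N) (a : Localization.AtPrime p.asIdeal)
    (m : M) : locMap p f (LocMod.tmul p a m) = LocMod.tmul p a (f.hom m) := rfl

lemma LocMod.hom_ext {M : ModuleCat.{u} Λ} {Y : Type*} [AddCommGroup Y] [Module (LocAlg Λ p) Y]
    {f g : LocMod p M →ₗ[LocAlg Λ p] Y} (h : ∀ m, f (LocMod.tmul p 1 m) = g (LocMod.tmul p 1 m)) :
    f = g := by
  ext x
  induction x using LocMod.induction with
  | add x y hx hy => rw [map_add, map_add, hx, hy]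
  | tmul a m =>
    have : LocMod.tmul p a m = (a ⊗ₜ[R] 1 : LocAlg Λ p) • LocMod.tmul p 1 m := by
      rw [LocMod.smul_tmul, mul_one, one_smul]
    rw [this, map_smul, map_smul, h]

/-- The localisation functor `Mod Λ ⥤ Mod Λ_p`. -/
noncomputable def locFunctor : ModuleCat.{u} Λ ⥤ ModuleCat.{u} (LocAlg Λ p) where
  obj M := ModuleCat.of _ (LocMod p M)
  map f := ModuleCat.ofHom (locMap p f)
  map_id _ := ModuleCat.hom_ext (LocMod.hom_ext p fun _ => rfl)
  map_comp _ _ := ModuleCat.hom_ext (LocMod.hom_ext p fun _ => rfl)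

instance instAdditiveLocFunctor : (locFunctor (Λ := Λ) p).Additive where
  map_add {_ _ f g} := ModuleCat.hom_ext (LocMod.hom_ext p fun m => LocMod.tmul_add p 1 (f.hom m) (g.hom m))

/-- Multiplication by `c ∈ R_p` on `M_p`. -/
noncomputable def locScaleMap (c : Localization.AtPrime p.asIdeal) (M : ModuleCat.{u} Λ) :
    LocMod p M →ₗ[LocAlg Λ p] LocMod p M :=
  LocMod.mkLin p (LinearMap.toAddMonoidHom (locAction p M (c ⊗ₜ[R] 1))) (fun a l b m => by
    change LocMod.tmul p (c * (a * b)) ((1:Λ) • (l • m)) = _ • LocMod.tmul p (c * b) ((1 : Λ) • m)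
    rw [one_smul, one_smul, LocMod.smul_tmul, mul_left_comm])

lemma locScaleMap_tmul (c : Localization.AtPrime p.asIdeal) (M : ModuleCat.{u} Λ)
    (a : Localization.AtPrime p.asIdeal) (m : M) :
    locScaleMap p c M (LocMod.tmul p a m) = LocMod.tmul p (c * a) m := by
  change LocMod.tmul p (c * a) ((1:Λ) • m) = _
  rw [one_smul]

lemma locScaleMap_comp (c d : Localization.AtPrime p.asIdeal) (M : ModuleCat.{u} Λ) :
    locScaleMap p d M ∘ₗ locScaleMap p c M = locScaleMap p (d * c) M :=
  LocMod.hom_ext p fun m => by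
    rw [LinearMap.comp_apply, locScaleMap_tmul, locScaleMap_tmul, locScaleMap_tmul, mul_assoc]

lemma locScaleMap_one (M : ModuleCat.{u} Λ) : locScaleMap p 1 M = LinearMap.id :=
  LocMod.hom_ext p fun m => by rw [locScaleMap_tmul, one_mul, LinearMap.id_apply]

/-- Multiplication by `c ∈ R_p` as a natural transformation. -/
noncomputable def locScale (c : Localization.AtPrime p.asIdeal) :
    locFunctor (Λ := Λ) p ⟶ locFunctor p where
  app M := ModuleCat.ofHom (locScaleMap p c M)
  naturality M N f := ModuleCat.hom_ext (LocMod.hom_ext p fun m => by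
    change locScaleMap p c N (LocMod.tmul p 1 (f.hom m)) =
      locMap p f (locScaleMap p c M (LocMod.tmul p 1 m))
    rw [locScaleMap_tmul, locScaleMap_tmul, locMap_tmul])

lemma LocMod.scale_tmul_one {M : ModuleCat.{u} Λ} (r : R) (m : M) :
    locScaleMap p (algebraMap R _ r) M (LocMod.tmul p 1 m) =
      LocMod.tmul p 1 (algebraMap R Λ r • m) := by
  rw [locScaleMap_tmul, mul_one, Algebra.algebraMap_eq_smul_one (A := Localization.AtPrime _)]
  exact (TensorProduct.smul_tmul r (1 : Localization.AtPrime p.asIdeal)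
    ((RestrictScalars.addEquiv R Λ M).symm m))

lemma locScaleMap_eq_smul (c : Localization.AtPrime p.asIdeal) {M : ModuleCat.{u} Λ}
    (x : LocMod p M) : locScaleMap p c M x = (c ⊗ₜ[R] (1 : Λ) : LocAlg Λ p) • x := rfl

lemma LocMod.map_scale {M N : ModuleCat.{u} Λ} (c : Localization.AtPrime p.asIdeal)
    (g : LocMod p M →ₗ[LocAlg Λ p] LocMod p N) (x : LocMod p M) :
    g (locScaleMap p c M x) = locScaleMap p c N (g x) := by
  rw [locScaleMap_eq_smul, locScaleMap_eq_smul, map_smul]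

/-- every localised element is a fraction. -/
lemma LocMod.exists_scale {M : ModuleCat.{u} Λ} (x : LocMod p M) :
    ∃ s ∈ p.asIdeal.primeCompl, ∃ m : M,
      locScaleMap p (algebraMap R _ s) M x = LocMod.tmul p 1 m := by
  induction x using LocMod.induction with
  | tmul a m =>
    obtain ⟨⟨r, s⟩, h⟩ := IsLocalization.surj p.asIdeal.primeCompl a
    refine ⟨s.1, s.2, algebraMap R Λ r • m, ?_⟩
    rw [locScaleMap_tmul, mul_comm, h, ← LocMod.scale_tmul_one, locScaleMap_tmul, mul_one]
  | add x y hx hy =>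
    obtain ⟨s, hs, m, hm⟩ := hx
    obtain ⟨t, ht, n, hn⟩ := hy
    refine ⟨t * s, mul_mem ht hs, algebraMap R Λ t • m + algebraMap R Λ s • n, ?_⟩
    rw [LocMod.tmul_add, ← LocMod.scale_tmul_one, ← LocMod.scale_tmul_one, ← hm, ← hn, map_add, ← LinearMap.comp_apply,
      ← LinearMap.comp_apply, locScaleMap_comp, locScaleMap_comp, map_mul]
    congr 2
    rw [mul_comm]

lemma locAlg_one_mul_tmul (a : Localization.AtPrime p.asIdeal) (l : Λ) :
    (a ⊗ₜ[R] l : LocAlg Λ p) • LocMod.tmul p 1 (1 : ModuleCat.of Λ Λ) = LocMod.tmul p a l := by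
  rw [LocMod.smul_tmul, mul_one]
  congr 1
  exact mul_one l

/-- Localising the regular module gives the regular module. -/
noncomputable def locSelfEquiv : LocAlg Λ p ≃ₗ[LocAlg Λ p] LocMod p (ModuleCat.of Λ Λ) :=
  LinearEquiv.ofBijective
    (LinearMap.toSpanSingleton _ _ (LocMod.tmul p 1 (1 : ModuleCat.of Λ Λ))) (by
    let e : LocAlg Λ p ≃+ LocMod p (ModuleCat.of Λ Λ) :=
      (TensorProduct.congr (LinearEquiv.refl R (Localization.AtPrime p.asIdeal))
        ({ RestrictScalars.addEquiv R Λ (ModuleCat.of Λ Λ) with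
           map_smul' := fun r x => (Algebra.smul_def (A := Λ) r
             (RestrictScalars.addEquiv R Λ (ModuleCat.of Λ Λ) x)).symm } :
          RestrictScalars R Λ (ModuleCat.of Λ Λ) ≃ₗ[R] Λ).symm).toAddEquiv
    have h : ∀ x, LinearMap.toSpanSingleton (LocAlg Λ p) _
        (LocMod.tmul p 1 (1 : ModuleCat.of Λ Λ)) x = e x := by
      intro x
      rw [LinearMap.toSpanSingleton_apply]
      induction x using TensorProduct.induction_on with
      | zero => exact (zero_smul (LocAlg Λ p) _).trans (map_zero e).symm
      | add x y hx hy => rw [add_smul, hx, hy, map_add]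
      | tmul a l => rw [locAlg_one_mul_tmul]; rfl
    rw [show ⇑(LinearMap.toSpanSingleton (LocAlg Λ p) _
        (LocMod.tmul p 1 (1 : ModuleCat.of Λ Λ))) = e from funext h]
    exact e.bijective)

/-- Localising the regular module gives the regular module. -/
noncomputable def locSelfIso :
    (locFunctor p).obj (ModuleCat.of Λ Λ) ≅ ModuleCat.of (LocAlg Λ p) (LocAlg Λ p) :=
  (locSelfEquiv p).symm.toModuleIso

lemma locFunctor_fgProj {M : ModuleCat.{u} Λ} (h : Module.Finite Λ M ∧ Module.Projective Λ M) :
    Module.Finite (LocAlg Λ p) ((locFunctor p).obj M) ∧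
      Module.Projective (LocAlg Λ p) ((locFunctor p).obj M) :=
  (fgProj_iff _).2 (addOf_of_iso (addOf_map (locFunctor p) ((fgProj_iff M).1 h))
    (locSelfIso p).symm)

/-- morphisms out of a localised f.g. projective are fractions -/
lemma locFunctor_exists_lift {M N : ModuleCat.{u} Λ} (hM : addOf (ModuleCat.of Λ Λ) M)
    (g : (locFunctor p).obj M ⟶ (locFunctor p).obj N) :
    ∃ s ∈ p.asIdeal.primeCompl, ∃ h : M ⟶ N,
      (locFunctor p).map h = (locScale p (algebraMap R _ s)).app M ≫ g := by
  obtain ⟨n, i, π, hiπ⟩ := hM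
  let g' : LocMod p M →ₗ[LocAlg Λ p] LocMod p N := g.hom
  choose s hs y hy using fun k => LocMod.exists_scale p (M := N)
    (g' (LocMod.tmul p 1 ((π k).hom (1 : Λ))))
  have hdiv : ∀ k, ∃ z : N, locScaleMap p (algebraMap R _ (∏ k, s k)) N
      (g' (LocMod.tmul p 1 ((π k).hom (1 : Λ)))) = LocMod.tmul p 1 z := by
    intro k
    refine ⟨algebraMap R Λ (∏ j ∈ Finset.univ.erase k, s j) • y k, ?_⟩
    rw [← LocMod.scale_tmul_one, ← hy k, ← LinearMap.comp_apply (locScaleMap p _ N)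
      (locScaleMap p _ N), locScaleMap_comp, ← map_mul, Finset.prod_erase_mul _ _ (Finset.mem_univ k)]
  choose z hz using hdiv
  refine ⟨∏ k, s k, prod_mem fun k _ => hs k,
    ∑ k, i k ≫ ModuleCat.ofHom (LinearMap.toSpanSingleton Λ N (z k)), ?_⟩
  have hg' : ∀ k, g' ∘ₗ locScaleMap p (algebraMap R _ (∏ k, s k)) M ∘ₗ locMap p (π k) =
      locMap p (ModuleCat.ofHom (LinearMap.toSpanSingleton Λ N (z k))) := by
    intro k
    refine LocMod.hom_ext p fun m => ?_
    have hm : LocMod.tmul p 1 m = ((1 : Localization.AtPrime p.asIdeal) ⊗ₜ[R] (m : Λ) : LocAlg Λ p) •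
        LocMod.tmul p 1 (1 : ModuleCat.of Λ Λ) := (locAlg_one_mul_tmul p 1 m).symm
    rw [hm, map_smul, map_smul]
    congr 1
    change g' (locScaleMap p (algebraMap R _ (∏ k, s k)) M (LocMod.tmul p 1 ((π k).hom (1 : Λ)))) =
      LocMod.tmul p 1 ((1 : Λ) • z k)
    rw [one_smul, ← hz, LocMod.map_scale]
  have hg : ∀ k, (locFunctor p).map (π k) ≫ (locScale p (algebraMap R _ (∏ k, s k))).app M ≫ g =
      (locFunctor p).map (ModuleCat.ofHom (LinearMap.toSpanSingleton Λ N (z k))) :=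
    fun k => ModuleCat.hom_ext (hg' k)
  have h1 := congrArg ((locFunctor p).map) hiπ
  rw [Functor.map_sum, CategoryTheory.Functor.map_id] at h1
  rw [Functor.map_sum, ← Category.id_comp ((locScale p (algebraMap R _ (∏ k, s k))).app M ≫ g),
    ← h1, Preadditive.sum_comp]
  refine Finset.sum_congr rfl fun k _ => ?_
  rw [Functor.map_comp, Functor.map_comp, Category.assoc, hg]

lemma locPresilting (K : CochainComplex (ModuleCat.{u} Λ) ℤ)
    (hK : ∀ n, n ≠ -1 → n ≠ 0 → IsZero (K.X n)) (hP : addOf (ModuleCat.of Λ Λ) (K.X (-1)))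
    (h : ∀ f : K ⟶ K⟦(1 : ℤ)⟧, (HomotopyCategory.quotient _ _).map f = 0) (i : ℤ) (hi : 0 < i)
    (g : ((locFunctor p).mapHomologicalComplex (ComplexShape.up ℤ)).obj K ⟶
      (((locFunctor p).mapHomologicalComplex (ComplexShape.up ℤ)).obj K)⟦i⟧) :
    (HomotopyCategory.quotient _ _).map g = 0 := by
  have hK' : ∀ n, n ≠ -1 → n ≠ 0 →
      IsZero ((((locFunctor p).mapHomologicalComplex (ComplexShape.up ℤ)).obj K).X n) :=
    fun n h1 h2 => (locFunctor p).map_isZero (hK n h1 h2)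
  have gz : ∀ n, (i ≠ 1 ∨ n ≠ -1) → g.f n = 0 := by
    intro n hn
    rcases isZero_shift_X hK' hi hn with h | h
    · exact h.eq_of_src _ _
    · exact h.eq_of_tgt _ _
  by_cases hi1 : i = 1
  · subst hi1
    obtain ⟨s, hs, l, hl⟩ := locFunctor_exists_lift (N := K.X (-1 + 1)) p hP (g.f (-1))
    let f : K ⟶ K⟦(1 : ℤ)⟧ :=
      { f := fun n => if hn : n = -1 then eqToHom (by rw [hn]) ≫ l ≫ eqToHom (by rw [hn]; rfl) else 0
        comm' := by
          intro a b hab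
          by_cases ha : a = -1
          · exact (hK (b + 1) (by simp at hab; lia) (by simp at hab; lia)).eq_of_tgt _ _
          · by_cases ha0 : a = 0
            · exact (hK (b + 1) (by simp at hab; lia) (by simp at hab; lia)).eq_of_tgt _ _
            · exact (hK a ha ha0).eq_of_src _ _ }
    have hf : f.f (-1) = l := by
      simp only [f, dite_true, eqToHom_refl, Category.id_comp]
      exact Category.comp_id l
    have hfz : ∀ n, n ≠ -1 → f.f n = 0 := fun n hn => dif_neg hn
    have key : (NatTrans.mapHomologicalComplex (locScale p (algebraMap R _ s)) (ComplexShape.up ℤ)).app K ≫ g =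
        ((locFunctor p).mapHomologicalComplex (ComplexShape.up ℤ)).map f ≫
          (((locFunctor p).mapHomologicalComplex (ComplexShape.up ℤ)).commShiftIso (1 : ℤ)).hom.app K := by
      ext n : 1
      rw [HomologicalComplex.comp_f, HomologicalComplex.comp_f,
        Functor.mapHomologicalComplex_commShiftIso_hom_app_f]
      by_cases hn : n = -1
      · subst hn
        rw [Functor.mapHomologicalComplex_map_f, hf]
        exact hl.symm.trans (Category.comp_id _).symm
      · rw [gz n (Or.inr hn), comp_zero, Functor.mapHomologicalComplex_map_f, hfz n hn,
          Functor.map_zero]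
        exact zero_comp.symm
    have hfq : (HomotopyCategory.quotient _ _).map
        (((locFunctor p).mapHomologicalComplex (ComplexShape.up ℤ)).map f) = 0 := by
      rw [← Functor.mapHomotopyCategory_map, h f]
      exact Functor.map_zero _ _ _
    have hsg := congrArg (HomotopyCategory.quotient _ _).map key
    rw [Functor.map_comp, Functor.map_comp, hfq, zero_comp] at hsg
    have hunit : locScale (Λ := Λ) p (IsLocalization.mk' _ (1 : R) (⟨s, hs⟩ : p.asIdeal.primeCompl)) ≫
        locScale p (algebraMap R _ s) = 𝟙 _ := by
      ext M : 2
      refine ModuleCat.hom_ext ?_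
      refine (locScaleMap_comp p _ _ M).trans ?_
      rw [mul_comm, IsLocalization.mk'_spec, map_one]
      exact locScaleMap_one p M
    have hid := congrArg (fun t => (NatTrans.mapHomologicalComplex t (ComplexShape.up ℤ)).app K) hunit
    simp only [NatTrans.mapHomologicalComplex_comp, NatTrans.mapHomologicalComplex_id,
      NatTrans.comp_app, NatTrans.id_app] at hid
    rw [← Category.id_comp g, ← hid, Category.assoc, Functor.map_comp, Functor.map_comp, hsg,
      comp_zero]
  · have : g = 0 := by
      ext n : 1
      exact gz n (Or.inl hi1)
    rw [this, Functor.map_zero]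

/-- The localisation functor `K(Mod Λ) ⥤ K(Mod Λ_p)`. -/
noncomputable abbrev locK : KMod Λ ⥤ KMod (LocAlg Λ p) :=
  (locFunctor p).mapHomotopyCategory (ComplexShape.up ℤ)

lemma IsTwoTermSilting.localize {P : KMod Λ} (hP : IsTwoTermSilting P) :
    IsTwoTermSilting ((locK p).obj P) := by
  obtain ⟨⟨K, hK1, hK2, ⟨e⟩⟩, hpre, hgen⟩ := hP
  refine ⟨⟨((locFunctor p).mapHomologicalComplex _).obj K, fun n => locFunctor_fgProj p (hK1 n),
    fun n h1 h2 => (locFunctor p).map_isZero (hK2 n h1 h2), ⟨(locK p).mapIso e⟩⟩, ?_, ?_⟩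
  · have h1 : HomVanish ((HomotopyCategory.quotient _ _).obj K)
        ((HomotopyCategory.quotient _ _).obj K) :=
      hpre.of_addOf (addOf_of_iso' (addOf_refl _) e.symm) (addOf_of_iso' (addOf_refl _) e.symm)
    have h2 := (homVanish_quotient_iff _).2 (locPresilting p K hK2 ((fgProj_iff _).1 (hK1 (-1)))
      ((homVanish_quotient_iff K).1 h1 1 one_pos))
    have e' := (locK p).mapIso e
    exact h2.of_addOf (addOf_of_iso' (addOf_refl _) e') (addOf_of_iso' (addOf_refl _) e')
  · let Q := (ObjectProperty.singleton ((locK p).obj P)).triangEnvelope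
    apply Kbproj_le
    have : (Q.inverseImage (locK p)).IsStableUnderRetracts :=
      ⟨fun r h => Q.prop_of_retract (r.map (locK p)) h⟩
    have h1 : (ObjectProperty.singleton P).triangEnvelope ≤ Q.inverseImage (locK p) := by
      rw [ObjectProperty.triangEnvelope_le_iff]
      rintro _ ⟨⟩
      exact ObjectProperty.le_triangEnvelope _ _ ⟨PUnit.unit⟩
    have h2 : Kbproj Λ ((HomotopyCategory.singleFunctor (ModuleCat.{u} Λ) 0).obj (ModuleCat.of Λ Λ)) := by
      refine ⟨(HomologicalComplex.single _ _ 0).obj (ModuleCat.of Λ Λ), fun n => ?_, ⟨0, 0, ?_⟩,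
        ⟨Iso.refl _⟩⟩
      · by_cases hn : n = 0
        · subst hn
          exact (fgProj_iff _).2 (addOf_of_iso' (addOf_refl _) (HomologicalComplex.singleObjXSelf _ _ _))
        · exact (fgProj_iff _).2 ⟨0, Fin.elim0, Fin.elim0,
            (HomologicalComplex.isZero_single_obj_X _ _ _ _ hn).eq_of_src _ _⟩
      · intro n hn
        exact HomologicalComplex.isZero_single_obj_X _ _ _ _ (by lia)
    have h3 : Q _ := h1 _ (hgen _ h2)
    refine Q.prop_of_retract (Iso.retract ?_) h3
    exact (HomotopyCategory.quotient _ _).mapIso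
      ((HomologicalComplex.single _ _ 0).mapIso (locSelfIso p).symm ≪≫
        ((HomologicalComplex.singleMapHomologicalComplex (locFunctor p) (ComplexShape.up ℤ) 0).app _).symm)

/-- The map `2-silt Λ → 2-silt Λ_p`, `P ↦ P_p`. -/
noncomputable def TwoSilt.localize (p : PrimeSpectrum R) : TwoSilt Λ → TwoSilt (LocAlg Λ p) :=
  Quotient.map' (s₁ := twoSiltSetoid Λ) (s₂ := twoSiltSetoid (LocAlg Λ p))
    (fun P => ⟨(locK p).obj P.1, P.2.localize p⟩) (by
      intro P Q (h : addOf P.1 = addOf Q.1)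
      have h1 : addOf ((locK p).obj P.1) ((locK p).obj Q.1) :=
        addOf_map _ (h ▸ addOf_refl _)
      have h2 : addOf ((locK p).obj Q.1) ((locK p).obj P.1) :=
        addOf_map _ (h ▸ addOf_refl _)
      exact funext fun X => propext ⟨fun hX => addOf_trans h2 hX, fun hX => addOf_trans h1 hX⟩)

/-- The subcategory `𝒞_p = {X_p | X ∈ 𝒞}` of `Mod Λ_p`, closed under isomorphism. -/
def locProp (p : PrimeSpectrum R) (𝒞 : ObjectProperty (ModuleCat.{u} Λ)) :
    ObjectProperty (ModuleCat.{u} (LocAlg Λ p)) :=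
  fun Z => ∃ Y, 𝒞 Y ∧ Nonempty (Z ≅ (locFunctor p).obj Y)

/-- The restriction functor `Mod Λ_p ⥤ Mod Λ` along `Λ → Λ_p`. -/
noncomputable def locRestrict (p : PrimeSpectrum R) :
    ModuleCat.{u} (LocAlg Λ p) ⥤ ModuleCat.{u} Λ :=
  ModuleCat.restrictScalars
    (Algebra.TensorProduct.includeRight (R := R) (A := Localization.AtPrime p.asIdeal)
      (B := Λ)).toRingHom

/-- For primes `q ⊆ p` and a subcategory `𝒞` of `Mod Λ_p`, the subcategory `𝒞_q = {X_q | X ∈ 𝒞}`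
of `Mod Λ_q`. Here `X_q = R_q ⊗ X`, with `X` seen as a `Λ`-module; this is the localisation of
the `Λ_p`-module `X` at `q`, because `R_q ⊗_{R_p} X = R_q ⊗_R X`. -/
def locPropFrom (p q : PrimeSpectrum R) (𝒞 : ObjectProperty (ModuleCat.{u} (LocAlg Λ p))) :
    ObjectProperty (ModuleCat.{u} (LocAlg Λ q)) :=
  fun Z => ∃ Y, 𝒞 Y ∧ Nonempty (Z ≅ (locFunctor q).obj ((locRestrict p).obj Y))

/-- The submodule `pX` of a `Λ_p`-module `X`. -/
def primeMul (p : PrimeSpectrum R) (X : ModuleCat.{u} (LocAlg Λ p)) :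
    Submodule (LocAlg Λ p) X :=
  Submodule.span (LocAlg Λ p)
    {y | ∃ a ∈ p.asIdeal, ∃ x : X, y = algebraMap R (LocAlg Λ p) a • x}

/-- `ψ_p(𝒳) = {X ∈ mod Λ_p | X/pX ∈ 𝒳}`. -/
def psi (p : PrimeSpectrum R) (𝒳 : ObjectProperty (ModuleCat.{u} (LocAlg Λ p))) :
    ObjectProperty (ModuleCat.{u} (LocAlg Λ p)) :=
  fun X => modFg (LocAlg Λ p) X ∧ 𝒳 (ModuleCat.of (LocAlg Λ p) (X ⧸ primeMul p X))

/-- `r_{p,q}(𝒳) = ψ_p(𝒳)_q ∩ Fl Λ_q`, for primes `q ⊆ p`. -/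
def rMap (p q : PrimeSpectrum R) (𝒳 : ObjectProperty (ModuleCat.{u} (LocAlg Λ p))) :
    ObjectProperty (ModuleCat.{u} (LocAlg Λ q)) :=
  locPropFrom p q (psi p 𝒳) ⊓ modFl (LocAlg Λ q)

/-- `Φ_t(T) = (T_p ∩ Fl Λ_p)_p`. -/
def PhiT (R Λ : Type u) [CommRing R] [Ring Λ] [Algebra R Λ] (T : Tors (modFg Λ))
    (p : PrimeSpectrum R) : ObjectProperty (ModuleCat.{u} (LocAlg Λ p)) :=
  locProp p T.1 ⊓ modFl (LocAlg Λ p)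

/-- The compatible elements of `∏_p tors (Fl Λ_p)`: families `(𝒳^p)_p` of torsion classes with
`r_{p,q}(𝒳^p) ⊇ 𝒳^q` for all primes `p ⊇ q`. -/
def compatibleFamilies (R Λ : Type u) [CommRing R] [Ring Λ] [Algebra R Λ] :
    Set (∀ p : PrimeSpectrum R, ObjectProperty (ModuleCat.{u} (LocAlg Λ p))) :=
  {𝒳 | (∀ p : PrimeSpectrum R, IsTorsionClass (modFl (LocAlg Λ p)) (𝒳 p)) ∧
    ∀ p q : PrimeSpectrum R, q ≤ p → 𝒳 q ≤ rMap p q (𝒳 p)}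

/-- `(R, Λ)` is compatible: the image of `Φ_t` is the set of all compatible elements. -/
def IsCompatible (R Λ : Type u) [CommRing R] [Ring Λ] [Algebra R Λ] : Prop :=
  Set.range (PhiT R Λ) = compatibleFamilies R Λ

end Localisation

/-- `Hom_poset(X, Y)`: the order-preserving maps, with the pointwise order. -/
def PosetHom (X Y : Type*) [LE X] [LE Y] : Type _ :=
  {f : X → Y // ∀ a b, a ≤ b → f a ≤ f b}

instance instLEPosetHom (X Y : Type*) [LE X] [LE Y] : LE (PosetHom X Y) where
  le f g := ∀ a, f.1 a ≤ g.1 a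

/-- `R` has no idempotents other than `0` and `1`, that is, `R` is not a product of two nonzero
rings. -/
def RingIndecomposable (R : Type u) [CommRing R] : Prop :=
  ∀ e : R, IsIdempotentElem e → e = 0 ∨ e = 1

end SiltingTorsion

open SiltingTorsion

/-! A two-term silting complex `P` with differential `d : P₁ → P₀` is controlled by the class `Fac
H⁰(P)`. On Noetherian modules `X` this class is the vanishing condition `Hom(P, X[1]) = 0`: every
map `P₁ → X` extends along `d` (`Presents.fac_H0_iff`). Hence the order of `2-silt` is inclusion of
these classes (`TwoSilt.le_iff_fac_le`), and equal classes come from additively equivalent complexes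
(`addOf_of_homVanish`, `TwoSilt.eq_of_fac_eq`).

The class commutes with localisation (`TwoSilt.fac_localize`). Over `Λ_p`, Nakayama's lemma deduces
the vanishing for a finitely generated `X` from the vanishing for `X/pX`, so modules of finite
length already determine the order. With (a) and (b), each `tors (Fl Λ_p)` becomes a copy of `2-silt
Λ` through `TwoSilt.flAt`, and a family of torsion classes becomes a function `f : Spec R → 2-silt
Λ`. For `q ⊆ p`, the same Nakayama argument shows that `r_{p,q}` sends the class of `x` at `p` into
the class of `x` at `q` (`rMap_le`). So compatibility of the family forces `f q ≤ f p`.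

Three facts finish the proof. The values of `Φ_t` are compatible, without (a) and (b)
(`phiT_mem_compatibleFamilies`). `Φ_t` reflects the order, because membership in a torsion class is
detected on the modules `X_p/pX_p` (`IsTorsionClass.of_residue`). Finally, every order-preserving
`f` is realised by `torsOf f` (`phiT_torsOf`): a module of finite length over `Λ_p` has a dense
finitely generated `Λ`-submodule supported on the primes containing `p`, and there `f` takes values
at least `f p`. -/

namespace SiltingTorsion

/-! ### Linear algebra of two-term presentations -/

section TwoTermMaps

variable {A : Type u} [Ring A]

/-- Every linear map `P₁ → X` extends along `d : P₁ → P₀`; for a two-term complex `P` with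
differential `d` this says that `Hom(P, X[1]) = 0`. -/
def ExtendsAlong {P₁ P₀ : Type u} [AddCommGroup P₁] [Module A P₁] [AddCommGroup P₀] [Module A P₀]
    (d : P₁ →ₗ[A] P₀) (X : Type u) [AddCommGroup X] [Module A X] : Prop :=
  ∀ g : P₁ →ₗ[A] X, ∃ h : P₀ →ₗ[A] X, h ∘ₗ d = g

/-- Every linear map `P₁ → Q₀` is null-homotopic; for two-term complexes `P` and `Q` with
differentials `d` and `e` this says that `Hom(P, Q[1]) = 0`. -/
def NullHomotopic {P₁ P₀ Q₁ Q₀ : Type u} [AddCommGroup P₁] [Module A P₁] [AddCommGroup P₀]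
    [Module A P₀] [AddCommGroup Q₁] [Module A Q₁] [AddCommGroup Q₀] [Module A Q₀]
    (d : P₁ →ₗ[A] P₀) (e : Q₁ →ₗ[A] Q₀) : Prop :=
  ∀ g : P₁ →ₗ[A] Q₀, ∃ (h : P₀ →ₗ[A] Q₀) (k : P₁ →ₗ[A] Q₁), g = h ∘ₗ d + e ∘ₗ k

/-- `X` is a quotient of a finite power of `M`. -/
def IsQuotientOfPower (A : Type u) [Ring A] (M X : Type u) [AddCommGroup M] [Module A M]
    [AddCommGroup X] [Module A X] : Prop :=
  ∃ (n : ℕ) (f : (Fin n → M) →ₗ[A] X), Function.Surjective f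

lemma IsQuotientOfPower.of_surjective {M X Y : Type u} [AddCommGroup M] [Module A M]
    [AddCommGroup X] [Module A X] [AddCommGroup Y] [Module A Y] (h : IsQuotientOfPower A M X)
    (f : X →ₗ[A] Y) (hf : Function.Surjective f) : IsQuotientOfPower A M Y := by
  obtain ⟨n, g, hg⟩ := h
  exact ⟨n, f ∘ₗ g, hf.comp hg⟩

lemma IsQuotientOfPower.of_surjective_left {M N X : Type u} [AddCommGroup M] [Module A M]
    [AddCommGroup X] [Module A X] [AddCommGroup N] [Module A N] (h : IsQuotientOfPower A M X)
    (f : N →ₗ[A] M) (hf : Function.Surjective f) : IsQuotientOfPower A N X := by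
  obtain ⟨n, g, hg⟩ := h
  exact ⟨n, g ∘ₗ LinearMap.compLeft f (Fin n), hg.comp hf.comp_left⟩

lemma IsQuotientOfPower.trans {M N X : Type u} [AddCommGroup M] [Module A M]
    [AddCommGroup X] [Module A X] [AddCommGroup N] [Module A N] (h : IsQuotientOfPower A M N)
    (h' : IsQuotientOfPower A N X) : IsQuotientOfPower A M X := by
  obtain ⟨n, g, hg⟩ := h
  obtain ⟨m, f, hf⟩ := h'
  let e : (Fin (m * n) → M) ≃ₗ[A] (Fin m → Fin n → M) :=
    (LinearEquiv.funCongrLeft A M finProdFinEquiv).trans (LinearEquiv.curry A M (Fin m) (Fin n))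
  exact ⟨m * n, f ∘ₗ LinearMap.compLeft g (Fin m) ∘ₗ e.toLinearMap,
    hf.comp (hg.comp_left.comp e.surjective)⟩

lemma IsQuotientOfPower.finite {M X : Type u} [AddCommGroup M] [Module A M]
    [AddCommGroup X] [Module A X] [Module.Finite A M] (h : IsQuotientOfPower A M X) :
    Module.Finite A X := by
  obtain ⟨n, g, hg⟩ := h
  exact Module.Finite.of_surjective g hg

lemma fac_iff {M X : ModuleCat.{u} A} : fac M X ↔ IsQuotientOfPower A M X := by
  constructor
  · rintro ⟨Y, f, ⟨n, i, p, h⟩, hf⟩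
    rw [ModuleCat.epi_iff_surjective] at hf
    refine IsQuotientOfPower.of_surjective ⟨n, LinearMap.lsum A (fun _ => M) ℕ fun k => (p k).hom,
      fun y => ⟨fun k => (i k).hom y, ?_⟩⟩ f.hom hf
    simpa [ModuleCat.hom_sum] using congrArg (fun t => t.hom y) h
  · rintro ⟨n, f, hf⟩
    refine ⟨ModuleCat.of A (Fin n → M), ModuleCat.ofHom f,
      ⟨n, fun k => ModuleCat.ofHom (LinearMap.proj k),
        fun k => ModuleCat.ofHom (LinearMap.single A (fun _ => M) k), ?_⟩, ?_⟩
    · refine ModuleCat.hom_ext (LinearMap.ext fun (x : Fin n → M) => ?_)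
      simpa [ModuleCat.hom_sum] using LinearMap.sum_single_apply (φ := fun _ : Fin n => M) x
    · rwa [ModuleCat.epi_iff_surjective]

variable {P₁ P₀ Q₁ Q₀ : Type u} [AddCommGroup P₁] [Module A P₁] [AddCommGroup P₀]
  [Module A P₀] [AddCommGroup Q₁] [Module A Q₁] [AddCommGroup Q₀] [Module A Q₀]
  {X Y : Type u} [AddCommGroup X] [Module A X] [AddCommGroup Y] [Module A Y]
  {d : P₁ →ₗ[A] P₀} {e : Q₁ →ₗ[A] Q₀}

/-- Projectivity of `P₁` lifts a map into the quotient back to `X`, where it extends. -/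
lemma ExtendsAlong.of_surjective [Module.Projective A P₁] (h : ExtendsAlong d X) (f : X →ₗ[A] Y)
    (hf : Function.Surjective f) : ExtendsAlong d Y := by
  intro g
  obtain ⟨g', rfl⟩ := Module.projective_lifting_property f g hf
  obtain ⟨k, rfl⟩ := h g'
  exact ⟨f ∘ₗ k, by rw [LinearMap.comp_assoc]⟩

/-- This is exactness of `Hom(P, -[1])` in the middle. The extension found over `Z` lifts to `Y`
since `P₀` is projective, and the remaining error takes values in `X`. -/
lemma ExtendsAlong.of_extension [Module.Projective A P₀] {Z : Type u} [AddCommGroup Z] [Module A Z]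
    (f : X →ₗ[A] Y) (g : Y →ₗ[A] Z) (hf : Function.Injective f) (hg : Function.Surjective g)
    (hfg : Function.Exact f g) (hX : ExtendsAlong d X) (hZ : ExtendsAlong d Z) :
    ExtendsAlong d Y := by
  intro a
  obtain ⟨b, hb⟩ := hZ (g ∘ₗ a)
  obtain ⟨b', rfl⟩ := Module.projective_lifting_property g b hg
  have hr : ∀ x, (a - b' ∘ₗ d) x ∈ LinearMap.range f := by
    intro x
    have := LinearMap.congr_fun hb x
    simp only [LinearMap.comp_apply] at this
    exact (hfg _).1 (by simp [this])
  let c : P₁ →ₗ[A] X := (LinearEquiv.ofInjective f hf).symm.toLinearMap ∘ₗ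
    LinearMap.codRestrict (LinearMap.range f) (a - b' ∘ₗ d) hr
  have hc : ∀ x, f (c x) = (a - b' ∘ₗ d) x := fun x => by
    exact congrArg Subtype.val ((LinearEquiv.ofInjective f hf).apply_symm_apply
      (LinearMap.codRestrict (LinearMap.range f) (a - b' ∘ₗ d) hr x))
  obtain ⟨k, hk⟩ := hX c
  refine ⟨b' + f ∘ₗ k, LinearMap.ext fun x => ?_⟩
  have h1 := hc x
  rw [← hk] at h1
  simp only [LinearMap.comp_apply, LinearMap.sub_apply] at h1
  simp [h1]

lemma ExtendsAlong.pi (h : ExtendsAlong d X) (n : ℕ) : ExtendsAlong d (Fin n → X) := by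
  intro g
  choose k hk using fun i => h (LinearMap.proj i ∘ₗ g)
  exact ⟨LinearMap.pi k, LinearMap.ext fun x => funext fun i => LinearMap.congr_fun (hk i) x⟩

lemma ExtendsAlong.of_isQuotientOfPower [Module.Projective A P₁] (h : ExtendsAlong d X)
    (hY : IsQuotientOfPower A X Y) : ExtendsAlong d Y := by
  obtain ⟨n, f, hf⟩ := hY
  exact (h.pi n).of_surjective f hf

/-- Both terms of `P` are projective, so a map `P₁ → Q₀` matters only modulo the range of `e`:
`Hom(P, Q[1])` can be replaced by `Hom(P, H⁰(Q)[1])`. -/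
lemma nullHomotopic_iff [Module.Projective A P₁] [Module.Projective A P₀] :
    NullHomotopic d e ↔ ExtendsAlong d (Q₀ ⧸ LinearMap.range e) := by
  constructor
  · intro h g
    obtain ⟨g', rfl⟩ := Module.projective_lifting_property (LinearMap.range e).mkQ g
      (Submodule.mkQ_surjective _)
    obtain ⟨a, b, rfl⟩ := h g'
    refine ⟨(LinearMap.range e).mkQ ∘ₗ a, LinearMap.ext fun x => ?_⟩
    simp
  · intro h g
    obtain ⟨a, ha⟩ := h ((LinearMap.range e).mkQ ∘ₗ g)
    obtain ⟨b, rfl⟩ := Module.projective_lifting_property (LinearMap.range e).mkQ a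
      (Submodule.mkQ_surjective _)
    have hr : ∀ x, (g - b ∘ₗ d) x ∈ LinearMap.range e := fun x => by
      have := LinearMap.congr_fun ha x
      rw [← Submodule.ker_mkQ (LinearMap.range e), LinearMap.mem_ker]
      simp only [LinearMap.comp_apply] at this
      rw [LinearMap.sub_apply, map_sub, LinearMap.comp_apply, this, sub_self]
    obtain ⟨k, hk⟩ := Module.projective_lifting_property e.rangeRestrict
      (LinearMap.codRestrict (LinearMap.range e) (g - b ∘ₗ d) hr) e.surjective_rangeRestrict
    refine ⟨b, k, LinearMap.ext fun x => ?_⟩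
    have := congrArg Subtype.val (LinearMap.congr_fun hk x)
    simp only [LinearMap.comp_apply, LinearMap.codRestrict_apply, LinearMap.sub_apply] at this
    change e (k x) = _ at this
    simp [this]

/-- The modules `X` with `Hom(P, X[1]) = 0` are the factor modules of powers of `H⁰(P)`, when `P`
is presilting and detects zero modules. -/
lemma ExtendsAlong.isQuotientOfPower [Module.Projective A P₀] [Module.Projective A P₁]
    (hgen : ∀ (Y : Type u) [AddCommGroup Y] [Module A Y], ExtendsAlong d Y →
      (∀ h : P₀ →ₗ[A] Y, h ∘ₗ d = 0 → h = 0) → Subsingleton Y)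
    (hP : NullHomotopic d d) [IsNoetherian A X] (hX : ExtendsAlong d X) :
    IsQuotientOfPower A (P₀ ⧸ LinearMap.range d) X := by
  let M := P₀ ⧸ LinearMap.range d
  -- The trace of `M = H⁰(P)` in `X`. It is a quotient of a finite power of `M` because `X` is
  -- Noetherian, and the goal is that it is everything.
  let t : Submodule A X := ⨆ f : M →ₗ[A] X, LinearMap.range f
  obtain ⟨n, F, hF⟩ : ∃ (n : ℕ) (F : (Fin n → M) →ₗ[A] X), LinearMap.range F = t := by
    have hfg : t.FG := IsNoetherian.noetherian t
    have hc : IsCompactElement t := (Submodule.fg_iff_compact t).1 hfg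
    obtain ⟨s, hs⟩ := CompleteLattice.IsCompactElement.exists_finset_of_le_iSup _ hc
      (fun f : M →ₗ[A] X => LinearMap.range f) le_rfl
    refine ⟨s.card, LinearMap.lsum A (fun _ => M) ℕ fun k => (s.equivFin.symm k).1, ?_⟩
    apply le_antisymm
    · rintro _ ⟨x, rfl⟩
      simp only [LinearMap.lsum_apply, LinearMap.sum_apply, LinearMap.comp_apply]
      exact sum_mem fun k _ => (le_iSup (fun f : M →ₗ[A] X => LinearMap.range f) _) ⟨_, rfl⟩
    · refine hs.trans (iSup₂_le fun f hf => ?_)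
      rintro _ ⟨x, rfl⟩
      refine ⟨Pi.single (s.equivFin ⟨f, hf⟩) x, ?_⟩
      rw [LinearMap.lsum_piSingle]
      simp
  have htq : IsQuotientOfPower A M t :=
    ⟨n, LinearMap.codRestrict t F fun x => hF ▸ ⟨x, rfl⟩, fun ⟨y, hy⟩ => by
      rw [← hF] at hy
      obtain ⟨x, hx⟩ := hy
      exact ⟨x, Subtype.ext hx⟩⟩
  have ht : ExtendsAlong d t := (nullHomotopic_iff.1 hP).of_isQuotientOfPower htq
  -- The quotient `X ⧸ t` satisfies both conditions of `hgen`: the first is inherited from `X`, and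
  -- the second says that every map `M → X ⧸ t` is zero.
  have hsub : Subsingleton (X ⧸ t) := by
    refine hgen _ (hX.of_surjective t.mkQ t.mkQ_surjective) fun h hh => ?_
    obtain ⟨h', rfl⟩ := Module.projective_lifting_property t.mkQ h t.mkQ_surjective
    have hr : ∀ x, h' (d x) ∈ t := fun x => by
      rw [← Submodule.ker_mkQ t, LinearMap.mem_ker]
      exact LinearMap.congr_fun hh x
    -- Subtracting an extension `k` of `h' ∘ d` with values in `t` makes `h'` vanish on the range of
    -- `d`, so the difference factors through `M` and lands in the trace.
    obtain ⟨k, hk⟩ := ht (LinearMap.codRestrict t (h' ∘ₗ d) hr)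
    have hk' : ∀ x, (k (d x) : X) = h' (d x) := fun x =>
      congrArg Subtype.val (LinearMap.congr_fun hk x)
    let f : M →ₗ[A] X := (LinearMap.range d).liftQ (h' - t.subtype ∘ₗ k) (by
      rintro _ ⟨x, rfl⟩
      simp [hk'])
    ext x
    have h1 : f (Submodule.Quotient.mk x) ∈ t :=
      (le_iSup (fun f : M →ₗ[A] X => LinearMap.range f) f) ⟨_, rfl⟩
    have h2 : f (Submodule.Quotient.mk x) = h' x - k x := rfl
    rw [h2] at h1
    have h3 := t.add_mem h1 (k x).2
    rw [sub_add_cancel] at h3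
    simpa using h3
  have htop : t = ⊤ := (Submodule.Quotient.subsingleton_iff).1 hsub
  exact htq.of_surjective t.subtype fun x => ⟨⟨x, htop ▸ trivial⟩, rfl⟩

/-- `Q` is a direct summand of `P'`, up to homotopy, when `P'` is a sum of copies of `P` that
covers `Q`. -/
lemma exists_section_of_cover {P₁' P₀' : Type u} [AddCommGroup P₁'] [Module A P₁']
    [AddCommGroup P₀'] [Module A P₀'] (d' : P₁' →ₗ[A] P₀') [IsNoetherian A P₀'] [IsNoetherian A Q₁]
    [Module.Projective A P₁] [Module.Projective A Q₁] [Module.Projective A Q₀]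
    (a₁ : P₁' →ₗ[A] Q₁) (a₀ : P₀' →ₗ[A] Q₀) (ha : a₀ ∘ₗ d' = e ∘ₗ a₁)
    (hP : NullHomotopic d d') (hsurj : ∀ y, ∃ x z, a₀ x + e z = y)
    (hgen : ∀ (f₁ : P₁ →ₗ[A] Q₁) (f₀ : P₀ →ₗ[A] Q₀), f₀ ∘ₗ d = e ∘ₗ f₁ →
      ∃ (c₁ : P₁ →ₗ[A] P₁') (c₀ : P₀ →ₗ[A] P₀'), c₀ ∘ₗ d = d' ∘ₗ c₁ ∧ a₁ ∘ₗ c₁ = f₁ ∧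
        a₀ ∘ₗ c₀ = f₀)
    (H : ∀ (L : Type u) [AddCommGroup L] [Module A L] [IsNoetherian A L],
      ExtendsAlong d L → ExtendsAlong e L) :
    ∃ (b₁ : Q₁ →ₗ[A] P₁') (b₀ : Q₀ →ₗ[A] P₀') (c : Q₀ →ₗ[A] Q₁), b₀ ∘ₗ e = d' ∘ₗ b₁ ∧
      a₁ ∘ₗ b₁ + c ∘ₗ e = LinearMap.id ∧ a₀ ∘ₗ b₀ + e ∘ₗ c = LinearMap.id := by
  -- The cover is onto on `H⁰`, so its cone is homotopy equivalent to `j : P₁' → K`, with `K` the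
  -- kernel of `w`. A section exists once the map from `Q` to this cone is null-homotopic.
  let w : P₀' × Q₁ →ₗ[A] Q₀ := a₀.coprod e
  have hw : Function.Surjective w := fun y => by
    obtain ⟨x, z, h⟩ := hsurj y
    exact ⟨(x, z), h⟩
  have ha' : ∀ x, a₀ (d' x) = e (a₁ x) := LinearMap.congr_fun ha
  obtain ⟨s, hs⟩ := Module.projective_lifting_property w LinearMap.id hw
  have hs' : ∀ x, w (s x) = x := LinearMap.congr_fun hs
  let K := LinearMap.ker w
  let j : P₁' →ₗ[A] K := LinearMap.codRestrict K (d'.prod (-a₁)) fun x => by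
    simp [K, w, ha']
  let q := (LinearMap.range j).mkQ
  have hq : Function.Surjective q := Submodule.mkQ_surjective _
  have hL : ExtendsAlong d (K ⧸ LinearMap.range j) := by
    intro g
    obtain ⟨g, rfl⟩ := Module.projective_lifting_property q g hq
    let u : P₁ →ₗ[A] P₀' := LinearMap.fst A P₀' Q₁ ∘ₗ K.subtype ∘ₗ g
    let v : P₁ →ₗ[A] Q₁ := LinearMap.snd A P₀' Q₁ ∘ₗ K.subtype ∘ₗ g
    have huv : ∀ x, a₀ (u x) + e (v x) = 0 := fun x => (g x).2
    obtain ⟨h, y, hu⟩ := hP u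
    have hu' : ∀ x, u x = h (d x) + d' (y x) := LinearMap.congr_fun hu
    -- The chain map `(v + a₁ y, -a₀ h)` from `P` to `Q` lifts through the cover; the lift corrects
    -- `h` to a map with values in `K`.
    obtain ⟨c₁, c₀, hc, hc₁, hc₀⟩ := hgen (v + a₁ ∘ₗ y) (-(a₀ ∘ₗ h)) (by
      ext x
      have := huv x
      rw [hu', map_add, ha'] at this
      simp only [LinearMap.comp_apply, LinearMap.neg_apply, LinearMap.add_apply, map_add]
      rw [neg_eq_iff_add_eq_zero, ← this]
      abel)
    replace hc := LinearMap.congr_fun hc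
    replace hc₁ := LinearMap.congr_fun hc₁
    replace hc₀ := LinearMap.congr_fun hc₀
    simp only [LinearMap.comp_apply, LinearMap.neg_apply, LinearMap.add_apply] at hc hc₁ hc₀
    let k : P₀ →ₗ[A] K := LinearMap.codRestrict K ((h + c₀).prod 0) fun x => by
      simp [K, w, hc₀]
    refine ⟨q ∘ₗ k, LinearMap.ext fun x => ?_⟩
    rw [LinearMap.comp_apply, LinearMap.comp_apply, LinearMap.comp_apply, ← sub_eq_zero, ← map_sub,
      ← LinearMap.mem_ker, Submodule.ker_mkQ]
    refine ⟨c₁ x - y x, Subtype.ext (Prod.ext ?_ ?_)⟩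
    · change d' (c₁ x - y x) = h (d x) + c₀ (d x) - u x
      rw [hu', hc, map_sub]
      abel
    · change -a₁ (c₁ x - y x) = 0 - v x
      rw [map_sub, hc₁]
      abel
  -- In terms of the splitting `s`, this is the map from `Q` to the cone. `H` makes it
  -- null-homotopic, and the resulting `h` and `k` supply the section and the homotopy.
  let i : Q₁ →ₗ[A] K := LinearMap.codRestrict K (LinearMap.inr A P₀' Q₁ - s ∘ₗ e) fun x => by
    simp only [K, LinearMap.mem_ker, LinearMap.sub_apply, map_sub, LinearMap.comp_apply, hs']
    simp [w]
  obtain ⟨h, hh⟩ := H _ hL (q ∘ₗ i)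
  obtain ⟨h, rfl⟩ := Module.projective_lifting_property q h hq
  have hr : ∀ x, (i - h ∘ₗ e) x ∈ LinearMap.range j := fun x => by
    rw [← Submodule.ker_mkQ (LinearMap.range j), LinearMap.mem_ker, LinearMap.sub_apply, map_sub,
      sub_eq_zero]
    exact (LinearMap.congr_fun hh x).symm
  obtain ⟨k, hk⟩ := Module.projective_lifting_property j.rangeRestrict
    (LinearMap.codRestrict (LinearMap.range j) (i - h ∘ₗ e) hr) j.surjective_rangeRestrict
  have hk1 : ∀ x, d' (k x) = 0 - (s (e x)).1 - (h (e x)).1.1 := fun x =>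
    congrArg (fun t => t.1.1.1) (LinearMap.congr_fun hk x)
  have hk2 : ∀ x, -a₁ (k x) = x - (s (e x)).2 - (h (e x)).1.2 := fun x =>
    congrArg (fun t => t.1.1.2) (LinearMap.congr_fun hk x)
  refine ⟨-k, LinearMap.fst A P₀' Q₁ ∘ₗ (s + K.subtype ∘ₗ h),
    LinearMap.snd A P₀' Q₁ ∘ₗ (s + K.subtype ∘ₗ h), ?_, ?_, ?_⟩
  · ext x
    simp [hk1]
    abel
  · ext x
    simp [hk2]
  · ext x
    have h1 : w (s x + (h x).1) = x := by
      rw [map_add, hs', (h x).2, add_zero]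
    exact h1

end TwoTermMaps

/-! ### Chain maps and homotopies out of two-term complexes -/

section TwoTermHom

open CochainComplex HomComplex

variable {C : Type*} [Category* C] [Preadditive C]

/-- A morphism out of a complex concentrated in degrees `-1` and `0`. -/
lemma exists_hom_of_isZero {K L : CochainComplex C ℤ} (hK : ∀ n, n ≠ -1 → n ≠ 0 → IsZero (K.X n))
    (g : K.X (-1) ⟶ L.X (-1)) (g' : K.X 0 ⟶ L.X 0) (h : g ≫ L.d (-1) 0 = K.d (-1) 0 ≫ g')
    (h' : g' ≫ L.d 0 1 = 0) : ∃ f : K ⟶ L, f.f (-1) = g ∧ f.f 0 = g' := by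
  let F : ∀ n, K.X n ⟶ L.X n := fun n =>
    if hn : n = -1 then eqToHom (by rw [hn]) ≫ g ≫ eqToHom (by rw [hn]) else
    if hn : n = 0 then eqToHom (by rw [hn]) ≫ g' ≫ eqToHom (by rw [hn]) else 0
  have F1 : F (-1) = g := by simp [F]
  have F0 : F 0 = g' := by simp [F]
  refine ⟨{ f := F, comm' := ?_ }, F1, F0⟩
  rintro i j (rfl : i + 1 = j)
  by_cases h1 : i = -1
  · subst h1
    exact (congrArg (· ≫ L.d (-1) 0) F1).trans (h.trans (congrArg (K.d (-1) 0 ≫ ·) F0.symm))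
  · by_cases h0 : i = 0
    · subst h0
      refine (congrArg (· ≫ L.d 0 1) F0).trans (h'.trans ?_)
      rw [(hK (0 + 1) (by lia) (by lia)).eq_of_tgt (K.d 0 (0 + 1)) 0, zero_comp]
    · exact (hK i h1 h0).eq_of_src _ _

/-- Null-homotopic morphisms out of a complex concentrated in degrees `-1` and `0`. -/
lemma quotient_map_eq_zero_iff_of_isZero {K L : CochainComplex C ℤ}
    (hK : ∀ n, n ≠ -1 → n ≠ 0 → IsZero (K.X n)) (f : K ⟶ L) :
    (HomotopyCategory.quotient _ _).map f = 0 ↔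
      ∃ (h : K.X 0 ⟶ L.X (-1)) (k : K.X (-1) ⟶ L.X (-2)),
        f.f (-1) = K.d (-1) 0 ≫ h + k ≫ L.d (-2) (-1) ∧ f.f 0 = h ≫ L.d (-1) 0 := by
  rw [HomotopyCategory.quotient_map_eq_zero_iff]
  constructor
  · rintro ⟨H⟩
    refine ⟨H.hom 0 (-1), H.hom (-1) (-2), ?_, ?_⟩
    · have := H.comm (-1)
      rw [dNext_eq H.hom (show (ComplexShape.up ℤ).Rel (-1) 0 by simp),
        prevD_eq H.hom (show (ComplexShape.up ℤ).Rel (-2) (-1) by simp)] at this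
      simpa using this
    · have := H.comm 0
      rw [dNext_eq H.hom (show (ComplexShape.up ℤ).Rel 0 1 by simp),
        prevD_eq H.hom (show (ComplexShape.up ℤ).Rel (-1) 0 by simp),
        (hK 1 (by lia) (by lia)).eq_of_tgt (K.d 0 1) 0] at this
      simpa using this
  · rintro ⟨h, k, h1, h0⟩
    -- Only the components of a homotopy out of degrees `0` and `-1` can be nonzero.
    refine ⟨(Cochain.equivHomotopy f 0).symm ⟨Cochain.single h (-1) + Cochain.single k (-1), ?_⟩⟩
    rw [δ_add, Cochain.δ_single h (-1) 0 (by lia) (-1) 0 (by lia) (by lia),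
      Cochain.δ_single k (-1) 0 (by lia) (-2) (-1) (by lia) (by lia)]
    ext p
    by_cases hp1 : p = -1
    · subst hp1
      simp [Cochain.single_v_eq_zero, h1]
    · by_cases hp0 : p = 0
      · subst hp0
        simp [Cochain.single_v_eq_zero, h0]
      · exact (hK p hp1 hp0).eq_of_src _ _

end TwoTermHom

/-! ### From the homotopy category to linear maps -/

section Bridge

variable {A : Type u} [Ring A]

/-- The differential of a two-term complex as a linear map. -/
abbrev diff (K : CochainComplex (ModuleCat.{u} A) ℤ) : K.X (-1) →ₗ[A] K.X 0 := (K.d (-1) 0).hom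

/-- The quotient functor is full and commutes with shifts, so the vanishing can be tested on chain
maps. -/
lemma homVanish_iff_forall (K L : CochainComplex (ModuleCat.{u} A) ℤ) :
    HomVanish ((HomotopyCategory.quotient _ _).obj K) ((HomotopyCategory.quotient _ _).obj L) ↔
      ∀ i : ℤ, 0 < i → ∀ f : K ⟶ L⟦i⟧, (HomotopyCategory.quotient _ _).map f = 0 := by
  constructor
  · intro h i hi f
    rw [← cancel_mono (((HomotopyCategory.quotient _ _).commShiftIso i).hom.app L),
      h i hi ((HomotopyCategory.quotient _ _).map f ≫ _), zero_comp]
  · intro h i hi f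
    obtain ⟨g, hg⟩ := (HomotopyCategory.quotient _ _).map_surjective
      (f ≫ ((HomotopyCategory.quotient _ _).commShiftIso i).inv.app L)
    rw [← cancel_mono (((HomotopyCategory.quotient _ _).commShiftIso i).inv.app L), ← hg, h i hi g,
      zero_comp]

/-- A shift by `i > 1` leaves no common degree. For `i = 1` a chain map is an arbitrary linear map
from degree `-1` of `K` to degree `0` of `L`. -/
lemma homVanish_iff_nullHomotopic {K L : CochainComplex (ModuleCat.{u} A) ℤ}
    (hK : ∀ n, n ≠ -1 → n ≠ 0 → IsZero (K.X n)) (hL : ∀ n, n ≠ -1 → n ≠ 0 → IsZero (L.X n)) :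
    HomVanish ((HomotopyCategory.quotient _ _).obj K) ((HomotopyCategory.quotient _ _).obj L) ↔
      NullHomotopic (diff K) (diff L) := by
  rw [homVanish_iff_forall]
  -- The shift negates the differential, so `k` changes sign between the two descriptions.
  have hd : (L⟦(1 : ℤ)⟧).d (-2) (-1) = -(L.d (-1) 0) := by
    rw [CochainComplex.shiftFunctor_obj_d', Int.negOnePow_one, Units.neg_smul, one_smul]
    rfl
  constructor
  · intro H g
    have hz : IsZero ((L⟦(1 : ℤ)⟧).X 0) := hL (0 + 1) (by lia) (by lia)
    obtain ⟨f, hf, hf'⟩ := exists_hom_of_isZero (L := L⟦(1 : ℤ)⟧) hK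
      (ModuleCat.ofHom g : K.X (-1) ⟶ L.X 0) 0 (hz.eq_of_tgt _ _) zero_comp
    obtain ⟨h, k, hk, -⟩ := (quotient_map_eq_zero_iff_of_isZero hK f).1 (H 1 one_pos f)
    rw [hf, hd] at hk
    refine ⟨h.hom, -k.hom, LinearMap.ext fun x => ?_⟩
    have := LinearMap.congr_fun (congrArg ModuleCat.Hom.hom hk) x
    refine this.trans ?_
    let h' : K.X 0 ⟶ L.X 0 := h
    let k' : K.X (-1) ⟶ L.X (-1) := k
    change h'.hom ((K.d (-1) 0).hom x) + -(L.d (-1) 0).hom (k'.hom x) =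
      h'.hom ((K.d (-1) 0).hom x) + (L.d (-1) 0).hom (-k'.hom x)
    rw [map_neg]
  · intro H i hi f
    rw [quotient_map_eq_zero_iff_of_isZero hK]
    by_cases hi1 : i = 1
    · subst hi1
      obtain ⟨h, k, hk⟩ := H (f.f (-1)).hom
      have hz : IsZero ((L⟦(1 : ℤ)⟧).X 0) := hL (0 + 1) (by lia) (by lia)
      refine ⟨ModuleCat.ofHom h, -ModuleCat.ofHom k, ?_, hz.eq_of_tgt _ _⟩
      rw [hd]
      refine ModuleCat.hom_ext (LinearMap.ext fun x => ?_)
      refine (LinearMap.congr_fun hk x).trans ?_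
      change h ((K.d (-1) 0).hom x) + (L.d (-1) 0).hom (k x) =
        h ((K.d (-1) 0).hom x) + -(L.d (-1) 0).hom (-k x)
      rw [map_neg, neg_neg]
    · have hz : ∀ n, -1 ≤ n → IsZero ((L⟦i⟧).X n) := fun n hn => hL (n + i) (by lia) (by lia)
      exact ⟨0, 0, (hz _ le_rfl).eq_of_tgt _ _, (hz 0 (by lia)).eq_of_tgt _ _⟩

/-- A two-term complex that generates `K^b(proj A)` detects zero modules. -/
lemma subsingleton_of_generates {K : CochainComplex (ModuleCat.{u} A) ℤ}
    (hK : ∀ n, n ≠ -1 → n ≠ 0 → IsZero (K.X n))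
    (hgen : Kbproj A ≤ (ObjectProperty.singleton
      ((HomotopyCategory.quotient _ _).obj K)).triangEnvelope)
    (Y : Type u) [AddCommGroup Y] [Module A Y] (h1 : ExtendsAlong (diff K) Y)
    (h0 : ∀ h : K.X 0 →ₗ[A] Y, h ∘ₗ diff K = 0 → h = 0) : Subsingleton Y := by
  let S : ℤ → KMod A := fun i =>
    (HomotopyCategory.singleFunctor (ModuleCat.{u} A) i).obj (ModuleCat.of A Y)
  -- The left orthogonal of all shifts of `Y` is a thick subcategory. It contains `K`, hence `A`,
  -- and then every map `A → Y` vanishes.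
  let T : ObjectProperty (KMod A) := fun Z => ∃ i : ℤ, Nonempty (Z ≅ S i)
  have hT : T.IsStableUnderShift ℤ :=
    { isStableUnderShiftBy := fun n => ⟨by
        rintro Z ⟨i, ⟨e⟩⟩
        exact ⟨i - n, ⟨(shiftFunctor _ n).mapIso e ≪≫
          ((HomotopyCategory.singleFunctors (ModuleCat.{u} A)).shiftIso n (i - n) i (by lia)).app
            (ModuleCat.of A Y)⟩⟩⟩ }
  have hT' : T.leftOrthogonal.IsStableUnderRetracts :=
    ⟨fun r h Z f hZ => by rw [← Category.id_comp f, ← r.retract, Category.assoc, h (r.r ≫ f) hZ, comp_zero]⟩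
  have hle : (ObjectProperty.singleton ((HomotopyCategory.quotient _ _).obj K)).triangEnvelope ≤
      T.leftOrthogonal := by
    rw [ObjectProperty.triangEnvelope_le_iff]
    rintro _ ⟨⟩ Z f ⟨i, ⟨e⟩⟩
    rw [← cancel_mono e.hom, zero_comp]
    obtain ⟨g, hg⟩ := (HomotopyCategory.quotient _ _).map_surjective (Y :=
      (HomologicalComplex.single (ModuleCat.{u} A) (ComplexShape.up ℤ) i).obj (ModuleCat.of A Y))
      (f ≫ e.hom)
    refine hg.symm.trans ((quotient_map_eq_zero_iff_of_isZero hK g).2 ?_)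
    have hz : ∀ n, n ≠ i → IsZero (((HomologicalComplex.single (ModuleCat.{u} A)
      (ComplexShape.up ℤ) i).obj (ModuleCat.of A Y)).X n) := fun n hn =>
      HomologicalComplex.isZero_single_obj_X _ _ _ _ hn
    -- Only the copies of `Y` in degrees `-1` and `0` meet `K`; they are handled by `h1` and `h0`
    -- respectively.
    by_cases hi : i = -1
    · subst hi
      let e1 : _ ≅ ModuleCat.of A Y := HomologicalComplex.singleObjXSelf (ComplexShape.up ℤ) (-1)
        (ModuleCat.of A Y)
      obtain ⟨h, hh⟩ := h1 (g.f (-1) ≫ e1.hom).hom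
      refine ⟨ModuleCat.ofHom h ≫ e1.inv, 0, ?_, (hz 0 (by lia)).eq_of_tgt _ _⟩
      rw [zero_comp, add_zero, ← cancel_mono e1.hom]
      simp only [Category.assoc, Iso.inv_hom_id, Category.comp_id]
      exact ModuleCat.hom_ext hh.symm
    · by_cases hi0 : i = 0
      · subst hi0
        let e1 : _ ≅ ModuleCat.of A Y := HomologicalComplex.singleObjXSelf (ComplexShape.up ℤ) 0
          (ModuleCat.of A Y)
        refine ⟨0, 0, (hz (-1) (by lia)).eq_of_tgt _ _, ?_⟩
        rw [zero_comp, ← cancel_mono e1.hom, zero_comp]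
        refine ModuleCat.hom_ext (h0 _ ?_)
        have hc : K.d (-1) 0 ≫ g.f 0 = 0 := by
          rw [← g.comm]
          exact (((hz (-1) (by lia)).eq_of_tgt (g.f (-1)) 0) ▸ zero_comp)
        have := congrArg (fun t => (t ≫ e1.hom).hom) hc
        simpa using this
      · exact ⟨0, 0, (hz _ (by lia)).eq_of_tgt _ _, (hz _ (by lia)).eq_of_tgt _ _⟩
  have hA : Kbproj A (HomotopyCategory.singleFunctor (ModuleCat.{u} A) 0 |>.obj
      (ModuleCat.of A A)) := by
    refine ⟨(HomologicalComplex.single _ _ 0).obj (ModuleCat.of A A), fun n => ?_, ⟨0, 0, ?_⟩,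
      ⟨Iso.refl _⟩⟩
    · by_cases hn : n = 0
      · subst hn
        exact (fgProj_iff _).2
          (addOf_of_iso' (addOf_refl _) (HomologicalComplex.singleObjXSelf _ _ _))
      · exact (fgProj_iff _).2 ⟨0, Fin.elim0, Fin.elim0,
          (HomologicalComplex.isZero_single_obj_X _ _ _ _ hn).eq_of_src _ _⟩
    · intro n hn
      exact HomologicalComplex.isZero_single_obj_X _ _ _ _ (by lia)
  refine ⟨fun x y => ?_⟩
  rw [← sub_eq_zero]
  generalize x - y = x
  let φ : ModuleCat.of A A ⟶ ModuleCat.of A Y := ModuleCat.ofHom (LinearMap.toSpanSingleton A Y x)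
  have hφ : φ = 0 := by
    have h := hle _ (hgen _ hA) ((HomotopyCategory.singleFunctor (ModuleCat.{u} A) 0).map φ)
      ⟨0, ⟨Iso.refl _⟩⟩
    obtain ⟨a, -, -, ha⟩ := (quotient_map_eq_zero_iff_of_isZero (fun n _ hn =>
      HomologicalComplex.isZero_single_obj_X _ _ _ _ hn)
        ((HomologicalComplex.single (ModuleCat.{u} A) (ComplexShape.up ℤ) 0).map φ)).1 h
    rw [((HomologicalComplex.isZero_single_obj_X (ComplexShape.up ℤ) 0 (ModuleCat.of A Y) (-1)
      (by lia)).eq_of_tgt a 0), zero_comp, HomologicalComplex.single_map_f_self] at ha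
    rwa [← cancel_epi (HomologicalComplex.singleObjXSelf (ComplexShape.up ℤ) 0 _).hom, comp_zero,
      ← cancel_mono (HomologicalComplex.singleObjXSelf (ComplexShape.up ℤ) 0 _).inv, zero_comp,
      Category.assoc]
  have := congrArg (fun t => t.hom (1 : A)) hφ
  simpa [φ] using this

/-- The zeroth homology of a two-term complex is the cokernel of its differential. -/
lemma exists_homology_iso {K : CochainComplex (ModuleCat.{u} A) ℤ}
    (hK : ∀ n, n ≠ -1 → n ≠ 0 → IsZero (K.X n)) :
    Nonempty ((HomotopyCategory.homologyFunctor (ModuleCat.{u} A) (ComplexShape.up ℤ) 0).obj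
      ((HomotopyCategory.quotient _ _).obj K) ≅
        ModuleCat.of A (K.X 0 ⧸ LinearMap.range (diff K))) := by
  have e1 := K.isoHomologyι 0 1 (by simp) ((hK 1 (by lia) (by lia)).eq_of_tgt _ _)
  have e2 := (K.opcyclesIsCokernel (-1) 0 (by simp)).coconePointUniqueUpToIso
    (ModuleCat.cokernelIsColimit (K.d (-1) 0))
  exact ⟨(HomotopyCategory.homologyFunctorFactors (ModuleCat.{u} A) (ComplexShape.up ℤ) 0).app K ≪≫
    e1 ≪≫ e2⟩

end Bridge

/-! ### Silting complexes and their `Fac` classes -/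

section SiltingComplexes

variable {A : Type u} [Ring A]

/-- A homomorphism is determined by its values on generators of `M`, which embeds the homomorphisms
in a finite power of `N`. This finiteness yields finite universal maps and allows Nakayama's lemma
on Hom modules. -/
lemma isNoetherian_linearMap (R : Type u) [CommRing R] [IsNoetherianRing R] [Algebra R A]
    [Module.Finite R A] (M N : Type u) [AddCommGroup M] [Module A M] [AddCommGroup N] [Module A N]
    [Module R N] [IsScalarTower R A N] [Module.Finite A M] [Module.Finite A N] :
    IsNoetherian R (M →ₗ[A] N) := by
  have : Module.Finite R N := Module.Finite.trans A N
  have : IsNoetherian R N := isNoetherian_of_isNoetherianRing_of_finite R N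
  obtain ⟨n, f, hf⟩ := Module.Finite.exists_fin' A M
  let φ : (M →ₗ[A] N) →ₗ[R] (Fin n → N) :=
    { toFun := fun g k => g (f (Pi.single k 1))
      map_add' := fun _ _ => rfl
      map_smul' := fun _ _ => rfl }
  refine isNoetherian_of_injective φ fun g g' h => ?_
  have h1 : g ∘ₗ f = g' ∘ₗ f := by
    refine LinearMap.pi_ext' fun k => LinearMap.ext_ring ?_
    exact congrFun h k
  ext x
  obtain ⟨y, rfl⟩ := hf x
  exact LinearMap.congr_fun h1 y

/-- The morphisms of complexes from `P` to `Q` factor through a single morphism from a finite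
power of `P`. -/
lemma exists_universal_chain_map (R : Type u) [CommRing R] [IsNoetherianRing R] [Algebra R A]
    [Module.Finite R A] {P₁ P₀ Q₁ Q₀ : Type u} [AddCommGroup P₁] [Module A P₁] [AddCommGroup P₀]
    [Module A P₀] [AddCommGroup Q₁] [Module A Q₁] [AddCommGroup Q₀] [Module A Q₀]
    [Module.Finite A P₁] [Module.Finite A P₀] [Module.Finite A Q₁] [Module.Finite A Q₀]
    (d : P₁ →ₗ[A] P₀) (e : Q₁ →ₗ[A] Q₀) :
    ∃ (n : ℕ) (a₁ : (Fin n → P₁) →ₗ[A] Q₁) (a₀ : (Fin n → P₀) →ₗ[A] Q₀),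
      a₀ ∘ₗ d.compLeft (Fin n) = e ∘ₗ a₁ ∧
      ∀ (f₁ : P₁ →ₗ[A] Q₁) (f₀ : P₀ →ₗ[A] Q₀), f₀ ∘ₗ d = e ∘ₗ f₁ →
        ∃ (c₁ : P₁ →ₗ[A] (Fin n → P₁)) (c₀ : P₀ →ₗ[A] (Fin n → P₀)),
          c₀ ∘ₗ d = d.compLeft (Fin n) ∘ₗ c₁ ∧ a₁ ∘ₗ c₁ = f₁ ∧ a₀ ∘ₗ c₀ = f₀ := by
  let _ : Module R P₁ := Module.compHom P₁ (algebraMap R A)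
  let _ : Module R P₀ := Module.compHom P₀ (algebraMap R A)
  let _ : Module R Q₁ := Module.compHom Q₁ (algebraMap R A)
  let _ : Module R Q₀ := Module.compHom Q₀ (algebraMap R A)
  have : IsScalarTower R A P₁ := IsScalarTower.of_algebraMap_smul fun _ _ => rfl
  have : IsScalarTower R A P₀ := IsScalarTower.of_algebraMap_smul fun _ _ => rfl
  have : IsScalarTower R A Q₁ := IsScalarTower.of_algebraMap_smul fun _ _ => rfl
  have : IsScalarTower R A Q₀ := IsScalarTower.of_algebraMap_smul fun _ _ => rfl
  have := isNoetherian_linearMap R (A := A) P₁ Q₁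
  have := isNoetherian_linearMap R (A := A) P₀ Q₀
  -- Chain maps form an `R`-submodule of a Noetherian module; finitely many generators assemble into
  -- the universal map.
  let S : Submodule R ((P₁ →ₗ[A] Q₁) × (P₀ →ₗ[A] Q₀)) :=
    { carrier := {f | f.2 ∘ₗ d = e ∘ₗ f.1}
      add_mem' := fun {f g} hf hg => by
        change (f.2 + g.2) ∘ₗ d = e ∘ₗ (f.1 + g.1)
        rw [LinearMap.add_comp, LinearMap.comp_add, hf, hg]
      zero_mem' := by
        change (0 : P₀ →ₗ[A] Q₀) ∘ₗ d = e ∘ₗ (0 : P₁ →ₗ[A] Q₁)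
        simp
      smul_mem' := fun r f hf => by
        ext x
        have := LinearMap.congr_fun (show f.2 ∘ₗ d = e ∘ₗ f.1 from hf) x
        change r • f.2 (d x) = e (r • f.1 x)
        rw [← algebraMap_smul A r (f.1 x), map_smul, ← algebraMap_smul A r]
        exact congrArg _ this }
  obtain ⟨n, g, hg⟩ := Submodule.fg_iff_exists_fin_generating_family.1 (IsNoetherian.noetherian S)
  have hgS : ∀ k, (g k).2 ∘ₗ d = e ∘ₗ (g k).1 := fun k =>
    (hg ▸ Submodule.subset_span ⟨k, rfl⟩ : g k ∈ S)
  refine ⟨n, LinearMap.lsum A (fun _ => P₁) ℕ fun k => (g k).1,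
    LinearMap.lsum A (fun _ => P₀) ℕ fun k => (g k).2, ?_, fun f₁ f₀ hf => ?_⟩
  · ext x
    simp only [LinearMap.lsum_apply, LinearMap.comp_apply, LinearMap.sum_apply, map_sum]
    exact Finset.sum_congr rfl fun k _ => LinearMap.congr_fun (hgS k) _
  · have hfS : (f₁, f₀) ∈ Submodule.span R (Set.range g) := hg ▸ hf
    obtain ⟨c, hc⟩ := (Submodule.mem_span_range_iff_exists_fun R).1 hfS
    -- The coefficients `c k` lie in `R`, which acts centrally, so scaling by them gives a chain map
    -- from `P` to its power.
    refine ⟨LinearMap.pi fun k => c k • LinearMap.id, LinearMap.pi fun k => c k • LinearMap.id,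
      ?_, ?_, ?_⟩
    · ext x k
      change c k • d x = d (c k • x)
      rw [← algebraMap_smul A (c k) x, map_smul, algebraMap_smul]
    · ext x
      have h := LinearMap.congr_fun (congrArg Prod.fst hc) x
      simp only [Prod.fst_sum, LinearMap.sum_apply, Prod.smul_fst, LinearMap.smul_apply] at h
      simp only [LinearMap.lsum_apply, LinearMap.comp_apply, LinearMap.sum_apply]
      refine Eq.trans (Finset.sum_congr rfl fun k _ => ?_) h
      change (g k).1 (c k • x) = _
      rw [← algebraMap_smul A (c k) x, map_smul, algebraMap_smul]
    · ext x
      have h := LinearMap.congr_fun (congrArg Prod.snd hc) x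
      simp only [Prod.snd_sum, LinearMap.sum_apply, Prod.smul_snd, LinearMap.smul_apply] at h
      simp only [LinearMap.lsum_apply, LinearMap.comp_apply, LinearMap.sum_apply]
      refine Eq.trans (Finset.sum_congr rfl fun k _ => ?_) h
      change (g k).2 (c k • x) = _
      rw [← algebraMap_smul A (c k) x, map_smul, algebraMap_smul]

/-- The complex `K` is a two-term complex of finitely generated projective modules isomorphic to
`P`. -/
structure Presents (K : CochainComplex (ModuleCat.{u} A) ℤ) (P : KMod A) : Prop where
  fgProj : ∀ n, Module.Finite A (K.X n) ∧ Module.Projective A (K.X n)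
  isZero : ∀ n, n ≠ -1 → n ≠ 0 → IsZero (K.X n)
  iso : Nonempty (P ≅ (HomotopyCategory.quotient _ _).obj K)

lemma IsTwoTermSilting.exists_presents {P : KMod A} (hP : IsTwoTermSilting P) :
    ∃ K, Presents K P := by
  obtain ⟨K, h1, h2, h3⟩ := hP.twoTerm
  exact ⟨K, h1, h2, h3⟩

/-- The zeroth cohomology of a complex. -/
noncomputable abbrev H0 (P : KMod A) : ModuleCat.{u} A :=
  (HomotopyCategory.homologyFunctor (ModuleCat.{u} A) (ComplexShape.up ℤ) 0).obj P

variable {K L : CochainComplex (ModuleCat.{u} A) ℤ} {P Q : KMod A}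

lemma Presents.exists_H0_equiv (h : Presents K P) :
    Nonempty (H0 P ≃ₗ[A] (K.X 0 ⧸ LinearMap.range (diff K))) := by
  obtain ⟨e⟩ := h.iso
  obtain ⟨e'⟩ := exists_homology_iso h.isZero
  exact ⟨((HomotopyCategory.homologyFunctor _ _ 0).mapIso e ≪≫ e').toLinearEquiv⟩

lemma Presents.finite_H0 (h : Presents K P) : Module.Finite A (H0 P) := by
  obtain ⟨e⟩ := h.exists_H0_equiv
  have := (h.fgProj 0).1
  exact Module.Finite.equiv e.symm

lemma Presents.homVanish_iff (hK : Presents K P) (hL : Presents L Q) :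
    HomVanish P Q ↔ NullHomotopic (diff K) (diff L) := by
  obtain ⟨e⟩ := hK.iso
  obtain ⟨e'⟩ := hL.iso
  rw [← homVanish_iff_nullHomotopic hK.isZero hL.isZero]
  exact ⟨fun h => h.of_addOf (addOf_of_iso' (addOf_refl _) e.symm)
    (addOf_of_iso' (addOf_refl _) e'.symm), fun h => h.of_addOf (addOf_of_iso' (addOf_refl _) e)
    (addOf_of_iso' (addOf_refl _) e')⟩

lemma Presents.homVanish_iff_extendsAlong (hK : Presents K P) (hL : Presents L Q) :
    HomVanish P Q ↔ ExtendsAlong (diff K) (H0 Q) := by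
  have := (hK.fgProj 0).2
  have := (hK.fgProj (-1)).2
  obtain ⟨e⟩ := hL.exists_H0_equiv
  rw [hK.homVanish_iff hL, nullHomotopic_iff]
  exact ⟨fun h => h.of_surjective e.symm.toLinearMap e.symm.surjective,
    fun h => h.of_surjective e.toLinearMap e.surjective⟩

/-- Presilting gives the vanishing on `H⁰(P)`, and it passes to factor modules of powers.
Conversely, generation by `P` detects zero modules, which makes the trace of `H⁰(P)` in `X`
everything. -/
lemma Presents.fac_H0_iff (hK : Presents K P) (hP : IsTwoTermSilting P) {X : ModuleCat.{u} A}
    [IsNoetherian A X] : fac (H0 P) X ↔ ExtendsAlong (diff K) X := by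
  have := (hK.fgProj 0).2
  have := (hK.fgProj (-1)).2
  obtain ⟨e⟩ := hK.exists_H0_equiv
  have hd := (hK.homVanish_iff hK).1 hP.presilting
  rw [fac_iff]
  constructor
  · intro h
    exact ((hK.homVanish_iff_extendsAlong hK).1 hP.presilting).of_isQuotientOfPower h
  · intro h
    have hgen : Kbproj A ≤ (ObjectProperty.singleton
        ((HomotopyCategory.quotient _ _).obj K)).triangEnvelope := by
      refine hP.generates.trans ?_
      rw [ObjectProperty.triangEnvelope_le_iff]
      rintro _ ⟨⟩
      obtain ⟨e⟩ := hK.iso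
      exact ObjectProperty.prop_of_retract _ e.retract
        (ObjectProperty.le_triangEnvelope _ _ ⟨PUnit.unit⟩)
    exact (h.isQuotientOfPower (fun Y _ _ => subsingleton_of_generates hK.isZero hgen Y)
      hd).of_surjective_left e.toLinearMap e.surjective

/-- Turns the order of `2-silt` into membership in a `Fac` class, which can be localised and reduced
modulo primes. -/
lemma homVanish_iff_fac [IsNoetherianRing A] (hP : IsTwoTermSilting P) (hQ : IsTwoTermSilting Q) :
    HomVanish P Q ↔ fac (H0 P) (H0 Q) := by
  obtain ⟨K, hK⟩ := hP.exists_presents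
  obtain ⟨L, hL⟩ := hQ.exists_presents
  have := hL.finite_H0
  rw [hK.fac_H0_iff hP, hK.homVanish_iff_extendsAlong hL]

lemma fac_mono {M N : ModuleCat.{u} A} (h : fac M N) : fac N ≤ fac M := fun X hX => by
  rw [fac_iff] at *
  exact h.trans hX

lemma fac_congr {M N : ModuleCat.{u} A} (e : M ≅ N) : fac M = fac N :=
  le_antisymm
    (fac_mono (fac_iff.2 ⟨1, e.inv.hom ∘ₗ LinearMap.proj 0, fun x => ⟨fun _ => e.hom.hom x, by simp⟩⟩))
    (fac_mono (fac_iff.2 ⟨1, e.hom.hom ∘ₗ LinearMap.proj 0, fun x => ⟨fun _ => e.inv.hom x, by simp⟩⟩))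

lemma fac_of_addOf {M N : ModuleCat.{u} A} (h : addOf M N) : fac M N :=
  ⟨N, 𝟙 N, h, inferInstance⟩

/-- Two-term silting complexes `P ≥ Q ≥ P` are additively equivalent. -/
lemma addOf_of_homVanish (R : Type u) [CommRing R] [IsNoetherianRing R] [Algebra R A]
    [Module.Finite R A] (hP : IsTwoTermSilting P) (hQ : IsTwoTermSilting Q) (h : HomVanish P Q)
    (h' : HomVanish Q P) : addOf P Q := by
  have : IsNoetherianRing A := IsNoetherianRing.of_finite R A
  obtain ⟨K, hK⟩ := hP.exists_presents
  obtain ⟨L, hL⟩ := hQ.exists_presents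
  have := (hK.fgProj 0).2
  have := (hK.fgProj (-1)).2
  have := (hK.fgProj 0).1
  have := (hK.fgProj (-1)).1
  have := (hL.fgProj 0).2
  have := (hL.fgProj (-1)).2
  have := (hL.fgProj 0).1
  have := (hL.fgProj (-1)).1
  have hfac : fac (H0 P) (H0 Q) := (homVanish_iff_fac hP hQ).1 h
  have hfac' : fac (H0 Q) (H0 P) := (homVanish_iff_fac hQ hP).1 h'
  -- All chain maps `P → Q` factor through `a : Pⁿ → Q`. A section of `a` up to homotopy exhibits
  -- `Q` as a summand of `Pⁿ`.
  obtain ⟨n, a₁, a₀, ha, hgen⟩ := exists_universal_chain_map R (diff K) (diff L)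
  have hnull : NullHomotopic (diff K) ((diff K).compLeft (Fin n)) := by
    intro g
    choose x y hxy using fun k => (hK.homVanish_iff hK).1 hP.presilting (LinearMap.proj k ∘ₗ g)
    refine ⟨LinearMap.pi x, LinearMap.pi y, LinearMap.ext fun z => funext fun k => ?_⟩
    exact LinearMap.congr_fun (hxy k) z
  -- Some power of `H⁰(P)` covers `H⁰(Q)`. Each component of the covering map lifts to a chain map
  -- and so factors through `a`; hence `a` is onto on `H⁰`.
  have hsurj : ∀ y, ∃ x z, a₀ x + diff L z = y := by
    obtain ⟨eP⟩ := hK.exists_H0_equiv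
    obtain ⟨eQ⟩ := hL.exists_H0_equiv
    obtain ⟨m, f, hf⟩ := ((fac_iff.1 hfac).of_surjective eQ.toLinearMap
      eQ.surjective).of_surjective_left eP.symm.toLinearMap eP.symm.surjective
    have hcomp : ∀ k, ∃ c₀ : K.X 0 →ₗ[A] (Fin n → K.X 0), ∀ x,
        f (Pi.single k ((LinearMap.range (diff K)).mkQ x)) =
          (LinearMap.range (diff L)).mkQ (a₀ (c₀ x)) := by
      intro k
      obtain ⟨f₀, hf₀⟩ := Module.projective_lifting_property (LinearMap.range (diff L)).mkQ
        (f ∘ₗ LinearMap.single A _ k ∘ₗ (LinearMap.range (diff K)).mkQ) (Submodule.mkQ_surjective _)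
      have hr : ∀ x, f₀ (diff K x) ∈ LinearMap.range (diff L) := fun x => by
        rw [← Submodule.ker_mkQ (LinearMap.range (diff L)), LinearMap.mem_ker]
        refine (LinearMap.congr_fun hf₀ (diff K x)).trans ?_
        have : (LinearMap.range (diff K)).mkQ (diff K x) = 0 := by simp
        rw [LinearMap.comp_apply, LinearMap.comp_apply, this, map_zero, map_zero]
      obtain ⟨f₁, hf₁⟩ := Module.projective_lifting_property (diff L).rangeRestrict
        (LinearMap.codRestrict (LinearMap.range (diff L)) (f₀ ∘ₗ diff K) hr)
        (diff L).surjective_rangeRestrict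
      obtain ⟨c₁, c₀, -, -, hc⟩ := hgen f₁ f₀ (LinearMap.ext fun x =>
        (congrArg Subtype.val (LinearMap.congr_fun hf₁ x)).symm)
      refine ⟨c₀, fun x => ?_⟩
      rw [← LinearMap.comp_apply a₀, hc]
      exact (LinearMap.congr_fun hf₀ x).symm
    choose c₀ hc₀ using hcomp
    intro y
    obtain ⟨x, hx⟩ := hf ((LinearMap.range (diff L)).mkQ y)
    choose x' hx' using fun k => (LinearMap.range (diff K)).mkQ_surjective (x k)
    have hy : (LinearMap.range (diff L)).mkQ (y - a₀ (∑ k, c₀ k (x' k))) = 0 := by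
      rw [map_sub, map_sum, map_sum, ← hx, sub_eq_zero]
      conv_lhs => rw [← Finset.univ_sum_single x, map_sum]
      refine Finset.sum_congr rfl fun k _ => ?_
      rw [← hc₀, hx']
    rw [← LinearMap.mem_ker, Submodule.ker_mkQ] at hy
    obtain ⟨z, hz⟩ := hy
    exact ⟨_, z, by rw [hz, add_sub_cancel]⟩
  -- The condition on test modules is `Fac H⁰(P) ⊆ Fac H⁰(Q)`, which comes from `P ≤ Q`.
  obtain ⟨b₁, b₀, c, hb, h1, h0⟩ := exists_section_of_cover ((diff K).compLeft (Fin n)) a₁ a₀ ha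
    hnull hsurj hgen fun N _ _ _ hN => by
      have hN' := (hK.fac_H0_iff hP (X := ModuleCat.of A N)).2 hN
      exact (hL.fac_H0_iff hQ).1 (fac_mono hfac' _ hN')
  have hα : ∀ k, ∃ f : K ⟶ L, f.f (-1) = ModuleCat.ofHom (a₁ ∘ₗ LinearMap.single A _ k) ∧
      f.f 0 = ModuleCat.ofHom (a₀ ∘ₗ LinearMap.single A _ k) := fun k => by
    refine exists_hom_of_isZero hK.isZero _ _ (ModuleCat.hom_ext (LinearMap.ext fun x => ?_))
      ((hL.isZero 1 (by lia) (by lia)).eq_of_tgt _ _)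
    refine ((LinearMap.congr_fun ha (Pi.single k x)).symm).trans (congrArg a₀ ?_)
    ext i
    change diff K ((Pi.single k x : Fin n → K.X (-1)) i) = (Pi.single k (diff K x) : Fin n → K.X 0) i
    exact Pi.apply_single (fun _ => diff K) (fun _ => map_zero _) k x i
  have hβ : ∀ k, ∃ f : L ⟶ K, f.f (-1) = ModuleCat.ofHom (LinearMap.proj k ∘ₗ b₁) ∧
      f.f 0 = ModuleCat.ofHom (LinearMap.proj k ∘ₗ b₀) := fun k => by
    refine exists_hom_of_isZero hL.isZero _ _ (ModuleCat.hom_ext (LinearMap.ext fun x => ?_))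
      ((hK.isZero 1 (by lia) (by lia)).eq_of_tgt _ _)
    exact congrFun (LinearMap.congr_fun hb x).symm k
  choose α hα1 hα0 using hα
  choose β hβ1 hβ0 using hβ
  obtain ⟨e⟩ := hK.iso
  obtain ⟨e'⟩ := hL.iso
  refine addOf_of_iso (addOf_of_iso' ⟨n, fun k => (HomotopyCategory.quotient _ _).map (β k),
    fun k => (HomotopyCategory.quotient _ _).map (α k), ?_⟩ e') e
  simp only [← Functor.map_comp]
  rw [← Functor.map_sum, ← CategoryTheory.Functor.map_id, ← sub_eq_zero, ← Functor.map_sub,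
    quotient_map_eq_zero_iff_of_isZero hL.isZero]
  -- Up to sign, `c` is the homotopy between the identity of `Q` and `b` followed by `a`.
  refine ⟨-ModuleCat.ofHom c, 0, ?_, ?_⟩
  · refine ModuleCat.hom_ext (LinearMap.ext fun x => ?_)
    have hx := LinearMap.congr_fun h1 x
    have hs : a₁ (b₁ x) = ∑ k, a₁ (Pi.single k (b₁ x k)) := by
      rw [← map_sum, Finset.univ_sum_single]
    simp only [LinearMap.add_apply, LinearMap.comp_apply, LinearMap.id_apply] at hx
    rw [hs] at hx
    have hsum : (∑ k, β k ≫ α k).f (-1) = ∑ k, (β k).f (-1) ≫ (α k).f (-1) :=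
      (HomologicalComplex.eval (ModuleCat.{u} A) (ComplexShape.up ℤ) (-1)).map_sum _ _
    simp only [HomologicalComplex.sub_f_apply, hsum, hα1, hβ1, ModuleCat.hom_sub, ModuleCat.hom_sum,
      LinearMap.sub_apply, LinearMap.sum_apply, HomologicalComplex.id_f]
    refine sub_eq_iff_eq_add.2 (eq_sub_of_add_eq hx |>.trans ?_)
    simp [sub_eq_neg_add]
  · refine ModuleCat.hom_ext (LinearMap.ext fun x => ?_)
    have hx := LinearMap.congr_fun h0 x
    have hs : a₀ (b₀ x) = ∑ k, a₀ (Pi.single k (b₀ x k)) := by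
      rw [← map_sum, Finset.univ_sum_single]
    simp only [LinearMap.add_apply, LinearMap.comp_apply, LinearMap.id_apply] at hx
    rw [hs] at hx
    have hsum : (∑ k, β k ≫ α k).f 0 = ∑ k, (β k).f 0 ≫ (α k).f 0 :=
      (HomologicalComplex.eval (ModuleCat.{u} A) (ComplexShape.up ℤ) 0).map_sum _ _
    simp only [HomologicalComplex.sub_f_apply, hsum, hα0, hβ0, ModuleCat.hom_sub, ModuleCat.hom_sum,
      LinearMap.sub_apply, LinearMap.sum_apply, HomologicalComplex.id_f]
    refine sub_eq_iff_eq_add.2 (eq_sub_of_add_eq hx |>.trans ?_)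
    simp [sub_eq_neg_add]

end SiltingComplexes

/-! ### The order of `2-silt` through `Fac` classes -/

section FacOrder

variable {A : Type u} [Ring A]

/-- The factor modules of powers of `H⁰(P)`, for `P` a two-term silting complex up to additive
equivalence. -/
noncomputable def TwoSilt.fac : TwoSilt A → ObjectProperty (ModuleCat.{u} A) :=
  Quotient.lift (fun P => SiltingTorsion.fac (H0 P.1)) (by
    intro P Q (h : addOf P.1 = addOf Q.1)
    exact le_antisymm
      (fac_mono (fac_of_addOf (addOf_map (HomotopyCategory.homologyFunctor _ _ 0)
        (h ▸ addOf_refl _))))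
      (fac_mono (fac_of_addOf (addOf_map (HomotopyCategory.homologyFunctor _ _ 0)
        (h ▸ addOf_refl _)))))

lemma TwoSilt.le_iff_fac_le [IsNoetherianRing A] (x y : TwoSilt A) : x ≤ y ↔ x.fac ≤ y.fac := by
  induction x, y using Quotient.inductionOn₂ with
  | h P Q =>
    refine (homVanish_iff_fac Q.2 P.2).trans ⟨fac_mono, fun h => h _ ?_⟩
    exact fac_of_addOf (addOf_refl _)

/-- `TwoSilt` carries only a relation `≤`; antisymmetry rests on the additive equivalence of
mutually comparable complexes. -/
lemma TwoSilt.eq_of_fac_eq (R : Type u) [CommRing R] [IsNoetherianRing R] [Algebra R A]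
    [Module.Finite R A] {x y : TwoSilt A} (h : x.fac = y.fac) : x = y := by
  have : IsNoetherianRing A := IsNoetherianRing.of_finite R A
  have h1 := (TwoSilt.le_iff_fac_le x y).2 h.le
  have h2 := (TwoSilt.le_iff_fac_le y x).2 h.ge
  induction x, y using Quotient.inductionOn₂ with
  | h P Q =>
    have h1 : HomVanish Q.1 P.1 := h1
    have h2 : HomVanish P.1 Q.1 := h2
    refine Quotient.sound (funext fun X => propext ⟨fun hX => ?_, fun hX => ?_⟩)
    · exact addOf_trans (addOf_of_homVanish R Q.2 P.2 h1 h2) hX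
    · exact addOf_trans (addOf_of_homVanish R P.2 Q.2 h2 h1) hX

/-- A single presentation tests all Noetherian modules. In this form closure under extensions is
visible and Nakayama's lemma applies. -/
lemma TwoSilt.exists_fac_iff (x : TwoSilt A) : ∃ K : CochainComplex (ModuleCat.{u} A) ℤ,
    (∀ n, Module.Finite A (K.X n) ∧ Module.Projective A (K.X n)) ∧
      ∀ X : ModuleCat.{u} A, IsNoetherian A X → (x.fac X ↔ ExtendsAlong (diff K) X) := by
  induction x using Quotient.inductionOn with
  | h P =>
    obtain ⟨K, hK⟩ := P.2.exists_presents
    exact ⟨K, hK.fgProj, fun X _ => hK.fac_H0_iff P.2⟩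

lemma TwoSilt.fac_of_epi (x : TwoSilt A) {X Y : ModuleCat.{u} A} (f : X ⟶ Y) (hf : Epi f)
    (h : x.fac X) : x.fac Y := by
  induction x using Quotient.inductionOn with
  | h P =>
    rw [ModuleCat.epi_iff_surjective] at hf
    have h : SiltingTorsion.fac (H0 P.1) X := h
    exact fac_iff.2 ((fac_iff.1 h).of_surjective f.hom hf)

lemma TwoSilt.finite_of_fac (x : TwoSilt A) {X : ModuleCat.{u} A} (h : x.fac X) :
    Module.Finite A X := by
  induction x using Quotient.inductionOn with
  | h P =>
    obtain ⟨K, hK⟩ := P.2.exists_presents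
    have := hK.finite_H0
    have h : SiltingTorsion.fac (H0 P.1) X := h
    exact (fac_iff.1 h).finite

end FacOrder

/-! ### Nakayama arguments over a local base -/

section Nakayama

variable {A : Type u} [Ring A] {S : Type u} [CommRing S] [IsLocalRing S] [IsNoetherianRing S]
  [Algebra S A] [Module.Finite S A]

/-- `Hom(P, X[1]) = 0` can be checked modulo the maximal ideal. -/
lemma ExtendsAlong.of_quotient_maximalIdeal {P₁ P₀ X : Type u} [AddCommGroup P₁] [Module A P₁]
    [AddCommGroup P₀] [Module A P₀] [AddCommGroup X] [Module A X] [Module S X]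
    [IsScalarTower S A X] [Module.Finite A P₁] [Module.Projective A P₁] [Module.Projective A P₀]
    [Module.Finite A X] (d : P₁ →ₗ[A] P₀) (N : Submodule A X)
    (hN : ∀ x ∈ N, x ∈ IsLocalRing.maximalIdeal S • (⊤ : Submodule S X))
    (h : ExtendsAlong d (X ⧸ N)) : ExtendsAlong d X := by
  have hnoeth := isNoetherian_linearMap S (A := A) P₁ X
  -- The maps that extend along `d`; Nakayama's lemma will show that they are all maps.
  let D : Submodule S (P₁ →ₗ[A] X) :=
    { carrier := {g | ∃ h : P₀ →ₗ[A] X, h ∘ₗ d = g}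
      add_mem' := by
        rintro _ _ ⟨a, rfl⟩ ⟨b, rfl⟩
        exact ⟨a + b, LinearMap.add_comp _ _ _⟩
      zero_mem' := ⟨0, LinearMap.zero_comp _⟩
      smul_mem' := by
        rintro c _ ⟨a, rfl⟩
        exact ⟨c • a, LinearMap.smul_comp _ _ _⟩ }
  -- `P₁` is a summand of a finite free module, so a map with values in `N ⊆ 𝔪X` is a finite
  -- combination of coordinate maps with coefficients in `𝔪X`, and lies in `𝔪 Hom(P₁, X)`.
  have hmem : ∀ g : P₁ →ₗ[A] X, (∀ x, g x ∈ N) →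
      g ∈ IsLocalRing.maximalIdeal S • (⊤ : Submodule S (P₁ →ₗ[A] X)) := by
    intro g hg
    obtain ⟨n, π, i, -, -, hπ⟩ := Module.Finite.exists_comp_eq_id_of_projective A P₁
    let ψ : Fin n → X →ₗ[S] (P₁ →ₗ[A] X) := fun k =>
      { toFun := fun x => LinearMap.toSpanSingleton A X x ∘ₗ LinearMap.proj k ∘ₗ i
        map_add' := fun x y => by ext; simp
        map_smul' := fun c x => by
          ext y
          exact smul_comm _ c x }
    have hsum : g = ∑ k, ψ k (g (π (Pi.single k 1))) := by
      ext x
      have h1 := LinearMap.congr_fun hπ x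
      simp only [LinearMap.comp_apply, LinearMap.id_apply] at h1
      conv_lhs => rw [← h1, pi_eq_sum_univ' (i x), map_sum, map_sum]
      rw [LinearMap.sum_apply]
      refine Finset.sum_congr rfl fun k _ => ?_
      simp only [ψ, LinearMap.coe_mk, AddHom.coe_mk, LinearMap.comp_apply,
        LinearMap.toSpanSingleton_apply, LinearMap.proj_apply, map_smul]
    rw [hsum]
    refine sum_mem fun k _ => ?_
    have h2 : ψ k (g (π (Pi.single k 1))) ∈
        (IsLocalRing.maximalIdeal S • (⊤ : Submodule S X)).map (ψ k) := ⟨_, hN _ (hg _), rfl⟩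
    rw [Submodule.map_smul''] at h2
    exact Submodule.smul_mono le_rfl le_top h2
  have hle : (⊤ : Submodule S (P₁ →ₗ[A] X)) ≤
      D ⊔ IsLocalRing.maximalIdeal S • (⊤ : Submodule S (P₁ →ₗ[A] X)) := by
    intro g _
    obtain ⟨b, hb⟩ := h (N.mkQ ∘ₗ g)
    obtain ⟨b, rfl⟩ := Module.projective_lifting_property N.mkQ b N.mkQ_surjective
    rw [← add_sub_cancel (b ∘ₗ d) g]
    refine Submodule.add_mem_sup ⟨b, rfl⟩ (hmem _ fun x => ?_)
    rw [← Submodule.ker_mkQ N, LinearMap.mem_ker, LinearMap.sub_apply, map_sub, sub_eq_zero]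
    exact (LinearMap.congr_fun hb x).symm
  have htop := Submodule.le_of_le_smul_of_le_jacobson_bot (IsNoetherian.noetherian _)
    (IsLocalRing.maximalIdeal_le_jacobson ⊥) hle
  exact fun g => htop (Submodule.mem_top (x := g))

/-- A finitely generated module killed by the maximal ideal has finite length. -/
lemma isFiniteLength_of_maximalIdeal_smul {X : Type u} [AddCommGroup X] [Module A X] [Module S X]
    [IsScalarTower S A X] [Module.Finite A X]
    (h : ∀ a ∈ IsLocalRing.maximalIdeal S, ∀ x : X, a • x = 0) : IsFiniteLength A X := by
  have : Module.Finite S X := Module.Finite.trans A X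
  have htors : Module.IsTorsionBySet S X (IsLocalRing.maximalIdeal S : Set S) :=
    fun x a => h a.1 a.2 x
  let _ : Module (S ⧸ IsLocalRing.maximalIdeal S) X := htors.module
  have : IsScalarTower S (S ⧸ IsLocalRing.maximalIdeal S) X := htors.isScalarTower
  have : Module.Finite (S ⧸ IsLocalRing.maximalIdeal S) X := Module.Finite.of_restrictScalars_finite S _ _
  let _ : Field (S ⧸ IsLocalRing.maximalIdeal S) := Ideal.Quotient.field _
  -- The module is finite-dimensional over the residue field, hence Artinian; this passes to `S` and
  -- then to `A`.
  have hart : IsArtinian (S ⧸ IsLocalRing.maximalIdeal S) X := inferInstance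
  have hartS : IsArtinian S X :=
    (LinearMap.isArtinian_iff_of_bijective (σ := Ideal.Quotient.mk (IsLocalRing.maximalIdeal S))
      { toFun := (id : X → X)
        map_add' := fun _ _ => rfl
        map_smul' := fun _ _ => rfl } Function.bijective_id).2 hart
  have : IsNoetherian S X := isNoetherian_of_isNoetherianRing_of_finite S X
  have hn : IsNoetherian A X := isNoetherian_of_tower S inferInstance
  have ha : IsArtinian A X := isArtinian_of_tower S inferInstance
  exact isFiniteLength_iff_isNoetherian_isArtinian.2 ⟨hn, ha⟩

/-- The maximal ideal acts nilpotently on modules of finite length. -/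
lemma exists_pow_smul_eq_zero {X : Type u} [AddCommGroup X] [Module A X] [Module S X]
    [IsScalarTower S A X] (h : IsFiniteLength A X) {a : S} (ha : a ∈ IsLocalRing.maximalIdeal S) :
    ∃ n : ℕ, ∀ x : X, a ^ n • x = 0 := by
  obtain ⟨hn, hart⟩ := isFiniteLength_iff_isNoetherian_isArtinian.1 h
  have : Module.Finite S X := Module.Finite.trans A X
  have : IsNoetherian S X := isNoetherian_of_isNoetherianRing_of_finite S X
  -- The chain `aⁿX` stabilises by the Artinian property, and Nakayama's lemma kills its stable
  -- value.
  let F : ℕ →o (Submodule A X)ᵒᵈ :=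
    { toFun := fun n => OrderDual.toDual (LinearMap.range ((a ^ n) • (LinearMap.id : X →ₗ[A] X)))
      monotone' := by
        intro i j hij
        change LinearMap.range _ ≤ LinearMap.range _
        rintro _ ⟨x, rfl⟩
        refine ⟨a ^ (j - i) • x, ?_⟩
        simp only [LinearMap.smul_apply, LinearMap.id_apply, smul_smul, ← pow_add]
        rw [Nat.add_sub_cancel' hij] }
  obtain ⟨n, hF⟩ := IsArtinian.monotone_stabilizes F
  refine ⟨n, fun x => ?_⟩
  let V : Submodule S X := LinearMap.range ((a ^ n) • (LinearMap.id : X →ₗ[S] X))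
  have hV : V ≤ IsLocalRing.maximalIdeal S • V := by
    rintro _ ⟨y, rfl⟩
    have h1 : (a ^ n) • y ∈ LinearMap.range ((a ^ n) • (LinearMap.id : X →ₗ[A] X)) := ⟨y, rfl⟩
    have h2 : LinearMap.range ((a ^ n) • (LinearMap.id : X →ₗ[A] X)) =
      LinearMap.range ((a ^ (n + 1)) • (LinearMap.id : X →ₗ[A] X)) := hF (n + 1) (by lia)
    rw [h2] at h1
    obtain ⟨z, hz⟩ := h1
    change (a ^ n) • y ∈ _
    rw [← hz]
    change a ^ (n + 1) • z ∈ _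
    rw [pow_succ', mul_smul]
    exact Submodule.smul_mem_smul ha ⟨z, rfl⟩
  have hV0 := Submodule.eq_bot_of_le_smul_of_le_jacobson_bot _ V (IsNoetherian.noetherian _) hV
    (IsLocalRing.maximalIdeal_le_jacobson ⊥)
  have : a ^ n • x ∈ V := ⟨x, rfl⟩
  rwa [hV0] at this

end Nakayama

/-! ### Localisation seen inside restricted modules -/

section LocalizedModules

variable {R Λ : Type u} [CommRing R] [Ring Λ] [Algebra R Λ] (p : PrimeSpectrum R)

/-- A module over `Λ_p`, seen as a `Λ`-module. -/
noncomputable abbrev res (Z : ModuleCat.{u} (LocAlg Λ p)) : ModuleCat.{u} Λ := (locRestrict p).obj Z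

variable {p} {Z : ModuleCat.{u} (LocAlg Λ p)} {Y : ModuleCat.{u} Λ}

variable (Z) in
/-- The identity of a `Λ_p`-module, with values in its restriction to `Λ`. -/
noncomputable def toRes : Z ≃+ res p Z := AddEquiv.refl Z

/-- The restriction to `Λ` of a linear map. -/
noncomputable def resMap {Z' : ModuleCat.{u} (LocAlg Λ p)} (g : Z →ₗ[LocAlg Λ p] Z') :
    res p Z →ₗ[Λ] res p Z' := ((locRestrict p).map (ModuleCat.ofHom g)).hom

lemma resMap_toRes {Z' : ModuleCat.{u} (LocAlg Λ p)} (g : Z →ₗ[LocAlg Λ p] Z') (z : Z) :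
    resMap g (toRes Z z) = toRes Z' (g z) := rfl

lemma resMap_injective {Z' : ModuleCat.{u} (LocAlg Λ p)} {g : Z →ₗ[LocAlg Λ p] Z'} :
    Function.Injective (resMap g) ↔ Function.Injective g := Iff.rfl

lemma resMap_surjective {Z' : ModuleCat.{u} (LocAlg Λ p)} {g : Z →ₗ[LocAlg Λ p] Z'} :
    Function.Surjective (resMap g) ↔ Function.Surjective g := Iff.rfl

lemma smul_toRes (l : Λ) (z : Z) :
    l • toRes Z z = toRes Z (((1 : Localization.AtPrime p.asIdeal) ⊗ₜ[R] l : LocAlg Λ p) • z) := rfl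

lemma algebraMap_smul_toRes (r : R) (z : Z) :
    algebraMap R Λ r • toRes Z z =
      toRes Z ((algebraMap R (Localization.AtPrime p.asIdeal) r ⊗ₜ[R] (1 : Λ) : LocAlg Λ p) • z) := by
  rw [smul_toRes]
  congr 2
  rw [Algebra.algebraMap_eq_smul_one, Algebra.algebraMap_eq_smul_one, TensorProduct.smul_tmul]

/-- Elements of `R` outside of `p` act bijectively on `Λ_p`-modules. -/
lemma res_smul_bijective {s : R} (hs : s ∉ p.asIdeal) :
    Function.Bijective fun z : res p Z => algebraMap R Λ s • z := by
  let c := IsLocalization.mk' (Localization.AtPrime p.asIdeal) (1 : R)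
    (⟨s, hs⟩ : p.asIdeal.primeCompl)
  have hc : c * algebraMap R _ s = 1 := by
    rw [IsLocalization.mk'_spec, map_one]
  have h1 : (c ⊗ₜ[R] (1 : Λ) : LocAlg Λ p) *
      (algebraMap R (Localization.AtPrime p.asIdeal) s ⊗ₜ[R] (1 : Λ)) = 1 := by
    rw [Algebra.TensorProduct.tmul_mul_tmul, hc, mul_one]
    rfl
  have h2 : (algebraMap R (Localization.AtPrime p.asIdeal) s ⊗ₜ[R] (1 : Λ) : LocAlg Λ p) *
      (c ⊗ₜ[R] (1 : Λ)) = 1 := by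
    rw [Algebra.TensorProduct.tmul_mul_tmul, mul_comm, hc, mul_one]
    rfl
  constructor
  · intro z w h
    obtain ⟨z, rfl⟩ := (toRes Z).surjective z
    obtain ⟨w, rfl⟩ := (toRes Z).surjective w
    simp only [algebraMap_smul_toRes] at h
    have := congrArg (fun t : Z => (c ⊗ₜ[R] (1 : Λ) : LocAlg Λ p) • t) ((toRes Z).injective h)
    simp only [smul_smul, h1, one_smul] at this
    rw [this]
  · intro z
    obtain ⟨z, rfl⟩ := (toRes Z).surjective z
    refine ⟨toRes Z ((c ⊗ₜ[R] (1 : Λ) : LocAlg Λ p) • z), ?_⟩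
    simp only [algebraMap_smul_toRes, smul_smul, h2, one_smul]

lemma res_smul_eq_zero {s : R} (hs : s ∉ p.asIdeal) {z : res p Z}
    (h : algebraMap R Λ s • z = 0) : z = 0 :=
  (res_smul_bijective hs).1 (h.trans (smul_zero _).symm)

variable (p Y) in
/-- The canonical map `M → M_p`. -/
noncomputable def locUnit : Y →ₗ[Λ] res p ((locFunctor p).obj Y) where
  toFun m := toRes ((locFunctor p).obj Y) (LocMod.tmul p 1 m)
  map_add' x y := LocMod.tmul_add p 1 x y
  map_smul' l m := by
    refine Eq.trans ?_ (smul_toRes (Z := (locFunctor p).obj Y) l (LocMod.tmul p 1 m)).symm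
    refine congrArg (toRes ((locFunctor p).obj Y))
      (Eq.trans ?_ (LocMod.smul_tmul p 1 1 l m).symm)
    rw [mul_one]

lemma locUnit_naturality {Y' : ModuleCat.{u} Λ} (f : Y ⟶ Y') (y : Y) :
    resMap ((locFunctor p).map f).hom (locUnit p Y y) = locUnit p Y' (f.hom y) := rfl

lemma locUnit_exists (z : res p ((locFunctor p).obj Y)) :
    ∃ s ∉ p.asIdeal, ∃ y, algebraMap R Λ s • z = locUnit p Y y := by
  obtain ⟨z, rfl⟩ := (toRes _).surjective z
  obtain ⟨s, hs, m, h⟩ := LocMod.exists_scale p z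
  exact ⟨s, hs, m, (algebraMap_smul_toRes s _).trans (congrArg (toRes _) h)⟩

lemma locUnit_eq_zero {y : Y} (h : locUnit p Y y = 0) :
    ∃ s ∉ p.asIdeal, algebraMap R Λ s • y = 0 := by
  have h' : TensorProduct.mk R (Localization.AtPrime p.asIdeal) (RestrictScalars R Λ Y) 1
      ((RestrictScalars.addEquiv R Λ Y).symm y) = 0 := h
  obtain ⟨s, hs⟩ := (IsLocalizedModule.eq_zero_iff p.asIdeal.primeCompl _).1 h'
  exact ⟨s.1, s.2, hs⟩

variable (p) in
/-- A linear map that becomes an isomorphism after localisation at `p`. -/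
structure IsLocMap {Y Y' : Type u} [AddCommGroup Y] [Module Λ Y] [AddCommGroup Y'] [Module Λ Y']
    (f : Y →ₗ[Λ] Y') : Prop where
  torsion : ∀ y : Y, f y = 0 → ∃ s ∉ p.asIdeal, algebraMap R Λ s • y = 0
  exists_smul : ∀ z : Y', ∃ s ∉ p.asIdeal, ∃ y, algebraMap R Λ s • z = f y

lemma isLocMap_locUnit : IsLocMap p (locUnit p Y) :=
  ⟨fun _ => locUnit_eq_zero, locUnit_exists⟩

lemma IsLocMap.comp {Y₁ Y₂ Y₃ : Type u} [AddCommGroup Y₁] [Module Λ Y₁] [AddCommGroup Y₂]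
    [Module Λ Y₂] [AddCommGroup Y₃] [Module Λ Y₃] {g : Y₂ →ₗ[Λ] Y₃} {f : Y₁ →ₗ[Λ] Y₂}
    (hg : IsLocMap p g) (hf : IsLocMap p f) : IsLocMap p (g ∘ₗ f) := by
  constructor
  · intro y hy
    obtain ⟨s, hs, h⟩ := hg.torsion _ hy
    rw [← map_smul] at h
    obtain ⟨t, ht, h⟩ := hf.torsion _ h
    refine ⟨t * s, p.2.mul_notMem ht hs, ?_⟩
    rw [map_mul, mul_smul, h]
  · intro z
    obtain ⟨s, hs, y, h⟩ := hg.exists_smul z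
    obtain ⟨t, ht, x, h'⟩ := hf.exists_smul y
    refine ⟨t * s, p.2.mul_notMem ht hs, x, ?_⟩
    rw [map_mul, mul_smul, h, ← map_smul, h', LinearMap.comp_apply]

/-- The complement of `p` lies in the complement of `q`, so denominators for `p` also serve for `q`.
-/
lemma IsLocMap.of_le {q : PrimeSpectrum R} (hqp : q ≤ p) {Y Y' : Type u} [AddCommGroup Y]
    [Module Λ Y] [AddCommGroup Y'] [Module Λ Y'] {f : Y →ₗ[Λ] Y'} (hf : IsLocMap p f) :
    IsLocMap q f :=
  ⟨fun y hy => let ⟨s, hs, h⟩ := hf.torsion y hy; ⟨s, fun h' => hs (hqp h'), h⟩,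
    fun z => let ⟨s, hs, h⟩ := hf.exists_smul z; ⟨s, fun h' => hs (hqp h'), h⟩⟩

/-- The extension of a map `M → Z` to `M_p`, for `Z` a `Λ_p`-module. -/
lemma exists_locLift (f : Y →ₗ[Λ] res p Z) :
    ∃ g : (locFunctor p).obj Y →ₗ[LocAlg Λ p] Z, ∀ y, resMap g (locUnit p Y y) = f y := by
  let φ : Localization.AtPrime p.asIdeal →+ RestrictScalars R Λ Y →+ Z :=
    AddMonoidHom.mk' (fun a => AddMonoidHom.mk' (fun y => (a ⊗ₜ[R] (1 : Λ) : LocAlg Λ p) •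
      (toRes Z).symm (f (RestrictScalars.addEquiv R Λ Y y))) (fun x y => by
        rw [map_add, map_add, map_add, smul_add])) (fun a b => by
        ext y
        exact (congrArg (· • (toRes Z).symm (f (RestrictScalars.addEquiv R Λ Y y)))
          (TensorProduct.add_tmul (R := R) a b (1 : Λ))).trans
            (add_smul (a ⊗ₜ[R] (1 : Λ) : LocAlg Λ p) (b ⊗ₜ[R] (1 : Λ)) _))
  let g : LocMod p Y →+ Z := TensorProduct.liftAddHom φ (fun r a y => by
    change ((r • a) ⊗ₜ[R] (1 : Λ) : LocAlg Λ p) • (toRes Z).symm (f _) =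
      (a ⊗ₜ[R] (1 : Λ) : LocAlg Λ p) •
        ((toRes Z).symm (f (algebraMap R Λ r • RestrictScalars.addEquiv R Λ Y y)))
    obtain ⟨z, hz⟩ := (toRes Z).surjective (f (RestrictScalars.addEquiv R Λ Y y))
    rw [map_smul, ← hz, algebraMap_smul_toRes, AddEquiv.symm_apply_apply, AddEquiv.symm_apply_apply,
      smul_smul, Algebra.TensorProduct.tmul_mul_tmul, mul_one, Algebra.smul_def, mul_comm])
  have hg : ∀ a y, g (LocMod.tmul p a y) = (a ⊗ₜ[R] (1 : Λ) : LocAlg Λ p) • (toRes Z).symm (f y) :=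
    fun _ _ => rfl
  refine ⟨LocMod.mkLin p g fun a l b m => ?_, fun y => ?_⟩
  · obtain ⟨z, hz⟩ := (toRes Z).surjective (f m)
    rw [hg, hg, map_smul, ← hz, smul_toRes, AddEquiv.symm_apply_apply, AddEquiv.symm_apply_apply,
      smul_smul, smul_smul, Algebra.TensorProduct.tmul_mul_tmul,
      Algebra.TensorProduct.tmul_mul_tmul, mul_one, mul_one, one_mul]
  · exact (congrArg (toRes Z) (hg 1 y)).trans (congrArg (toRes Z) (one_smul _ _))

/-- The extension of `f` to `Y_p` is bijective: denominators act bijectively on `Z` and `Y_p`, and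
after clearing them the two conditions on `f` give injectivity and surjectivity. -/
lemma IsLocMap.exists_iso {f : Y →ₗ[Λ] res p Z} (hf : IsLocMap p f) :
    Nonempty (Z ≅ (locFunctor p).obj Y) := by
  obtain ⟨g, hg⟩ := exists_locLift f
  refine ⟨(LinearEquiv.ofBijective g ⟨resMap_injective.1 ?_, resMap_surjective.1 ?_⟩).toModuleIso.symm⟩
  · rw [injective_iff_map_eq_zero]
    intro x hx
    obtain ⟨s, hs, y, h⟩ := locUnit_exists x
    have h1 : f y = 0 := by
      rw [← hg y, ← h, map_smul, hx, smul_zero]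
    obtain ⟨t, ht, h2⟩ := hf.torsion y h1
    apply res_smul_eq_zero hs
    apply res_smul_eq_zero ht
    rw [h, ← map_smul, h2, map_zero]
  · intro z
    obtain ⟨s, hs, y, h⟩ := hf.exists_smul z
    obtain ⟨x, hx⟩ := (res_smul_bijective hs).2 (locUnit p Y y)
    refine ⟨x, (res_smul_bijective hs).1 ?_⟩
    simp only at hx ⊢
    rw [← map_smul, h, ← hg y, hx]

lemma exists_isLocMap_of_iso (e : Z ≅ (locFunctor p).obj Y) :
    ∃ f : Y →ₗ[Λ] res p Z, IsLocMap p f := by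
  let e' : res p Z ≃ₗ[Λ] res p ((locFunctor p).obj Y) := ((locRestrict p).mapIso e).toLinearEquiv
  refine ⟨e'.symm.toLinearMap ∘ₗ locUnit p Y, IsLocMap.comp ⟨fun y hy => ?_, fun z => ?_⟩
    isLocMap_locUnit⟩
  · exact ⟨1, p.2.one_notMem, by rw [e'.symm.map_eq_zero_iff.1 hy, smul_zero]⟩
  · exact ⟨1, p.2.one_notMem, e' z, by simp⟩

variable (p) in
/-- A submodule that contains a multiple of each element by an element outside of `p`. -/
def IsDense {Y : Type u} [AddCommGroup Y] [Module Λ Y] (N : Submodule Λ Y) : Prop :=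
  ∀ z : Y, ∃ s ∉ p.asIdeal, algebraMap R Λ s • z ∈ N

/-- `Z ∈ 𝒞_p` if and only if `Z` has a dense `Λ`-submodule in `𝒞`, when `𝒞` is closed under factor
modules. -/
lemma locProp_iff {T : ObjectProperty (ModuleCat.{u} Λ)}
    (hT : ∀ (X Y : ModuleCat.{u} Λ) (f : X ⟶ Y), Epi f → T X → T Y) :
    locProp p T Z ↔ ∃ N : Submodule Λ (res p Z), T (ModuleCat.of Λ N) ∧ IsDense p N := by
  constructor
  · rintro ⟨Y, hY, ⟨e⟩⟩
    obtain ⟨f, hf⟩ := exists_isLocMap_of_iso e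
    refine ⟨LinearMap.range f, hT _ _ (ModuleCat.ofHom f.rangeRestrict) ?_ hY, fun z => ?_⟩
    · rw [ModuleCat.epi_iff_surjective]
      exact f.surjective_rangeRestrict
    · obtain ⟨s, hs, y, h⟩ := hf.exists_smul z
      exact ⟨s, hs, h ▸ ⟨y, rfl⟩⟩
  · rintro ⟨N, hN, hd⟩
    refine ⟨ModuleCat.of Λ N, hN, IsLocMap.exists_iso (f := N.subtype) ⟨fun y hy => ?_, fun z => ?_⟩⟩
    · exact ⟨1, p.2.one_notMem, by rw [Subtype.ext (a1 := y) (a2 := 0) hy, smul_zero]⟩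
    · obtain ⟨s, hs, h⟩ := hd z
      exact ⟨s, hs, ⟨_, h⟩, rfl⟩

lemma locMap_surjective {Y' : ModuleCat.{u} Λ} (f : Y ⟶ Y') (hf : Function.Surjective f.hom) :
    Function.Surjective ((locFunctor p).map f).hom := by
  rw [← resMap_surjective]
  intro z
  obtain ⟨s, hs, y, h⟩ := locUnit_exists z
  obtain ⟨x, rfl⟩ := hf y
  obtain ⟨w, hw⟩ := (res_smul_bijective hs).2 (locUnit p Y x)
  refine ⟨w, (res_smul_bijective hs).1 ?_⟩
  simp only at hw ⊢
  rw [h, ← map_smul, ← locUnit_naturality, hw]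

lemma locMap_injective {Y' : ModuleCat.{u} Λ} (f : Y ⟶ Y') (hf : Function.Injective f.hom) :
    Function.Injective ((locFunctor p).map f).hom := by
  rw [← resMap_injective, injective_iff_map_eq_zero]
  intro z hz
  obtain ⟨s, hs, y, h⟩ := locUnit_exists z
  have h1 : locUnit p Y' (f.hom y) = 0 := by
    rw [← locUnit_naturality, ← h, map_smul, hz, smul_zero]
  obtain ⟨t, ht, h2⟩ := locUnit_eq_zero h1
  rw [← map_smul] at h2
  apply res_smul_eq_zero hs
  apply res_smul_eq_zero ht
  rw [h, ← map_smul, hf (h2.trans (map_zero _).symm), map_zero]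

lemma locMap_exact {Y₁ Y₂ Y₃ : ModuleCat.{u} Λ} (f : Y₁ ⟶ Y₂) (g : Y₂ ⟶ Y₃)
    (h : Function.Exact f.hom g.hom) :
    Function.Exact ((locFunctor p).map f).hom ((locFunctor p).map g).hom := by
  change Function.Exact (resMap ((locFunctor p).map f).hom) (resMap ((locFunctor p).map g).hom)
  intro z
  constructor
  · intro hz
    obtain ⟨s, hs, y, hy⟩ := locUnit_exists z
    have h1 : locUnit p Y₃ (g.hom y) = 0 := by
      rw [← locUnit_naturality, ← hy, map_smul, hz, smul_zero]
    obtain ⟨t, ht, h2⟩ := locUnit_eq_zero h1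
    rw [← map_smul] at h2
    obtain ⟨x, hx⟩ := (h _).1 h2
    obtain ⟨w, hw⟩ := (res_smul_bijective (p.2.mul_notMem ht hs)).2 (locUnit p Y₁ x)
    refine ⟨w, (res_smul_bijective (p.2.mul_notMem ht hs)).1 ?_⟩
    simp only at hw ⊢
    rw [← map_smul, hw, locUnit_naturality, hx, map_smul, ← hy, ← mul_smul, ← map_mul]
  · rintro ⟨w, rfl⟩
    have h0 : f ≫ g = 0 := ModuleCat.hom_ext (LinearMap.ext fun x => (h _).2 ⟨x, rfl⟩)
    have h1 : (locFunctor p).map f ≫ (locFunctor p).map g = 0 := by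
      rw [← Functor.map_comp, h0, Functor.map_zero]
    obtain ⟨w, rfl⟩ := (toRes _).surjective w
    rw [resMap_toRes, resMap_toRes]
    exact congrArg (toRes _) (LinearMap.congr_fun (congrArg ModuleCat.Hom.hom h1) w)

end LocalizedModules

/-! ### Reduction modulo `p` over `Λ_p` -/

section LocalAlgebra

variable {R Λ : Type u} [CommRing R] [Ring Λ] [Algebra R Λ] {p : PrimeSpectrum R}

lemma algebraMap_locAlg (r : R) : algebraMap R (LocAlg Λ p) r =
    algebraMap (Localization.AtPrime p.asIdeal) (LocAlg Λ p)
      (algebraMap R (Localization.AtPrime p.asIdeal) r) := rfl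

lemma algebraMap_smul_toRes' {Z : ModuleCat.{u} (LocAlg Λ p)} (r : R) (z : Z) :
    algebraMap R Λ r • toRes Z z = toRes Z (algebraMap R (LocAlg Λ p) r • z) :=
  algebraMap_smul_toRes r z

section

variable {Z : ModuleCat.{u} (LocAlg Λ p)} [Module (Localization.AtPrime p.asIdeal) Z]
    [IsScalarTower (Localization.AtPrime p.asIdeal) (LocAlg Λ p) Z]

/-- An element of the maximal ideal is a fraction with numerator in `p`. Together with the next
lemma this identifies `pZ` with `𝔪Z`, so that Nakayama's lemma over `R_p` applies. -/
lemma maximalIdeal_smul_mem_primeMul {a : Localization.AtPrime p.asIdeal}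
    (ha : a ∈ IsLocalRing.maximalIdeal (Localization.AtPrime p.asIdeal)) (z : Z) :
    a • z ∈ primeMul p Z := by
  obtain ⟨⟨r, s⟩, h⟩ := IsLocalization.surj p.asIdeal.primeCompl a
  have hr : r ∈ p.asIdeal := by
    rw [← IsLocalization.AtPrime.to_map_mem_maximal_iff (Localization.AtPrime p.asIdeal) p.asIdeal]
    exact h ▸ Ideal.mul_mem_right _ _ ha
  have ha' : a = algebraMap R _ r * IsLocalization.mk' _ (1 : R) s := by
    rw [← h, mul_assoc]
    simp
  rw [ha', mul_smul, ← algebraMap_smul (LocAlg Λ p) (algebraMap R _ r), ← algebraMap_locAlg]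
  exact Submodule.subset_span ⟨r, hr, _, rfl⟩

/-- `R_p` acts centrally, so `𝔪Z` is stable under `Λ_p` and contains the span of the generators of
`pZ`. -/
lemma mem_maximalIdeal_smul_of_mem_primeMul {z : Z} (hz : z ∈ primeMul p Z) :
    z ∈ IsLocalRing.maximalIdeal (Localization.AtPrime p.asIdeal) •
      (⊤ : Submodule (Localization.AtPrime p.asIdeal) Z) := by
  induction hz using Submodule.span_induction with
  | zero => exact zero_mem _
  | add x y _ _ hx hy => exact add_mem hx hy
  | smul c x _ hx =>
    let f : Z →ₗ[Localization.AtPrime p.asIdeal] Z :=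
      { toFun := fun z => c • z
        map_add' := smul_add c
        map_smul' := fun a z => smul_comm c a z }
    have h2 : f x ∈ (IsLocalRing.maximalIdeal (Localization.AtPrime p.asIdeal) •
      (⊤ : Submodule (Localization.AtPrime p.asIdeal) Z)).map f := ⟨x, hx, rfl⟩
    rw [Submodule.map_smul''] at h2
    exact Submodule.smul_mono le_rfl le_top h2
  | mem x hx =>
    obtain ⟨a, ha, y, rfl⟩ := hx
    rw [algebraMap_locAlg, algebraMap_smul]
    exact Submodule.smul_mem_smul
      ((IsLocalization.AtPrime.to_map_mem_maximal_iff _ p.asIdeal a).2 ha) trivial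

end

lemma isScalarTower_compHom {Z : ModuleCat.{u} (LocAlg Λ p)} :
    letI : Module (Localization.AtPrime p.asIdeal) Z :=
      Module.compHom Z (algebraMap (Localization.AtPrime p.asIdeal) (LocAlg Λ p))
    IsScalarTower (Localization.AtPrime p.asIdeal) (LocAlg Λ p) Z := by
  let _ : Module (Localization.AtPrime p.asIdeal) Z :=
    Module.compHom Z (algebraMap (Localization.AtPrime p.asIdeal) (LocAlg Λ p))
  refine ⟨fun a c z => ?_⟩
  change (a • c) • z = algebraMap (Localization.AtPrime p.asIdeal) (LocAlg Λ p) a • c • z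
  have h : a • c = algebraMap (Localization.AtPrime p.asIdeal) (LocAlg Λ p) a * c :=
    Algebra.smul_def a c
  rw [h, mul_smul]

variable [IsNoetherianRing R] [Module.Finite R Λ]

instance isNoetherianRing_locAlg : IsNoetherianRing (LocAlg Λ p) :=
  have : IsNoetherianRing (Localization.AtPrime p.asIdeal) :=
    IsLocalization.isNoetherianRing p.asIdeal.primeCompl _ inferInstance
  IsNoetherianRing.of_finite (Localization.AtPrime p.asIdeal) (LocAlg Λ p)

lemma modFl_quotient_primeMul (Z : ModuleCat.{u} (LocAlg Λ p)) [Module.Finite (LocAlg Λ p) Z] :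
    modFl (LocAlg Λ p) (ModuleCat.of (LocAlg Λ p) (Z ⧸ primeMul p Z)) := by
  have : IsNoetherianRing (Localization.AtPrime p.asIdeal) :=
    IsLocalization.isNoetherianRing p.asIdeal.primeCompl _ inferInstance
  let _ : Module (Localization.AtPrime p.asIdeal) Z :=
    Module.compHom Z (algebraMap (Localization.AtPrime p.asIdeal) (LocAlg Λ p))
  have : IsScalarTower (Localization.AtPrime p.asIdeal) (LocAlg Λ p) Z :=
    isScalarTower_compHom
  refine isFiniteLength_of_maximalIdeal_smul (S := Localization.AtPrime p.asIdeal)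
    (X := Z ⧸ primeMul p Z) fun a ha x => ?_
  obtain ⟨z, rfl⟩ := (primeMul p Z).mkQ_surjective x
  rw [← algebraMap_smul (LocAlg Λ p) a, ← map_smul, algebraMap_smul, ← LinearMap.mem_ker,
    Submodule.ker_mkQ]
  exact maximalIdeal_smul_mem_primeMul ha z

lemma ExtendsAlong.of_quotient_primeMul {P₁ P₀ : Type u} [AddCommGroup P₁]
    [Module (LocAlg Λ p) P₁] [AddCommGroup P₀] [Module (LocAlg Λ p) P₀]
    [Module.Finite (LocAlg Λ p) P₁] [Module.Projective (LocAlg Λ p) P₁]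
    [Module.Projective (LocAlg Λ p) P₀] (d : P₁ →ₗ[LocAlg Λ p] P₀)
    (Z : ModuleCat.{u} (LocAlg Λ p)) [Module.Finite (LocAlg Λ p) Z]
    (h : ExtendsAlong d (Z ⧸ primeMul p Z)) : ExtendsAlong d Z := by
  have : IsNoetherianRing (Localization.AtPrime p.asIdeal) :=
    IsLocalization.isNoetherianRing p.asIdeal.primeCompl _ inferInstance
  let _ : Module (Localization.AtPrime p.asIdeal) Z :=
    Module.compHom Z (algebraMap (Localization.AtPrime p.asIdeal) (LocAlg Λ p))
  have : IsScalarTower (Localization.AtPrime p.asIdeal) (LocAlg Λ p) Z :=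
    isScalarTower_compHom
  exact ExtendsAlong.of_quotient_maximalIdeal (S := Localization.AtPrime p.asIdeal) d
    (primeMul p Z) (fun x hx => mem_maximalIdeal_smul_of_mem_primeMul hx) h

lemma exists_pow_smul_res_eq_zero {Z : ModuleCat.{u} (LocAlg Λ p)} (h : modFl _ Z) {a : R}
    (ha : a ∈ p.asIdeal) : ∃ n : ℕ, ∀ z : res p Z, algebraMap R Λ (a ^ n) • z = 0 := by
  have : IsNoetherianRing (Localization.AtPrime p.asIdeal) :=
    IsLocalization.isNoetherianRing p.asIdeal.primeCompl _ inferInstance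
  let _ : Module (Localization.AtPrime p.asIdeal) Z :=
    Module.compHom Z (algebraMap (Localization.AtPrime p.asIdeal) (LocAlg Λ p))
  have : IsScalarTower (Localization.AtPrime p.asIdeal) (LocAlg Λ p) Z :=
    isScalarTower_compHom
  obtain ⟨n, hn⟩ := exists_pow_smul_eq_zero (S := Localization.AtPrime p.asIdeal) h
    ((IsLocalization.AtPrime.to_map_mem_maximal_iff _ p.asIdeal a).2 ha)
  refine ⟨n, fun z => ?_⟩
  obtain ⟨z, rfl⟩ := (toRes Z).surjective z
  rw [algebraMap_smul_toRes', algebraMap_locAlg, algebraMap_smul, map_pow, hn, map_zero]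

/-- The order of `2-silt Λ_p` is detected by modules of finite length. -/
lemma TwoSilt.le_iff_fac_inf_modFl_le (x y : TwoSilt (LocAlg Λ p)) :
    x ≤ y ↔ x.fac ⊓ modFl _ ≤ y.fac ⊓ modFl _ := by
  rw [TwoSilt.le_iff_fac_le]
  refine ⟨fun h => inf_le_inf_right _ h, fun h => ?_⟩
  obtain ⟨K, hK, hyK⟩ := y.exists_fac_iff
  intro X hX
  have := x.finite_of_fac hX
  have := (hK 0).2
  have := (hK (-1)).1
  have := (hK (-1)).2
  -- Pass to `X/pX`, which has finite length and lies in the class of `x`; the vanishing lifts back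
  -- to `X`.
  refine (hyK X inferInstance).2 (ExtendsAlong.of_quotient_primeMul _ _ ?_)
  refine (hyK (ModuleCat.of _ (X ⧸ primeMul p X)) (inferInstanceAs (IsNoetherian _ (X ⧸ _)))).1
    (h _ ⟨?_, modFl_quotient_primeMul X⟩).1
  exact x.fac_of_epi (ModuleCat.ofHom (primeMul p X).mkQ)
    ((ModuleCat.epi_iff_surjective _).2 (primeMul p X).mkQ_surjective) hX

end LocalAlgebra

/-! ### `Fac` classes commute with localisation -/

section FacLocalization

variable {R Λ : Type u} [CommRing R] [Ring Λ] [Algebra R Λ] {p : PrimeSpectrum R}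

/-- A surjection from a power of `M_p` restricts to the same power of `M`, and the image is dense by
clearing denominators. Conversely, localisation preserves surjections and summands. -/
lemma locProp_fac (M : ModuleCat.{u} Λ) : fac ((locFunctor p).obj M) = locProp p (fac M) := by
  funext Z
  apply propext
  have hT : ∀ (X Y : ModuleCat.{u} Λ) (f : X ⟶ Y), Epi f → fac M X → fac M Y := by
    intro X Y f hf h
    rw [ModuleCat.epi_iff_surjective] at hf
    exact fac_iff.2 ((fac_iff.1 h).of_surjective f.hom hf)
  constructor
  · intro h
    obtain ⟨n, g, hg⟩ := fac_iff.1 h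
    rw [locProp_iff hT]
    let φ : (Fin n → M) →ₗ[Λ] res p Z := LinearMap.lsum Λ (fun _ => M) ℕ fun k =>
      resMap (g ∘ₗ LinearMap.single _ (fun _ => (locFunctor p).obj M) k) ∘ₗ locUnit p M
    refine ⟨LinearMap.range φ, fac_iff.2 ⟨n, φ.rangeRestrict, φ.surjective_rangeRestrict⟩, fun z => ?_⟩
    obtain ⟨z, rfl⟩ := (toRes Z).surjective z
    obtain ⟨x, rfl⟩ := hg z
    choose s hs m hm using fun k => locUnit_exists (toRes _ (x k))
    have hx : toRes Z (g x) = ∑ k, resMap (g ∘ₗ LinearMap.single _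
        (fun _ => (locFunctor p).obj M) k) (toRes _ (x k)) := by
      conv_lhs => rw [← Finset.univ_sum_single x, map_sum, map_sum]
      rfl
    -- The product of the denominators is a common one; each numerator absorbs the remaining
    -- factors.
    refine ⟨∏ k, s k, fun hp => ?_, fun k => algebraMap R Λ (∏ j ∈ Finset.univ.erase k, s j) • m k, ?_⟩
    · obtain ⟨k, -, hk⟩ := (p.2.prod_mem_iff).1 hp
      exact hs k hk
    · simp only [φ, LinearMap.lsum_apply, LinearMap.sum_apply, LinearMap.comp_apply,
        LinearMap.proj_apply]
      rw [hx, Finset.smul_sum]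
      refine Finset.sum_congr rfl fun k _ => ?_
      rw [map_smul, ← hm, ← mul_smul, ← map_mul, Finset.prod_erase_mul _ _ (Finset.mem_univ k),
        map_smul]
  · rintro ⟨Y, ⟨Y', f, hf, hf'⟩, ⟨e⟩⟩
    refine ⟨(locFunctor p).obj Y', (locFunctor p).map f ≫ e.inv, addOf_map _ hf, ?_⟩
    rw [ModuleCat.epi_iff_surjective] at hf'
    have : Epi ((locFunctor p).map f) :=
      (ModuleCat.epi_iff_surjective _).2 (locMap_surjective f hf')
    infer_instance

/-- `H⁰` of a two-term complex is a cokernel, and localisation is exact. -/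
lemma exists_H0_locK_iso {P : KMod Λ} (hP : IsTwoTermSilting P) :
    Nonempty (H0 ((locK p).obj P) ≅ (locFunctor p).obj (H0 P)) := by
  obtain ⟨K, hK⟩ := hP.exists_presents
  have hK' : Presents (((locFunctor p).mapHomologicalComplex _).obj K) ((locK p).obj P) :=
    ⟨fun n => locFunctor_fgProj p (hK.fgProj n),
      fun n h1 h2 => (locFunctor p).map_isZero (hK.isZero n h1 h2),
      hK.iso.map fun e => (locK p).mapIso e⟩
  obtain ⟨e⟩ := hK.exists_H0_equiv
  obtain ⟨e'⟩ := hK'.exists_H0_equiv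
  let π : K.X 0 ⟶ H0 P := ModuleCat.ofHom (e.symm.toLinearMap ∘ₗ (LinearMap.range (diff K)).mkQ)
  have hπ : Function.Surjective π.hom := e.symm.surjective.comp (Submodule.mkQ_surjective _)
  have hex : Function.Exact (K.d (-1) 0).hom π.hom := by
    intro x
    change e.symm ((LinearMap.range (diff K)).mkQ x) = 0 ↔ x ∈ LinearMap.range (diff K)
    rw [LinearEquiv.map_eq_zero_iff, ← LinearMap.mem_ker, Submodule.ker_mkQ]
  have h1 := locMap_surjective (p := p) π hπ
  have h2 := locMap_exact (p := p) _ _ hex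
  exact ⟨(e'.trans ((Submodule.quotEquivOfEq _ _ h2.linearMap_ker_eq.symm).trans
    (LinearMap.quotKerEquivOfSurjective _ h1))).toModuleIso⟩

lemma TwoSilt.fac_localize (x : TwoSilt Λ) : (x.localize p).fac = locProp p x.fac := by
  induction x using Quotient.inductionOn with
  | h P =>
    obtain ⟨e⟩ := exists_H0_locK_iso (p := p) P.2
    exact (fac_congr e).trans (locProp_fac _)

end FacLocalization

/-! ### Closure properties of torsion classes -/

section TorsionClasses

variable {A : Type u} [Ring A] {𝒜 T : ObjectProperty (ModuleCat.{u} A)}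

lemma IsTorsionClass.of_exact (hT : IsTorsionClass 𝒜 T) {X₁ X₂ X₃ : ModuleCat.{u} A}
    (f : X₁ →ₗ[A] X₂) (g : X₂ →ₗ[A] X₃) (hf : Function.Injective f) (hg : Function.Surjective g)
    (hfg : Function.Exact f g) (h₁ : T X₁) (h₃ : T X₃) (h₂ : 𝒜 X₂) : T X₂ :=
  hT.extension (ShortComplex.mk (ModuleCat.ofHom f) (ModuleCat.ofHom g)
      (ModuleCat.hom_ext hfg.linearMap_comp_eq_zero))
    (ModuleCat.shortComplex_shortExact _ hfg hf hg) h₁ h₃ h₂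

lemma IsTorsionClass.of_epi (hT : IsTorsionClass (modFg A) T) (X Y : ModuleCat.{u} A) (f : X ⟶ Y)
    (hf : Epi f) (h : T X) : T Y := by
  have : Module.Finite A X := hT.le _ h
  exact hT.factor X Y f hf h
    (Module.Finite.of_surjective f.hom ((ModuleCat.epi_iff_surjective f).1 hf))

lemma IsTorsionClass.of_surjective (hT : IsTorsionClass (modFg A) T) {X Y : ModuleCat.{u} A}
    (f : X →ₗ[A] Y) (hf : Function.Surjective f) (h : T X) : T Y :=
  hT.of_epi X Y (ModuleCat.ofHom f) ((ModuleCat.epi_iff_surjective _).2 hf) h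

lemma IsTorsionClass.of_subsingleton (hT : IsTorsionClass 𝒜 T) (X : ModuleCat.{u} A)
    [Subsingleton X] : T X :=
  hT.zero X (ModuleCat.isZero_of_subsingleton X)

end TorsionClasses

/-! ### Localised torsion classes and compatibility -/

section LocalizedTorsion

variable {R Λ : Type u} [CommRing R] [Ring Λ] [Algebra R Λ] {p : PrimeSpectrum R}

variable (Λ) in
/-- Multiplication by an element of the base ring. -/
def mulBy (r : R) (X : Type u) [AddCommGroup X] [Module Λ X] : X →ₗ[Λ] X where
  toFun x := algebraMap R Λ r • x
  map_add' := smul_add _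
  map_smul' l x := by
    rw [RingHom.id_apply, ← mul_smul, ← mul_smul, Algebra.commutes]

lemma mulBy_apply (r : R) {X : Type u} [AddCommGroup X] [Module Λ X] (x : X) :
    mulBy Λ r X x = algebraMap R Λ r • x := rfl

/-- A finitely generated module in which each element has a multiple in `D` by an element outside
of `p` has a common such multiplier. -/
lemma exists_smul_mem_of_finite {X : Type u} [AddCommGroup X] [Module Λ X] [Module.Finite Λ X]
    {D : Submodule Λ X} (h : IsDense p D) : ∃ s ∉ p.asIdeal, ∀ x : X, algebraMap R Λ s • x ∈ D := by
  obtain ⟨n, f, hf⟩ := Module.Finite.exists_fin' Λ X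
  choose s hs hm using fun k => h (f (Pi.single k 1))
  refine ⟨∏ k, s k, fun hp => ?_, fun x => ?_⟩
  · obtain ⟨k, -, hk⟩ := (p.2.prod_mem_iff).1 hp
    exact hs k hk
  · obtain ⟨y, rfl⟩ := hf x
    have hle : (⊤ : Submodule Λ (Fin n → Λ)) ≤ D.comap (mulBy Λ (∏ k, s k) X ∘ₗ f) := by
      rw [← (Pi.basisFun Λ (Fin n)).span_eq, Submodule.span_le]
      rintro _ ⟨k, rfl⟩
      rw [SetLike.mem_coe, Submodule.mem_comap, LinearMap.comp_apply, Pi.basisFun_apply, mulBy_apply,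
        ← Finset.prod_erase_mul _ _ (Finset.mem_univ k), map_mul, mul_smul]
      exact D.smul_mem _ (hm k)
    exact hle (Submodule.mem_top (x := y))

/-- A map into a fraction of the image of `a` factors through `a` up to a scalar. -/
lemma exists_factor_smul {X Y W : Type u} [AddCommGroup X] [Module Λ X] [AddCommGroup Y]
    [Module Λ Y] [AddCommGroup W] [Module Λ W] (a : X →ₗ[Λ] Y) (b : W →ₗ[Λ] Y) (t : R)
    (ht : ∀ x, a x = 0 → algebraMap R Λ t • x = 0) (hb : ∀ w, ∃ x, a x = b w) :
    ∃ c : W →ₗ[Λ] X, ∀ w, a (c w) = algebraMap R Λ t • b w := by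
  -- The value `c w` is `t • z` for any `z` over `b w`; the choice does not matter because `t` kills
  -- the kernel of `a`.
  have hc : ∀ w, ∃ x, (∃ z, a z = b w ∧ x = algebraMap R Λ t • z) := fun w =>
    let ⟨z, hz⟩ := hb w; ⟨_, z, hz, rfl⟩
  have huniq : ∀ z z', a z = a z' → algebraMap R Λ t • z = algebraMap R Λ t • z' := by
    intro z z' h
    rw [← sub_eq_zero, ← smul_sub]
    exact ht _ (by rw [map_sub, h, sub_self])
  choose c z hz hcz using hc
  refine ⟨{ toFun := c
            map_add' := fun v w => ?_
            map_smul' := fun l w => ?_ }, fun w => ?_⟩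
  · rw [hcz, hcz, hcz, ← smul_add]
    exact huniq _ _ (by rw [map_add, hz, hz, hz, map_add])
  · rw [hcz, hcz, RingHom.id_apply, ← mulBy_apply, ← mulBy_apply, ← map_smul]
    exact huniq _ _ (by rw [map_smul, hz, hz, map_smul])
  · change a (c w) = _
    rw [hcz, ← mulBy_apply, ← mulBy_apply, mulBy_apply, map_smul, hz, mulBy_apply]

variable {T : ObjectProperty (ModuleCat.{u} Λ)}

lemma IsLocMap.locFunctor_iso {Y Y' : ModuleCat.{u} Λ} {f : Y →ₗ[Λ] Y'} (hf : IsLocMap p f) :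
    Nonempty ((locFunctor p).obj Y' ≅ (locFunctor p).obj Y) :=
  (isLocMap_locUnit.comp hf).exists_iso

lemma locFunctor_finite {Y : ModuleCat.{u} Λ} [Module.Finite Λ Y] :
    Module.Finite (LocAlg Λ p) ((locFunctor p).obj Y) := by
  have h1 : fac (ModuleCat.of Λ Λ) Y := by
    obtain ⟨n, f, hf⟩ := Module.Finite.exists_fin' Λ Y
    exact fac_iff.2 ⟨n, f, hf⟩
  have h2 : fac ((locFunctor p).obj (ModuleCat.of Λ Λ)) ((locFunctor p).obj Y) := by
    rw [locProp_fac]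
    exact ⟨Y, h1, ⟨Iso.refl _⟩⟩
  have : Module.Finite (LocAlg Λ p) ((locFunctor p).obj (ModuleCat.of Λ Λ)) :=
    Module.Finite.equiv (locSelfEquiv p)
  exact (fac_iff.1 h2).finite

lemma locProp_of_epi (hT : ∀ (X Y : ModuleCat.{u} Λ) (f : X ⟶ Y), Epi f → T X → T Y)
    {X Y : ModuleCat.{u} (LocAlg Λ p)} (f : X →ₗ[LocAlg Λ p] Y) (hf : Function.Surjective f)
    (h : locProp p T X) : locProp p T Y := by
  obtain ⟨N, hN, hd⟩ := (locProp_iff hT).1 h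
  refine (locProp_iff hT).2 ⟨N.map (resMap f), ?_, fun z => ?_⟩
  · exact hT _ _ (ModuleCat.ofHom ((resMap f).submoduleMap N))
      ((ModuleCat.epi_iff_surjective _).2 (LinearMap.submoduleMap_surjective _ _)) hN
  · obtain ⟨x, rfl⟩ := resMap_surjective.2 hf z
    obtain ⟨s, hs, h⟩ := hd x
    exact ⟨s, hs, _, h, map_smul _ _ _⟩

/-- Localisation at `q ≤ p` factors through localisation at `p`. -/
lemma locPropFrom_locProp {q : PrimeSpectrum R} (hqp : q ≤ p) :
    locPropFrom p q (locProp p T) = locProp q T := by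
  funext Z
  apply propext
  constructor
  · rintro ⟨Y', ⟨Y, hY, ⟨e⟩⟩, ⟨e'⟩⟩
    obtain ⟨f, hf⟩ := exists_isLocMap_of_iso e
    obtain ⟨i⟩ := (hf.of_le hqp).locFunctor_iso
    exact ⟨Y, hY, ⟨e' ≪≫ i⟩⟩
  · rintro ⟨Y, hY, ⟨e⟩⟩
    obtain ⟨i⟩ := ((isLocMap_locUnit (p := p) (Y := Y)).of_le hqp).locFunctor_iso
    exact ⟨(locFunctor p).obj Y, ⟨Y, hY, ⟨Iso.refl _⟩⟩, ⟨e ≪≫ i.symm⟩⟩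

variable [IsNoetherianRing R] [Module.Finite R Λ]

/-- Localised torsion classes are closed under extensions. -/
lemma IsTorsionClass.locProp_of_exact (hT : IsTorsionClass (modFg Λ) T)
    {X₁ X₂ X₃ : ModuleCat.{u} (LocAlg Λ p)} (f' : X₁ →ₗ[LocAlg Λ p] X₂)
    (g' : X₂ →ₗ[LocAlg Λ p] X₃) (hf : Function.Injective f') (hg : Function.Surjective g')
    (hfg : Function.Exact f' g') (h₁ : locProp p T X₁) (h₃ : locProp p T X₃) :
    locProp p T X₂ := by
  have : IsNoetherianRing Λ := IsNoetherianRing.of_finite R Λ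
  rw [locProp_iff hT.of_epi] at *
  obtain ⟨N₁, hN₁, hd₁⟩ := h₁
  obtain ⟨N₃, hN₃, hd₃⟩ := h₃
  rw [← resMap_injective] at hf
  rw [← resMap_surjective] at hg
  replace hfg : Function.Exact (resMap f') (resMap g') := hfg
  revert hf hg hfg
  generalize resMap f' = f
  generalize resMap g' = g
  intro hf hg hfg
  have hfin₃ : N₃.FG := Module.Finite.iff_fg.1 (hT.le _ hN₃)
  obtain ⟨S, hS⟩ := hfin₃
  -- Lifts of generators of `N₃` span a finitely generated `L` over `N₃`. Its part `C` in `X₁` may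
  -- fail to lie in `N₁`.
  let L : Submodule Λ (res p X₂) := Submodule.span Λ (Function.surjInv hg '' S)
  have hLg : L.map g = N₃ := by
    rw [Submodule.map_span, ← hS, ← Set.image_comp]
    congr 1
    convert Set.image_id _ using 2
    funext x
    exact Function.surjInv_eq hg x
  have hLfin : Module.Finite Λ L :=
    Module.Finite.iff_fg.2 (Submodule.fg_span (S.finite_toSet.image _))
  let C : Submodule Λ (res p X₁) := L.comap f
  have hCfin : Module.Finite Λ C := by
    let φ : C →ₗ[Λ] L := (f ∘ₗ C.subtype).codRestrict L fun x => x.2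
    exact Module.Finite.of_injective φ fun x y h => Subtype.ext (hf (congrArg Subtype.val h))
  -- As `C` is finitely generated, one `s ∉ p` carries it into `N₁`. The preimage `N₁'` of `N₁`
  -- under `s` is isomorphic to `N₁` and contains `C`.
  obtain ⟨s, hs, hsC⟩ := exists_smul_mem_of_finite (p := p) (D := N₁.comap C.subtype)
    fun x => hd₁ x
  let N₁' : Submodule Λ (res p X₁) := N₁.comap (mulBy Λ s _)
  have hN₁' : T (ModuleCat.of Λ N₁') := by
    let φ : N₁' →ₗ[Λ] N₁ := (mulBy Λ s _ ∘ₗ N₁'.subtype).codRestrict N₁ fun x => x.2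
    have hφ : Function.Bijective φ := by
      constructor
      · intro x y h
        exact Subtype.ext ((res_smul_bijective hs).1 (congrArg Subtype.val h))
      · intro y
        obtain ⟨x, hx⟩ := (res_smul_bijective (Z := X₁) hs).2 y.1
        have hx' : mulBy Λ s _ x = y.1 := hx
        exact ⟨⟨x, by change mulBy Λ s _ x ∈ N₁; rw [hx']; exact y.2⟩, Subtype.ext hx⟩
    exact hT.of_surjective (X := ModuleCat.of Λ N₁) (Y := ModuleCat.of Λ N₁')
      (LinearEquiv.ofBijective φ hφ).symm.toLinearMap (LinearEquiv.surjective _) hN₁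
  have hfinN₁' : Module.Finite Λ N₁' := hT.le _ hN₁'
  -- Since `C ⊆ N₁'`, the kernel of `N₂ → N₃` is exactly `N₁'`, so `N₂` is an extension in `T`.
  let N₂ : Submodule Λ (res p X₂) := L ⊔ N₁'.map f
  have hgf : ∀ x, g (f x) = 0 := hfg.apply_apply_eq_zero
  have hfN : ∀ x ∈ N₁', f x ∈ N₂ := fun x hx => Submodule.mem_sup_right ⟨x, hx, rfl⟩
  have hgN : ∀ x ∈ N₂, g x ∈ N₃ := by
    intro x hx
    obtain ⟨l, hl, _, ⟨y, -, rfl⟩, rfl⟩ := Submodule.mem_sup.1 hx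
    rw [map_add, hgf, add_zero, ← hLg]
    exact ⟨l, hl, rfl⟩
  have hN₂fin : Module.Finite Λ N₂ := Module.Finite.iff_fg.2
    ((Module.Finite.iff_fg.1 hLfin).sup ((Module.Finite.iff_fg.1 hfinN₁').map f))
  refine ⟨N₂, hT.of_exact (X₁ := ModuleCat.of Λ N₁') (X₂ := ModuleCat.of Λ N₂)
    (X₃ := ModuleCat.of Λ N₃) (f.restrict hfN) (g.restrict hgN) ?_ ?_ ?_ hN₁' hN₃ hN₂fin, ?_⟩
  · intro x y h
    exact Subtype.ext (hf (congrArg Subtype.val h))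
  · rintro ⟨y, hy⟩
    rw [← hLg] at hy
    obtain ⟨l, hl, rfl⟩ := hy
    exact ⟨⟨l, Submodule.mem_sup_left hl⟩, rfl⟩
  · rintro ⟨x, hx⟩
    constructor
    · intro h
      obtain ⟨y, rfl⟩ := (hfg x).1 (congrArg Subtype.val h)
      refine ⟨⟨y, ?_⟩, rfl⟩
      obtain ⟨l, hl, _, ⟨z, hz, rfl⟩, h'⟩ := Submodule.mem_sup.1 hx
      have hC : y - z ∈ C := by
        change f (y - z) ∈ L
        rwa [map_sub, ← h', add_sub_cancel_right]
      have h2 : y - z ∈ N₁' := hsC ⟨y - z, hC⟩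
      simpa using add_mem h2 hz
    · rintro ⟨y, h⟩
      rw [← h]
      exact Subtype.ext (hgf _)
  · intro z
    obtain ⟨s', hs', hz⟩ := hd₃ (g z)
    rw [← hLg] at hz
    obtain ⟨l, hl, hlz⟩ := hz
    obtain ⟨x, hx⟩ := (hfg (algebraMap R Λ s' • z - l)).1 (by rw [map_sub, map_smul, hlz, sub_self])
    obtain ⟨t, ht, hxt⟩ := hd₁ x
    refine ⟨t * s', p.2.mul_notMem ht hs', ?_⟩
    have h1 : algebraMap R Λ s' • z = l + f x := by rw [hx, add_sub_cancel]
    rw [map_mul, mul_smul, h1, smul_add, ← map_smul]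
    refine add_mem (N₂.smul_mem _ (Submodule.mem_sup_left hl)) (hfN _ ?_)
    change algebraMap R Λ s • (algebraMap R Λ t • x) ∈ N₁
    exact N₁.smul_mem _ hxt

lemma IsTorsionClass.phiT (hT : IsTorsionClass (modFg Λ) T) :
    IsTorsionClass (modFl (LocAlg Λ p)) (locProp p T ⊓ modFl (LocAlg Λ p)) where
  le := inf_le_right
  zero Z hZ := by
    have : Subsingleton Z := ModuleCat.subsingleton_of_isZero hZ
    refine ⟨(locProp_iff hT.of_epi).2 ⟨⊥, hT.of_subsingleton _, fun z => ⟨1, p.2.one_notMem, ?_⟩⟩,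
      IsFiniteLength.of_subsingleton⟩
    obtain ⟨z, rfl⟩ := (toRes Z).surjective z
    rw [Subsingleton.elim z 0, map_zero, smul_zero]
    exact zero_mem _
  factor X Y f hf hX hY := by
    refine ⟨?_, hY⟩
    obtain ⟨N, hN, hd⟩ := (locProp_iff hT.of_epi).1 hX.1
    refine (locProp_iff hT.of_epi).2 ⟨N.map (resMap f.hom), ?_, fun z => ?_⟩
    · exact hT.of_surjective (X := ModuleCat.of Λ N) (Y := ModuleCat.of Λ (N.map (resMap f.hom)))
        ((resMap f.hom).submoduleMap N) (LinearMap.submoduleMap_surjective _ _) hN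
    · obtain ⟨x, rfl⟩ := resMap_surjective.2 ((ModuleCat.epi_iff_surjective f).1 hf) z
      obtain ⟨s, hs, h⟩ := hd x
      exact ⟨s, hs, _, h, map_smul _ _ _⟩
  extension S hS h₁ h₃ h₂ := by
    refine ⟨hT.locProp_of_exact S.f.hom S.g.hom hS.moduleCat_injective_f hS.moduleCat_surjective_g
      ((ShortComplex.ShortExact.moduleCat_exact_iff_function_exact _).1 hS.exact) h₁.1 h₃.1, h₂⟩

/-- A module in `T_q` is the localisation of some `Y ∈ T_p`, and `Y/pY` is a factor module of finite
length. This gives the compatibility of the values of `Φ_t`. -/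
lemma le_rMap (hT : ∀ (X Y : ModuleCat.{u} Λ) (f : X ⟶ Y), Epi f → T X → T Y)
    (hfg : T ≤ modFg Λ) {q : PrimeSpectrum R} (hqp : q ≤ p) :
    locProp q T ⊓ modFl _ ≤ rMap p q (locProp p T ⊓ modFl _) := by
  rintro Z ⟨hZ, hZ'⟩
  refine ⟨?_, hZ'⟩
  rw [← locPropFrom_locProp hqp] at hZ
  obtain ⟨Y, hY, e⟩ := hZ
  have hYfin : Module.Finite (LocAlg Λ p) Y := by
    obtain ⟨Y', hY', ⟨e'⟩⟩ := hY
    have : Module.Finite Λ Y' := hfg _ hY'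
    have := locFunctor_finite (p := p) (Y := Y')
    exact Module.Finite.equiv e'.symm.toLinearEquiv
  exact ⟨Y, ⟨hYfin, locProp_of_epi hT (Y := ModuleCat.of (LocAlg Λ p) (Y ⧸ primeMul p Y)) (primeMul p Y).mkQ
    (primeMul p Y).mkQ_surjective hY, modFl_quotient_primeMul Y⟩, e⟩

/-- By Nakayama's lemma `Y/pY ∈ Fac` forces `Y ∈ Fac`, so `ψ_p` stays in the class over `Λ_p`, which
localises to the class over `Λ_q`. Compatibility thereby becomes a comparison at `q` alone. -/
lemma rMap_le (x : TwoSilt Λ) {q : PrimeSpectrum R} (hqp : q ≤ p) :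
    rMap p q ((x.localize p).fac ⊓ modFl _) ≤ (x.localize q).fac ⊓ modFl _ := by
  rintro Z ⟨⟨Y, ⟨hY, hY', -⟩, e⟩, hZ⟩
  refine ⟨?_, hZ⟩
  rw [TwoSilt.fac_localize, ← locPropFrom_locProp hqp, ← TwoSilt.fac_localize]
  refine ⟨Y, ?_, e⟩
  obtain ⟨K, hK, hyK⟩ := (x.localize p).exists_fac_iff
  have : Module.Finite (LocAlg Λ p) Y := hY
  have := (hK 0).2
  have := (hK (-1)).1
  have := (hK (-1)).2
  refine (hyK Y inferInstance).2 (ExtendsAlong.of_quotient_primeMul _ _ ?_)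
  exact (hyK (ModuleCat.of _ (Y ⧸ primeMul p Y)) (inferInstanceAs (IsNoetherian _ (Y ⧸ _)))).1 hY'

end LocalizedTorsion

/-! ### Detecting torsion classes at residue fields -/

section Detection

variable {R Λ : Type u} [CommRing R] [Ring Λ] [Algebra R Λ] [IsNoetherianRing R]
  {T : ObjectProperty (ModuleCat.{u} Λ)}

/-- A prime ideal `p` of the form `(Ann X : r)`. -/
lemma exists_prime_annihilator (X : Type u) [AddCommGroup X] [Module Λ X] [Nontrivial X] :
    ∃ (p : PrimeSpectrum R) (r : R), ∀ a, a ∈ p.asIdeal ↔ ∀ x : X, algebraMap R Λ (a * r) • x = 0 := by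
  let _ : Module R X := Module.compHom X (algebraMap R Λ)
  have : Nontrivial (R ⧸ Module.annihilator R X) := by
    rw [Ideal.Quotient.nontrivial_iff, Ne, Module.annihilator_eq_top_iff]
    exact not_subsingleton X
  -- An associated prime of `R ⧸ Ann X` is the annihilator of the class of some `r`.
  obtain ⟨q, hq⟩ := associatedPrimes.nonempty R (R ⧸ Module.annihilator R X)
  obtain ⟨hq1, x, hx⟩ := Submodule.isAssociatedPrime_iff.1 hq
  obtain ⟨r, rfl⟩ := Ideal.Quotient.mk_surjective x
  refine ⟨⟨q, hq1⟩, r, fun a => ?_⟩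
  change a ∈ q ↔ _
  rw [hx, Submodule.mem_colon_singleton, Submodule.mem_bot, Algebra.smul_def,
    Ideal.Quotient.algebraMap_eq, ← map_mul, Ideal.Quotient.eq_zero_iff_mem, Module.mem_annihilator]
  rfl

variable [Module.Finite R Λ]

/-- A nonzero module that lies in a torsion class at all residue fields has a nonzero submodule in
the torsion class. -/
lemma IsTorsionClass.exists_submodule (hT : IsTorsionClass (modFg Λ) T) (X : ModuleCat.{u} Λ)
    [Nontrivial X] [Module.Finite Λ X]
    (h : ∀ p : PrimeSpectrum R, locProp p T (ModuleCat.of (LocAlg Λ p)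
      ((locFunctor p).obj X ⧸ primeMul p ((locFunctor p).obj X)))) :
    ∃ V : Submodule Λ X, V ≠ ⊥ ∧ T (ModuleCat.of Λ V) := by
  have : IsNoetherianRing Λ := IsNoetherianRing.of_finite R Λ
  obtain ⟨p, r, hp⟩ := exists_prime_annihilator (R := R) (Λ := Λ) X
  -- Multiplication by `r` kills `pX_p` by the choice of `p`, so it induces `ρ : X_p/pX_p → X_p`.
  -- The image under `ρ` of a dense submodule in `T` is the source of `V`.
  let ρ₀ : (locFunctor p).obj X →ₗ[LocAlg Λ p] (locFunctor p).obj X :=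
    ((locFunctor p).map (ModuleCat.ofHom (mulBy Λ r X))).hom
  have hρ₀ : ∀ x : X, resMap ρ₀ (locUnit p X x) = locUnit p X (algebraMap R Λ r • x) := fun _ => rfl
  have hker : primeMul p ((locFunctor p).obj X) ≤ LinearMap.ker ρ₀ := by
    refine Submodule.span_le.2 ?_
    rintro _ ⟨a, ha, z, rfl⟩
    rw [SetLike.mem_coe, LinearMap.mem_ker]
    apply (toRes _).injective
    rw [← resMap_toRes, ← algebraMap_smul_toRes', map_zero]
    obtain ⟨s, hs, x, hx⟩ := locUnit_exists (toRes _ z)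
    apply res_smul_eq_zero hs
    rw [← map_smul, ← mul_smul, ← map_mul, mul_comm, map_mul, mul_smul, hx, ← map_smul, hρ₀,
      ← mul_smul, ← map_mul, mul_comm, (hp a).1 ha, map_zero]
  let ρ : ModuleCat.of (LocAlg Λ p) ((locFunctor p).obj X ⧸ primeMul p ((locFunctor p).obj X))
      →ₗ[LocAlg Λ p] (locFunctor p).obj X := (primeMul p _).liftQ ρ₀ hker
  let π : (locFunctor p).obj X →ₗ[LocAlg Λ p]
    ModuleCat.of (LocAlg Λ p) ((locFunctor p).obj X ⧸ primeMul p ((locFunctor p).obj X)) :=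
    (primeMul p ((locFunctor p).obj X)).mkQ
  have hρπ : ∀ z, resMap ρ (resMap π z) = resMap ρ₀ z := fun _ => rfl
  obtain ⟨N, hN, hd⟩ := (locProp_iff hT.of_epi).1 (h p)
  let W := N.map (resMap ρ)
  have hTW : T (ModuleCat.of Λ W) :=
    hT.of_surjective (X := ModuleCat.of Λ N) (Y := ModuleCat.of Λ W)
      ((resMap ρ).submoduleMap N) (LinearMap.submoduleMap_surjective _ _) hN
  have hWfin : Module.Finite Λ W := hT.le _ hTW
  -- If `W = 0`, some `s ∉ p` satisfies `s r X = 0`, contradicting the choice of `p`.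
  have hW0 : W ≠ ⊥ := by
    intro hW
    have h1 : IsDense p (LinearMap.ker (mulBy Λ r X)) := by
      intro x
      obtain ⟨s, hs, hx⟩ := hd (resMap π (locUnit p X x))
      have h2 : resMap ρ (algebraMap R Λ s • resMap π (locUnit p X x)) ∈ W := ⟨_, hx, rfl⟩
      rw [hW, Submodule.mem_bot, map_smul, hρπ, hρ₀] at h2
      obtain ⟨t, ht, h3⟩ := locUnit_eq_zero (res_smul_eq_zero hs h2)
      refine ⟨t, ht, ?_⟩
      rwa [LinearMap.mem_ker, map_smul]
    obtain ⟨s, hs, h2⟩ := exists_smul_mem_of_finite h1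
    refine hs ((hp s).2 fun x => ?_)
    rw [mul_comm, map_mul, mul_smul]
    exact h2 x
  -- Transport `W ⊆ X_p` to `X`: `s` moves it into the image of `X`, and `t` kills the kernel of `X
  -- → X_p`. Both act injectively on `X_p`, so the resulting map `c` is nonzero.
  have h1 : IsDense p ((LinearMap.range (locUnit p X)).comap W.subtype) := by
    intro w
    obtain ⟨s, hs, x, hx⟩ := locUnit_exists w.1
    exact ⟨s, hs, x, hx.symm⟩
  obtain ⟨s, hs, hsW⟩ := exists_smul_mem_of_finite h1
  have h2 : IsDense p (⊥ : Submodule Λ (LinearMap.ker (locUnit p X))) := by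
    intro x
    obtain ⟨t, ht, h⟩ := locUnit_eq_zero x.2
    exact ⟨t, ht, Subtype.ext h⟩
  obtain ⟨t, ht, htK⟩ := exists_smul_mem_of_finite h2
  obtain ⟨c, hc⟩ := exists_factor_smul (locUnit p X) (W.subtype ∘ₗ mulBy Λ s W) t
    (fun x hx => congrArg Subtype.val (htK ⟨x, hx⟩)) fun w => hsW w
  refine ⟨LinearMap.range c, fun hc0 => hW0 ?_, hT.of_surjective (X := ModuleCat.of Λ W)
    (Y := ModuleCat.of Λ (LinearMap.range c)) c.rangeRestrict c.surjective_rangeRestrict hTW⟩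
  rw [eq_bot_iff]
  intro w hw
  have h3 : c ⟨w, hw⟩ = 0 := by
    rw [← Submodule.mem_bot Λ, ← hc0]
    exact ⟨_, rfl⟩
  have h4 := hc ⟨w, hw⟩
  rw [h3, map_zero] at h4
  exact res_smul_eq_zero hs (res_smul_eq_zero ht h4.symm)

/-- Membership in a torsion class is detected at the residue fields. -/
lemma IsTorsionClass.of_residue (hT : IsTorsionClass (modFg Λ) T) (X : ModuleCat.{u} Λ)
    [Module.Finite Λ X] (h : ∀ p : PrimeSpectrum R, locProp p T (ModuleCat.of (LocAlg Λ p)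
      ((locFunctor p).obj X ⧸ primeMul p ((locFunctor p).obj X)))) : T X := by
  have : IsNoetherianRing Λ := IsNoetherianRing.of_finite R Λ
  -- Take a maximal submodule `N` in `T`. If it is proper, the quotient contains a nonzero `V` in
  -- `T`, whose preimage is an extension in `T` larger than `N`.
  obtain ⟨N, hN, hmax⟩ := (wellFounded_gt (α := Submodule Λ X)).has_min
    {N | T (ModuleCat.of Λ N)} ⟨⊥, hT.of_subsingleton _⟩
  by_cases hNtop : N = ⊤
  · exact hT.of_surjective (X := ModuleCat.of Λ N) N.subtype
      (fun x => ⟨⟨x, hNtop ▸ trivial⟩, rfl⟩) hN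
  exfalso
  have : Nontrivial (ModuleCat.of Λ (X ⧸ N)) :=
    Submodule.Quotient.nontrivial_iff.2 hNtop
  -- The hypothesis passes to `X ⧸ N`, because its residue modules are factors of those of `X`.
  obtain ⟨V, hV, hTV⟩ := hT.exists_submodule (R := R) (ModuleCat.of Λ (X ⧸ N)) fun p => by
    let f : (locFunctor p).obj X →ₗ[LocAlg Λ p] (locFunctor p).obj (ModuleCat.of Λ (X ⧸ N)) :=
      ((locFunctor p).map (ModuleCat.ofHom N.mkQ)).hom
    have hf : Function.Surjective f := locMap_surjective _ N.mkQ_surjective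
    have hle : primeMul p ((locFunctor p).obj X) ≤ (primeMul p _).comap f := by
      refine Submodule.span_le.2 ?_
      rintro _ ⟨a, ha, z, rfl⟩
      exact Submodule.subset_span ⟨a, ha, f z, map_smul _ _ _⟩
    refine locProp_of_epi hT.of_epi (X := ModuleCat.of (LocAlg Λ p) (_ ⧸ _))
      (Y := ModuleCat.of (LocAlg Λ p) (_ ⧸ _)) (Submodule.mapQ _ _ f hle) ?_ (h p)
    intro y
    obtain ⟨y, rfl⟩ := Submodule.mkQ_surjective _ y
    obtain ⟨x, rfl⟩ := hf y
    exact ⟨Submodule.Quotient.mk x, rfl⟩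
  let N' : Submodule Λ X := V.comap N.mkQ
  have hNN' : N ≤ N' := fun x hx => by
    change N.mkQ x ∈ V
    have h : N.mkQ x = 0 := (Submodule.Quotient.mk_eq_zero N).2 hx
    rw [h]
    exact zero_mem V
  have hN' : T (ModuleCat.of Λ N') := by
    refine hT.of_exact (X₁ := ModuleCat.of Λ N) (X₂ := ModuleCat.of Λ N') (X₃ := ModuleCat.of Λ V)
      (Submodule.inclusion hNN') (N.mkQ.restrict fun x hx => hx) (Submodule.inclusion_injective _)
      ?_ ?_ hN hTV (inferInstanceAs (Module.Finite Λ N'))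
    · rintro ⟨y, hy⟩
      obtain ⟨x, rfl⟩ := N.mkQ_surjective y
      exact ⟨⟨x, hy⟩, rfl⟩
    · rintro ⟨x, hx⟩
      constructor
      · intro h
        have h' : N.mkQ x = 0 := congrArg Subtype.val h
        exact ⟨⟨x, (Submodule.Quotient.mk_eq_zero N).1 h'⟩, rfl⟩
      · rintro ⟨y, h⟩
        refine Subtype.ext ?_
        have h' : y.1 = x := congrArg Subtype.val h
        change N.mkQ x = 0
        rw [← h']
        exact (Submodule.Quotient.mk_eq_zero N).2 y.2
  refine hmax N' hN' (lt_of_le_of_ne hNN' fun heq => hV ?_)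
  rw [eq_bot_iff]
  intro y hy
  obtain ⟨x, rfl⟩ := N.mkQ_surjective y
  have hx : x ∈ N' := hy
  rw [← heq] at hx
  exact (Submodule.Quotient.mk_eq_zero N).2 hx

/-- `Φ_t` reflects the order. -/
lemma phiT_le_iff (T T' : Tors (modFg Λ)) : (∀ p, PhiT R Λ T p ≤ PhiT R Λ T' p) ↔ T ≤ T' := by
  constructor
  · intro h X hX
    have : Module.Finite Λ X := T.2.le _ hX
    refine T'.2.of_residue (R := R) X fun p => (h p _ ⟨?_, ?_⟩).1
    · exact locProp_of_epi T.2.of_epi (X := (locFunctor p).obj X)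
        (Y := ModuleCat.of (LocAlg Λ p) (_ ⧸ _)) (primeMul p _).mkQ
        (primeMul p _).mkQ_surjective ⟨X, hX, ⟨Iso.refl _⟩⟩
    · have := locFunctor_finite (p := p) (Y := X)
      exact modFl_quotient_primeMul _
  · rintro h p Z ⟨⟨Y, hY, e⟩, hZ⟩
    exact ⟨⟨Y, h Y hY, e⟩, hZ⟩

lemma phiT_mem_compatibleFamilies (T : Tors (modFg Λ)) : PhiT R Λ T ∈ compatibleFamilies R Λ :=
  ⟨fun _ => T.2.phiT, fun _ _ hqp => le_rMap T.2.of_epi T.2.le hqp⟩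

end Detection

/-! ### The torsion class of an order-preserving map -/

section Classification

variable {R Λ : Type u} [CommRing R] [Ring Λ] [Algebra R Λ] [IsNoetherianRing R] [Module.Finite R Λ]

lemma TwoSilt.fac_of_subsingleton {A : Type u} [Ring A] (x : TwoSilt A) (X : ModuleCat.{u} A)
    [Subsingleton X] : x.fac X := by
  obtain ⟨K, -, h⟩ := x.exists_fac_iff
  exact (h X inferInstance).2 fun g => ⟨0, LinearMap.ext fun _ => Subsingleton.elim _ _⟩

/-- The modules that are locally factor modules of the silting modules given by `f`. -/
def torsOf (f : PrimeSpectrum R → TwoSilt Λ) : ObjectProperty (ModuleCat.{u} Λ) := fun X =>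
  Module.Finite Λ X ∧ ∀ p, ((f p).localize p).fac ((locFunctor p).obj X)

/-- Localisation is exact, and at each prime membership is a vanishing condition, which is closed
under extensions. -/
lemma isTorsionClass_torsOf (f : PrimeSpectrum R → TwoSilt Λ) :
    IsTorsionClass (modFg Λ) (torsOf f) where
  le _ hX := hX.1
  zero X hX := by
    have : Subsingleton X := ModuleCat.subsingleton_of_isZero hX
    refine ⟨inferInstance, fun p => ?_⟩
    have : Subsingleton ((locFunctor p).obj X) :=
      ModuleCat.subsingleton_of_isZero ((locFunctor p).map_isZero hX)
    exact TwoSilt.fac_of_subsingleton _ _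
  factor X Y g hg hX hY := ⟨hY, fun p => TwoSilt.fac_of_epi _ ((locFunctor p).map g)
    ((ModuleCat.epi_iff_surjective _).2
      (locMap_surjective g ((ModuleCat.epi_iff_surjective g).1 hg))) (hX.2 p)⟩
  extension S hS h₁ h₃ h₂ := by
    refine ⟨h₂, fun p => ?_⟩
    obtain ⟨K, hK, h⟩ := ((f p).localize p).exists_fac_iff
    have := h₁.1
    have := h₃.1
    have : Module.Finite Λ S.X₂ := h₂
    have := locFunctor_finite (p := p) (Y := S.X₁)
    have := locFunctor_finite (p := p) (Y := S.X₂)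
    have := locFunctor_finite (p := p) (Y := S.X₃)
    have := (hK 0).2
    exact (h _ inferInstance).2 (ExtendsAlong.of_extension ((locFunctor p).map S.f).hom
      ((locFunctor p).map S.g).hom (locMap_injective _ hS.moduleCat_injective_f)
      (locMap_surjective _ hS.moduleCat_surjective_g)
      (locMap_exact _ _ ((ShortComplex.ShortExact.moduleCat_exact_iff_function_exact _).1 hS.exact))
      ((h _ inferInstance).1 (h₁.2 p)) ((h _ inferInstance).1 (h₃.2 p)))

/-- One inclusion is the condition at `p`. For the other, a dense submodule `N` of `Z` must be
checked at every prime, and the finite length of `Z` confines the support of `N` to primes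
containing `p`. -/
lemma phiT_torsOf {f : PrimeSpectrum R → TwoSilt Λ} (hf : ∀ p q, p ≤ q → f p ≤ f q)
    (p : PrimeSpectrum R) : PhiT R Λ ⟨torsOf f, isTorsionClass_torsOf f⟩ p =
      ((f p).localize p).fac ⊓ modFl _ := by
  have : IsNoetherianRing Λ := IsNoetherianRing.of_finite R Λ
  apply le_antisymm
  · rintro Z ⟨⟨Y, hY, ⟨e⟩⟩, hZ⟩
    exact ⟨TwoSilt.fac_of_epi _ e.inv inferInstance (hY.2 p), hZ⟩
  · rintro Z ⟨hZ, hZ'⟩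
    refine ⟨?_, hZ'⟩
    rw [TwoSilt.fac_localize,
      locProp_iff fun _ _ f hf h => TwoSilt.fac_of_epi _ f hf h] at hZ
    obtain ⟨N, hN, hd⟩ := hZ
    refine (locProp_iff (isTorsionClass_torsOf f).of_epi).2
      ⟨N, ⟨TwoSilt.finite_of_fac _ hN, fun q => ?_⟩, hd⟩
    by_cases hpq : p ≤ q
    -- Here `f p ≤ f q`, so `N` lies in the class of `f q` already over `Λ`.
    · rw [TwoSilt.fac_localize]
      exact ⟨_, (TwoSilt.le_iff_fac_le _ _).1 (hf p q hpq) _ hN, ⟨Iso.refl _⟩⟩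
    -- Some `a ∈ p` lies outside `q` and a power of it kills `N`, so `N_q = 0`.
    · obtain ⟨a, hap, haq⟩ : ∃ a ∈ p.asIdeal, a ∉ q.asIdeal := Set.not_subset.1 hpq
      obtain ⟨n, hn⟩ := exists_pow_smul_res_eq_zero hZ' hap
      have haq' : a ^ n ∉ q.asIdeal := fun h => haq (q.2.mem_of_pow_mem n h)
      have : Subsingleton (res q ((locFunctor q).obj (ModuleCat.of Λ N))) := by
        refine ⟨fun x y => ?_⟩
        rw [← sub_eq_zero]
        generalize x - y = x
        obtain ⟨s, hs, m, hm⟩ := locUnit_exists x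
        apply res_smul_eq_zero hs
        apply res_smul_eq_zero haq'
        have h0 : algebraMap R Λ (a ^ n) • m = 0 := Subtype.ext (hn m.1)
        rw [hm, ← map_smul, h0, map_zero]
      have : Subsingleton ((locFunctor q).obj (ModuleCat.of Λ N)) := (toRes _).injective.subsingleton
      exact TwoSilt.fac_of_subsingleton _ _

end Classification

/-! ### Compatible families as order-preserving maps -/

section Main

variable {R Λ : Type u} [CommRing R] [Ring Λ] [Algebra R Λ]

/-- The torsion class of finite length modules over `Λ_p` given by a silting complex over `Λ`. -/
noncomputable def TwoSilt.flAt (x : TwoSilt Λ) (p : PrimeSpectrum R) :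
    ObjectProperty (ModuleCat.{u} (LocAlg Λ p)) :=
  (x.localize p).fac ⊓ modFl (LocAlg Λ p)

/-- By (b) the class comes from a silting complex over `Λ_p`, which lifts to `Λ` by (a). -/
lemma TwoSilt.exists_flAt_eq {p : PrimeSpectrum R}
    (ha : ∃ e : TwoSilt Λ ≃o TwoSilt (LocAlg Λ p), ∀ P, e P = TwoSilt.localize p P)
    (hb : sTorsFl (LocAlg Λ p) = torsFl (LocAlg Λ p))
    {𝒳 : ObjectProperty (ModuleCat.{u} (LocAlg Λ p))}
    (h𝒳 : IsTorsionClass (modFl (LocAlg Λ p)) 𝒳) : ∃ x : TwoSilt Λ, x.flAt p = 𝒳 := by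
  obtain ⟨e, he⟩ := ha
  obtain ⟨M, ⟨P, hP, ⟨i⟩⟩, rfl⟩ : 𝒳 ∈ sTorsFl (LocAlg Λ p) := hb ▸ h𝒳
  let y : TwoSilt (LocAlg Λ p) := Quotient.mk (twoSiltSetoid _) ⟨P, hP⟩
  refine ⟨e.symm y, ?_⟩
  rw [TwoSilt.flAt, ← he, e.apply_symm_apply, fac_congr i]
  rfl

variable [IsNoetherianRing R] [Module.Finite R Λ]

/-- By (a) the order can be read over `Λ_p`, where modules of finite length determine it. -/
lemma TwoSilt.flAt_le_iff {p : PrimeSpectrum R}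
    (ha : ∃ e : TwoSilt Λ ≃o TwoSilt (LocAlg Λ p), ∀ P, e P = TwoSilt.localize p P)
    (x y : TwoSilt Λ) : x.flAt p ≤ y.flAt p ↔ x ≤ y := by
  obtain ⟨e, he⟩ := ha
  rw [← e.le_iff_le, he, he]
  exact (TwoSilt.le_iff_fac_inf_modFl_le _ _).symm

/-- Compatible families are given by order-preserving maps. -/
lemma exists_monotone_of_mem_compatibleFamilies
    (ha : ∀ p : PrimeSpectrum R, ∃ e : TwoSilt Λ ≃o TwoSilt (LocAlg Λ p),
      ∀ P : TwoSilt Λ, e P = TwoSilt.localize p P)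
    (hb : ∀ p : PrimeSpectrum R, sTorsFl (LocAlg Λ p) = torsFl (LocAlg Λ p))
    {𝒳 : ∀ p : PrimeSpectrum R, ObjectProperty (ModuleCat.{u} (LocAlg Λ p))}
    (h𝒳 : 𝒳 ∈ compatibleFamilies R Λ) :
    ∃ f : PosetHom (PrimeSpectrum R) (TwoSilt Λ), ∀ p, (f.1 p).flAt p = 𝒳 p := by
  choose f hf using fun p => TwoSilt.exists_flAt_eq (ha p) (hb p) (h𝒳.1 p)
  -- Monotonicity is tested at the smaller prime `q`, through `𝒳 q ⊆ r_{p,q}(𝒳 p)` and `rMap_le`.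
  refine ⟨⟨f, fun q p hqp => (TwoSilt.flAt_le_iff (ha q) _ _).1 ?_⟩, hf⟩
  rw [hf]
  refine (h𝒳.2 p q hqp).trans ?_
  rw [← hf]
  exact rMap_le _ hqp

lemma isCompatible_of_localize
    (ha : ∀ p : PrimeSpectrum R, ∃ e : TwoSilt Λ ≃o TwoSilt (LocAlg Λ p),
      ∀ P : TwoSilt Λ, e P = TwoSilt.localize p P)
    (hb : ∀ p : PrimeSpectrum R, sTorsFl (LocAlg Λ p) = torsFl (LocAlg Λ p)) :
    IsCompatible R Λ := by
  refine Set.Subset.antisymm ?_ fun 𝒳 h𝒳 => ?_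
  · rintro _ ⟨T, rfl⟩
    exact phiT_mem_compatibleFamilies T
  · obtain ⟨f, hf⟩ := exists_monotone_of_mem_compatibleFamilies ha hb h𝒳
    exact ⟨_, funext fun p => (phiT_torsOf f.2 p).trans (hf p)⟩

/-- Torsion classes correspond to order-preserving maps into the two-term silting complexes. -/
lemma exists_tors_orderIso
    (ha : ∀ p : PrimeSpectrum R, ∃ e : TwoSilt Λ ≃o TwoSilt (LocAlg Λ p),
      ∀ P : TwoSilt Λ, e P = TwoSilt.localize p P)
    (hb : ∀ p : PrimeSpectrum R, sTorsFl (LocAlg Λ p) = torsFl (LocAlg Λ p)) :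
    Nonempty (Tors (modFg Λ) ≃o PosetHom (PrimeSpectrum R) (TwoSilt Λ)) := by
  have : IsNoetherianRing Λ := IsNoetherianRing.of_finite R Λ
  choose F hF using fun T : Tors (modFg Λ) =>
    exists_monotone_of_mem_compatibleFamilies ha hb (phiT_mem_compatibleFamilies T)
  have hle : ∀ T T', F T ≤ F T' ↔ T ≤ T' := fun T T' => by
    rw [← phiT_le_iff (R := R)]
    refine forall_congr' fun p => ?_
    rw [← hF, ← hF]
    exact (TwoSilt.flAt_le_iff (ha p) _ _).symm
  refine ⟨{ toEquiv := Equiv.ofBijective F ⟨fun T T' h => ?_, fun f => ?_⟩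
            map_rel_iff' := hle _ _ }⟩
  · exact le_antisymm ((hle _ _).1 (h ▸ (hle T T).2 le_rfl)) ((hle _ _).1 (h ▸ (hle T T).2 le_rfl))
  -- The preimage of `f` is `torsOf f`: at each prime both maps give the same class of finite length
  -- modules, which determines the silting complex.
  · refine ⟨⟨torsOf f.1, isTorsionClass_torsOf f.1⟩, Subtype.ext (funext fun p => ?_)⟩
    have h := (hF ⟨torsOf f.1, isTorsionClass_torsOf f.1⟩ p).trans (phiT_torsOf f.2 p)
    exact TwoSilt.eq_of_fac_eq R (le_antisymm
      ((TwoSilt.le_iff_fac_le _ _).1 ((TwoSilt.flAt_le_iff (ha p) _ _).1 h.le))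
      ((TwoSilt.le_iff_fac_le _ _).1 ((TwoSilt.flAt_le_iff (ha p) _ _).1 h.ge)))

end Main

end SiltingTorsion

theorem theorem1p6 (R Λ : Type u) [CommRing R] [IsNoetherianRing R] [Ring Λ] [Algebra R Λ]
    [Module.Finite R Λ] (hR : RingIndecomposable R)
    (ha : ∀ p : PrimeSpectrum R, ∃ e : TwoSilt Λ ≃o TwoSilt (LocAlg Λ p),
      ∀ P : TwoSilt Λ, e P = TwoSilt.localize p P)
    (hb : ∀ p : PrimeSpectrum R, sTorsFl (LocAlg Λ p) = torsFl (LocAlg Λ p)) :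
    IsCompatible R Λ ∧
      Nonempty (Tors (modFg Λ) ≃o PosetHom (PrimeSpectrum R) (TwoSilt Λ)) := by
  exact ⟨isCompatible_of_localize ha hb, exists_tors_orderIso ha hb⟩
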